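/- **Setting.** Fix $E\ge 2$ workers. Worker $e\in\{1,\dots,E\}$ holds a weight block $w_e\in\mathbb R^{d_{w_e}}$ and a differentiable operator $a_e:\mathbb R^{d_{e-1}}\times\mathbb R^{d_{w_e}}\to\mathbb R^{d_e}$, with $d_E=1$; $\nabla_1a_e,\nabla_2a_e$ are its Jacobians in the first and second variable. For a sample $x\in\mathbb R^{d_0}$ put $y_0=x$, $y_e=a_e(y_{e-1},w_e)$, $L(x;\boldsymbol w)=y_E$, and $\ell(\boldsymbol w)=\mathbb E_{x\sim\mathcal D}L(x;\boldsymbol w)$, where $\boldsymbol w=(w_1,\dots,w_E)$. **Algorithm (Clapping-FU)** with step size $\gamma$, momentum coefficient $m$ and lazy sampling coefficient $p$. Start from $\boldsymbol w^{(1)}$, with $\tilde y_e^{(0)}=0$, $\tilde v_e^{(0)}=0$, $\tilde u_e^{(0)}=0$. Iteration $t=1$ draws $x^{(1)}\sim\mathcal D$ and is fresh. Iteration $t\ge2$ is fresh with probability $p$, and then draws a new $x^{(t)}\sim\mathcal D$; otherwise $x^{(t)}=x^{(t-1)}$. Let $\tilde y_0^{(t)}=x^{(t)}$ and $\tilde v_E^{(t)}=1$.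 - Forward, $e=1,\dots,E-1$: $y_e^{(t)}=a_e(\tilde y_{e-1}^{(t)},w_e^{(t)})$; set $\tilde y_e^{(t)}=y_e^{(t)}$ if the iteration is fresh, and $\tilde y_e^{(t)}=\tilde y_e^{(t-1)}+\mathcal C_F(y_e^{(t)}-\tilde y_e^{(t-1)})$ otherwise. - Backward, $e=E,\dots,2$: $v_{e-1}^{(t)}=\nabla_1a_e(\tilde y_{e-1}^{(t)},w_e^{(t)})^{\mathsf T}\tilde v_e^{(t)}$; set $\tilde v_{e-1}^{(t)}=v_{e-1}^{(t)}$ if the iteration is fresh, and $\tilde v_{e-1}^{(t)}=\tilde v_{e-1}^{(t-1)}+\mathcal C_B(v_{e-1}^{(t)}-\tilde v_{e-1}^{(t-1)})$ otherwise. - Update, $e=1,\dots,E$: $\tilde u_e^{(t)}=(1-m)\tilde u_e^{(t-1)}+m\,\nabla_2a_e(\tilde y_{e-1}^{(t)},w_e^{(t)})^{\mathsf T}\tilde v_e^{(t)}$ and $w_e^{(t+1)}=w_e^{(t)}-\gamma\tilde u_e^{(t)}$. Thus nothing is compressed at freshly sampled steps. The compressors may be randomized and may depend on the layer; all draws of samples,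 lazy sampling coins and compressor seeds are mutually independent. **Assumptions.** 1. $\ell$ is differentiable and $\nabla\ell$ is $L_{\nabla\ell}$-Lipschitz; the Jacobians $\nabla_1a_e,\nabla_2a_e$ are bounded by $C_a$ for $e=1,\dots,E$; for $e=1,\dots,E-1$, $a_e$ is $L_a$-Lipschitz and $\nabla_1a_{e+1},\nabla_2a_{e+1}$ are $L_{\nabla a}$-Lipschitz in (activation, weights). 2. For every $\boldsymbol w$, $L(\cdot;\boldsymbol w)$ is $\mathcal D$-integrable, $\mathbb E_x\nabla L(x;\boldsymbol w)=\nabla\ell(\boldsymbol w)$ and $\mathbb E_x\|\nabla L(x;\boldsymbol w)-\nabla\ell(\boldsymbol w)\|^2\le\sigma^2$. 3. For all $z$, $\mathbb E\|z-\mathcal C_F(z)\|^2\le\omega_F^2\|z\|^2$ and $\mathbb E\|z-\mathcal C_B(z)\|^2\le\omega_B^2\|z\|^2$, with $\omega_F,\omega_B\in[0,1)$. Moreover $\ell$ is bounded below with $\ell(\boldsymbol w^{(1)})-\inf\ell\le\Delta$. **Theorem.** Fix $E\ge2$ and constants $L_{\nabla\ell},C_a,L_a,L_{\nabla a},\Delta\ge0$.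 (a) There are $p\in(0,1]$ and $C>0$, depending only on these constants, such that for all $\sigma\ge0$, $\omega_F,\omega_B\in[0,1)$ and $T\ge1$ there are $\gamma>0$ and $m\in(0,1)$ such that for every problem, initial point and pair of compressors satisfying the assumptions, the iterates of Clapping-FU satisfy $$\frac1T\sum_{t=1}^T\mathbb E\left\|\nabla\ell(\boldsymbol w^{(t)})\right\|^2\le C\left(\frac{\sigma}{\sqrt T}+\frac1{T(1-\omega_B)^{E-1}(1-\omega_F)^{E-1}}\right),$$ the expectations being of integrable random variables. (b) For every prescribed $p\in(0,1]$ there is $C>0$, depending only on $p$ and these constants, such that the same conclusion holds for this $p$ (again with $\gamma,m$ depending only on $p$, $\sigma,\omega_F,\omega_B,T$ and these constants), for all problems which satisfy in addition that $\nabla_2a_1(x,\cdot)$ is $L_{\nabla a}$-Lipschitz for every $x$. -/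

import Mathlib

open MeasureTheory ProbabilityTheory
open scoped ENNReal

noncomputable section

namespace Clapping

/-- A pipeline of `E` workers.  Worker number `e + 1` (`e : Fin E`) owns the operator `a e`, which maps
the activation `y_e ∈ ℝ^{d e}` and the weight block `w_{e+1} ∈ ℝ^{dw e}` to the next activation
`y_{e+1}`.  Activations are indexed by `0, …, E`; activation `0` is the data sample and activation `E`
is the scalar loss, hence `d_last`. -/
structure Pipeline (E : ℕ) where
  /-- dimensions of the activations -/
  d : Fin (E + 1) → ℕ
  /-- dimensions of the weight blocks -/
  dw : Fin E → ℕ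
  d_last : d (Fin.last E) = 1
  /-- the operators of the workers -/
  a : ∀ e : Fin E, EuclideanSpace ℝ (Fin (d e.castSucc)) → EuclideanSpace ℝ (Fin (dw e)) →
    EuclideanSpace ℝ (Fin (d e.succ))

namespace Pipeline

variable {E : ℕ} (P : Pipeline E)

/-- The space of the `i`-th activation. -/
abbrev Act (i : Fin (E + 1)) : Type := EuclideanSpace ℝ (Fin (P.d i))

/-- The space of the weight block of one worker. -/
abbrev Wt (e : Fin E) : Type := EuclideanSpace ℝ (Fin (P.dw e))

/-- The space of all weights `w = (w_1, …, w_E)`, with the Euclidean norm. -/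
abbrev Params : Type := PiLp 2 (fun e : Fin E => P.Wt e)

/-- Jacobian of an operator with respect to the incoming activation. -/
def D1 (e : Fin E) (y : P.Act e.castSucc) (w : P.Wt e) : P.Act e.castSucc →L[ℝ] P.Act e.succ :=
  fderiv ℝ (fun y' => P.a e y' w) y

/-- Jacobian of an operator with respect to the weight block. -/
def D2 (e : Fin E) (y : P.Act e.castSucc) (w : P.Wt e) : P.Wt e →L[ℝ] P.Act e.succ :=
  fderiv ℝ (fun w' => P.a e y w') w

/-- The exact activations `y_0 = x`, `y_{e+1} = a_{e+1}(y_e, w_{e+1})`. -/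
def activation (x : P.Act 0) (w : P.Params) : ∀ i : Fin (E + 1), P.Act i :=
  fun i => Fin.induction (motive := fun i => P.Act i) x (fun e y => P.a e y (w e)) i

/-- The loss `L(x; w) = y_E` of one sample. -/
def loss (x : P.Act 0) (w : P.Params) : ℝ :=
  P.activation x w (Fin.last E) (Fin.cast P.d_last.symm 0)

/-- The objective `ℓ(w) = 𝔼_{x ∼ D} L(x; w)`. -/
def risk (D : Measure (P.Act 0)) (w : P.Params) : ℝ := ∫ x, P.loss x w ∂D

/-- The smoothness assumption.  The gradient of each operator is given by its two partial Jacobians.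
Joint Lipschitz continuity is written with `‖y - y'‖ + ‖w - w'‖`, which is implied by Lipschitz
continuity for the Euclidean norm of the pair and by Lipschitz continuity in each variable separately.
The operators `a_1, …, a_{E-1}` are `La`-Lipschitz, and the Jacobians of `a_2, …, a_E` (but not those
of `a_1`) are `LG`-Lipschitz. -/
structure Smooth (D : Measure (P.Act 0)) (Ll Ca La LG : ℝ) : Prop where
  risk_differentiable : Differentiable ℝ (P.risk D)
  risk_lipschitz : ∀ w w' : P.Params,
    ‖gradient (P.risk D) w - gradient (P.risk D) w'‖ ≤ Ll * ‖w - w'‖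
  differentiable : ∀ e : Fin E,
    Differentiable ℝ (fun z : P.Act e.castSucc × P.Wt e => P.a e z.1 z.2)
  D1_bound : ∀ (e : Fin E) (y : P.Act e.castSucc) (w : P.Wt e), ‖P.D1 e y w‖ ≤ Ca
  D2_bound : ∀ (e : Fin E) (y : P.Act e.castSucc) (w : P.Wt e), ‖P.D2 e y w‖ ≤ Ca
  a_lipschitz : ∀ e : Fin E, e.succ ≠ Fin.last E →
    ∀ (y y' : P.Act e.castSucc) (w w' : P.Wt e),
      ‖P.a e y w - P.a e y' w'‖ ≤ La * (‖y - y'‖ + ‖w - w'‖)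
  D1_lipschitz : ∀ e : Fin E, (e : ℕ) ≠ 0 →
    ∀ (y y' : P.Act e.castSucc) (w w' : P.Wt e),
      ‖P.D1 e y w - P.D1 e y' w'‖ ≤ LG * (‖y - y'‖ + ‖w - w'‖)
  D2_lipschitz : ∀ e : Fin E, (e : ℕ) ≠ 0 →
    ∀ (y y' : P.Act e.castSucc) (w w' : P.Wt e),
      ‖P.D2 e y w - P.D2 e y' w'‖ ≤ LG * (‖y - y'‖ + ‖w - w'‖)

/-- The weight Jacobian of the first operator is `LG`-Lipschitz in the weights, uniformly in the
sample. -/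
def FirstLayerSmooth (LG : ℝ) : Prop :=
  ∀ e : Fin E, (e : ℕ) = 0 → ∀ (x : P.Act e.castSucc) (w w' : P.Wt e),
    ‖P.D2 e x w - P.D2 e x w'‖ ≤ LG * ‖w - w'‖

/-- The stochastic gradient assumption: `∇L(x; w)`, `x ∼ D`, is an unbiased estimate of `∇ℓ(w)` with
variance at most `σ²`, at every point `w`. -/
structure Unbiased (D : Measure (P.Act 0)) (σ : ℝ) : Prop where
  loss_integrable : ∀ w : P.Params, Integrable (fun x => P.loss x w) D
  unbiased : ∀ w : P.Params, ∫ x, gradient (P.loss x) w ∂D = gradient (P.risk D) w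
  variance : ∀ w : P.Params,
    ∫⁻ x, ‖gradient (P.loss x) w - gradient (P.risk D) w‖ₑ ^ 2 ∂D ≤ ENNReal.ofReal (σ ^ 2)

/-- A family of randomized compressors, one for each activation space; the first argument is a random
seed.  Only the compressors of the communicated activations `1, …, E - 1` are ever relevant. -/
abbrev Compressor (S : Type*) := ∀ i : Fin (E + 1), S → P.Act i → P.Act i

/-- The contractive compressor assumption, `𝔼‖z - 𝒞(z)‖² ≤ ω² ‖z‖²`, the seed having law `ν`. -/
structure Contractive {S : Type*} [MeasurableSpace S] (ν : Measure S) (C : P.Compressor S) (ω : ℝ) :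
    Prop where
  measurable : ∀ i : Fin (E + 1), i ≠ 0 → i ≠ Fin.last E →
    Measurable (fun q : S × P.Act i => C i q.1 q.2)
  contractive : ∀ i : Fin (E + 1), i ≠ 0 → i ≠ Fin.last E → ∀ z : P.Act i,
    ∫⁻ s, ‖z - C i s z‖ₑ ^ 2 ∂ν ≤ ENNReal.ofReal (ω ^ 2 * ‖z‖ ^ 2)

/-! ### The algorithm -/

/-- What is kept after iteration `t`: the sample `x^{(t)}`, the activations `ỹ^{(t)}`, the activation
gradients `ṽ^{(t)}`, the momentum `ũ^{(t)}` and the weights `w^{(t+1)}`. -/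
structure State where
  /-- the current sample -/
  x : P.Act 0
  /-- the communicated activations -/
  y : ∀ i : Fin (E + 1), P.Act i
  /-- the communicated activation gradients -/
  v : ∀ i : Fin (E + 1), P.Act i
  /-- the momentum -/
  u : P.Params
  /-- the weights -/
  w : P.Params

/-- The forward pass, returning the communicated activations `ỹ_0 = x, ỹ_1, …`.  Worker `e + 1` computes
`y = a_{e+1}(ỹ_e, w_{e+1})`; on a fresh sample it is sent uncompressed, otherwise it is sent with
error feedback, `ỹ = ỹ_old + 𝒞(y - ỹ_old)`.  (The entry with index `E` is never used.) -/
def forward {S : Type*} (CF : P.Compressor S) (fresh : Bool) (s : Fin (E + 1) → S)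
    (x : P.Act 0) (w : P.Params) (yOld : ∀ i, P.Act i) : ∀ i : Fin (E + 1), P.Act i :=
  fun i => Fin.induction (motive := fun i => P.Act i) x
    (fun e yt =>
      if fresh then P.a e yt (w e)
      else yOld e.succ + CF e.succ (s e.succ) (P.a e yt (w e) - yOld e.succ)) i

/-- The backward pass, returning the communicated activation gradients `ṽ_E = 1, ṽ_{E-1}, …`.  Worker
`e + 1` computes `v = ∇₁a_{e+1}(ỹ_e, w_{e+1})ᵀ ṽ_{e+1}`; on a fresh sample it is sent uncompressed,
otherwise it is sent with error feedback.  (The entry with index `0` is never used.) -/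
def backward {S : Type*} (CB : P.Compressor S) (fresh : Bool) (s : Fin (E + 1) → S)
    (y : ∀ i, P.Act i) (w : P.Params) (vOld : ∀ i, P.Act i) : ∀ i : Fin (E + 1), P.Act i :=
  fun i => Fin.reverseInduction (motive := fun i => P.Act i) (WithLp.toLp 2 (fun _ => 1))
    (fun e vt =>
      if fresh then (P.D1 e (y e.castSucc) (w e)).adjoint vt
      else vOld e.castSucc + CB e.castSucc (s e.castSucc)
        ((P.D1 e (y e.castSucc) (w e)).adjoint vt - vOld e.castSucc)) i

/-- One iteration of Clapping-FU with step size `γ` and momentum coefficient `m`.  If `fresh` is true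
the new sample `ξ` is used, and nothing is compressed; otherwise the previous sample is retained. -/
def step {S : Type*} (CF CB : P.Compressor S) (γ m : ℝ) (fresh : Bool) (ξ : P.Act 0)
    (sF sB : Fin (E + 1) → S) (st : P.State) : P.State :=
  let x := if fresh then ξ else st.x
  let y := P.forward CF fresh sF x st.w st.y
  let v := P.backward CB fresh sB y st.w st.v
  let u : P.Params := WithLp.toLp 2 fun e =>
    (1 - m) • st.u e + m • (P.D2 e (y e.castSucc) (st.w e)).adjoint (v e.succ)
  { x := x, y := y, v := v, u := u, w := st.w - γ • u }

/-- The random inputs of the algorithm; iterations are counted from `0` here. -/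
structure Source (S Ω : Type*) where
  /-- the sample that is drawn if the iteration is fresh -/
  sample : ℕ → Ω → P.Act 0
  /-- the lazy sampling coin; `true` means that a new sample is drawn -/
  flag : ℕ → Ω → Bool
  /-- seeds of the forward compressors -/
  seedF : ℕ → Fin (E + 1) → Ω → S
  /-- seeds of the backward compressors -/
  seedB : ℕ → Fin (E + 1) → Ω → S

/-- The state after `n` iterations, started from the weights `w₁` with zero memory and momentum.  The
first iteration always draws a sample, and this counts as a fresh one. -/
def run {S Ω : Type*} (CF CB : P.Compressor S) (γ m : ℝ) (w₁ : P.Params) (X : P.Source S Ω) (ω : Ω) :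
    ℕ → P.State
  | 0 => { x := 0, y := fun _ => 0, v := fun _ => 0, u := 0, w := w₁ }
  | n + 1 =>
    P.step CF CB γ m (n == 0 || X.flag n ω) (X.sample n ω) (fun i => X.seedF n i ω)
      (fun i => X.seedB n i ω) (run CF CB γ m w₁ X ω n)

/-- The weights `w^{(t)}`, `t = 1, 2, …`, at which iteration `t` evaluates the gradient. -/
def weights {S Ω : Type*} (CF CB : P.Compressor S) (γ m : ℝ) (w₁ : P.Params) (X : P.Source S Ω)
    (t : ℕ) (ω : Ω) : P.Params :=
  (P.run CF CB γ m w₁ X ω (t - 1)).w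

/-- Names of the individual random inputs. -/
inductive Input (E : ℕ) where
  | sample (t : ℕ)
  | flag (t : ℕ)
  | seedF (t : ℕ) (i : Fin (E + 1))
  | seedB (t : ℕ) (i : Fin (E + 1))

/-- The σ-algebra generated by one random input. -/
@[reducible] def Source.sigma {P : Pipeline E} {S Ω : Type*} [MeasurableSpace S] (X : P.Source S Ω) :
    Input E → MeasurableSpace Ω
  | .sample t => MeasurableSpace.comap (X.sample t) inferInstance
  | .flag t => MeasurableSpace.comap (X.flag t) inferInstance
  | .seedF t i => MeasurableSpace.comap (X.seedF t i) inferInstance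
  | .seedB t i => MeasurableSpace.comap (X.seedB t i) inferInstance

/-- The random inputs are mutually independent; samples have law `D`, coins are `true` with probability
`p`, and seeds have law `ν`. -/
structure Source.IsDriver {P : Pipeline E} {S Ω : Type*} [MeasurableSpace S] [MeasurableSpace Ω]
    (X : P.Source S Ω) (D : Measure (P.Act 0)) (ν : Measure S) (p : ℝ) (μ : Measure Ω) : Prop where
  sample_measurable : ∀ t, Measurable (X.sample t)
  flag_measurable : ∀ t, Measurable (X.flag t)
  seedF_measurable : ∀ t i, Measurable (X.seedF t i)
  seedB_measurable : ∀ t i, Measurable (X.seedB t i)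
  sample_law : ∀ t, μ.map (X.sample t) = D
  flag_law : ∀ t, μ {ω | X.flag t ω = true} = ENNReal.ofReal p
  seedF_law : ∀ t i, μ.map (X.seedF t i) = ν
  seedB_law : ∀ t i, μ.map (X.seedB t i) = ν
  indep : iIndep X.sigma μ

end Pipeline

end Clapping

end

/-! The proof never uses that the compressors contract. A compressor with constant `1` leaves, in
mean square, a residual no larger than its input, and the contraction comes from the fresh
iterations: with probability `p`, independently of the past, every memory is overwritten by the
uncompressed message, so only a share `1 - p` of an old squared error survives.

On a stale iteration the sample does not change, so the exact activations and activation gradients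
move only because the weights do, by at most a constant times `γ‖u‖`. The squared tracking error of
a layer therefore satisfies a recursion with factor `(1 + p/4)² (1 - p)`, driven by the errors of
the layers that feed it and by `γ²‖u‖²`. This is `lintegral_tracking_le`. Summation over time and
induction over the layers give `sum_yErr_le` and `sum_vErr_le`.

Stale iterations reuse a sample on which the current weights already depend, so the sample gradient
at the current weights is not conditionally unbiased. The noise is therefore frozen at `wRef`, the
weights at the last refresh, which were determined before that sample was drawn. The price is the
drift from `wRef` to the current weights. It requires sample gradients that are Lipschitz in the
weights, hence smoothness of the first layer; if `p = 1`, almost every path is always fresh and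
there is no drift, which is why part (a) needs no such assumption. The distance to `wRef` obeys the
same tracking recursion. Altogether the accumulated squared bias is at most a constant times `γ² ∑
𝔼‖u‖²` (`sum_bias_le`).

The frozen noise stays correlated over about `1/p` iterations, so its momentum average has second
moment of order `m σ² / p` (`integral_norm_sq_avgNoise_le`).

Finally a pathwise descent argument for momentum (`sum_norm_sq_gradient_le`) leaves a multiple of `∑
‖u‖²` on the good side. With `γ = c m` and `c` small in terms of the smoothness constants and `p`,
every other occurrence of `∑ 𝔼‖u‖²` is absorbed there. What remains is of order `1/m + m σ² T`,
balanced by `m = 1 / (2 + σ√T)`. The outcome `σ/√T + 1/T` does not contain the compression constants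
and is stronger than the asserted rate. -/

noncomputable section

namespace Clapping

namespace Pipeline

variable {E : ℕ} (P : Pipeline E)

/-! ### Exact activations, exact activation gradients and the gradient of the loss -/

@[simp] lemma activation_zero (x : P.Act 0) (w : P.Params) : P.activation x w 0 = x := rfl

@[simp] lemma activation_succ (x : P.Act 0) (w : P.Params) (e : Fin E) :
    P.activation x w e.succ = P.a e (P.activation x w e.castSucc) (w e) := by
  simp [activation]

/-- The exact activation gradients `v_E = 1`, `v_{e-1} = ∇₁a_e(y_{e-1}, w_e)ᵀ v_e`. -/
def costate (x : P.Act 0) (w : P.Params) : ∀ i : Fin (E + 1), P.Act i :=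
  fun i => Fin.reverseInduction (motive := fun i => P.Act i) (WithLp.toLp 2 (fun _ => 1))
    (fun e vt => (P.D1 e (P.activation x w e.castSucc) (w e)).adjoint vt) i

@[simp] lemma costate_last (x : P.Act 0) (w : P.Params) :
    P.costate x w (Fin.last E) = WithLp.toLp 2 (fun _ => 1) := by
  simp [costate]

@[simp] lemma costate_castSucc (x : P.Act 0) (w : P.Params) (e : Fin E) :
    P.costate x w e.castSucc =
      (P.D1 e (P.activation x w e.castSucc) (w e)).adjoint (P.costate x w e.succ) := by
  simp [costate]

/-- Backpropagation: the gradient of the loss of one sample. -/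
def lossGrad (x : P.Act 0) (w : P.Params) : P.Params :=
  WithLp.toLp 2 fun e =>
    (P.D2 e (P.activation x w e.castSucc) (w e)).adjoint (P.costate x w e.succ)

/-- Stated for a free `n`, so that the equation can be substituted; `P.d_last` itself cannot be. -/
lemma inner_toLp_one {n : ℕ} (hn : n = 1) (z : EuclideanSpace ℝ (Fin n)) :
    inner ℝ (WithLp.toLp 2 (fun _ => 1) : EuclideanSpace ℝ (Fin n)) z = z (Fin.cast hn.symm 0) := by
  subst hn
  simp [PiLp.inner_apply]

lemma norm_toLp_one {n : ℕ} (hn : n = 1) :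
    ‖(WithLp.toLp 2 (fun _ => 1) : EuclideanSpace ℝ (Fin n))‖ = 1 := by
  subst hn
  simp [EuclideanSpace.norm_eq]

lemma fin_sum_telescope {n : ℕ} (f : Fin (n + 1) → ℝ) :
    ∑ e : Fin n, (f e.succ - f e.castSucc) = f (Fin.last n) - f 0 := by
  have h1 := Fin.sum_univ_succ f
  have h2 := Fin.sum_univ_castSucc f
  rw [Finset.sum_sub_distrib]
  linarith

/-- The derivative of the activations with respect to the weights. -/
def tangent (x : P.Act 0) (w : P.Params) : ∀ i : Fin (E + 1), P.Params →L[ℝ] P.Act i :=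
  fun i => Fin.induction (motive := fun i => P.Params →L[ℝ] P.Act i) 0
    (fun e J => (P.D1 e (P.activation x w e.castSucc) (w e)).comp J +
      (P.D2 e (P.activation x w e.castSucc) (w e)).comp (PiLp.proj 2 (fun e => P.Wt e) e)) i

lemma tangent_succ (x : P.Act 0) (w : P.Params) (e : Fin E) :
    P.tangent x w e.succ = (P.D1 e (P.activation x w e.castSucc) (w e)).comp
      (P.tangent x w e.castSucc) +
      (P.D2 e (P.activation x w e.castSucc) (w e)).comp (PiLp.proj 2 (fun e => P.Wt e) e) := by
  simp [tangent]

variable {P}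

/-- The chain rule along the two coordinate inclusions identifies the restrictions of the total
derivative with `D1` and `D2`. Joint differentiability is essential here. -/
lemma hasFDerivAt_operator {e : Fin E}
    (h : Differentiable ℝ (fun z : P.Act e.castSucc × P.Wt e => P.a e z.1 z.2))
    (y : P.Act e.castSucc) (w : P.Wt e) :
    HasFDerivAt (fun z : P.Act e.castSucc × P.Wt e => P.a e z.1 z.2)
      ((P.D1 e y w).comp (ContinuousLinearMap.fst ℝ _ _) +
        (P.D2 e y w).comp (ContinuousLinearMap.snd ℝ _ _)) (y, w) := by
  have hf := (h (y, w)).hasFDerivAt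
  have h1 : P.D1 e y w = (fderiv ℝ (fun z : P.Act e.castSucc × P.Wt e => P.a e z.1 z.2) (y, w)).comp
      (ContinuousLinearMap.inl ℝ _ _) :=
    (HasFDerivAt.comp (f := fun y' => (y', w)) y hf (hasFDerivAt_prodMk_left y w)).fderiv
  have h2 : P.D2 e y w = (fderiv ℝ (fun z : P.Act e.castSucc × P.Wt e => P.a e z.1 z.2) (y, w)).comp
      (ContinuousLinearMap.inr ℝ _ _) :=
    (HasFDerivAt.comp (f := fun w' => (y, w')) w hf (hasFDerivAt_prodMk_right y w)).fderiv
  refine hf.congr_fderiv ?_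
  rw [h1, h2]
  refine ContinuousLinearMap.ext fun z => ?_
  simp [← map_add]

lemma hasFDerivAt_activation
    (h : ∀ e : Fin E, Differentiable ℝ (fun z : P.Act e.castSucc × P.Wt e => P.a e z.1 z.2))
    (x : P.Act 0) (w : P.Params) (i : Fin (E + 1)) :
    HasFDerivAt (fun w => P.activation x w i) (P.tangent x w i) w := by
  induction i using Fin.induction with
  | zero => exact hasFDerivAt_const x w
  | succ e ih =>
    have h1 : HasFDerivAt (fun w : P.Params => w e) (PiLp.proj 2 (fun e => P.Wt e) e) w :=
      (PiLp.proj (𝕜 := ℝ) 2 (fun e => P.Wt e) e).hasFDerivAt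
    have h2 := (hasFDerivAt_operator (h e) (P.activation x w e.castSucc) (w e)).comp w
      (ih.prodMk h1)
    simp only [activation_succ]
    refine h2.congr_fderiv ?_
    rw [tangent_succ]
    ext z : 1
    simp

/-- Backpropagation as adjointness: from one layer to the next, the pairing of costate and tangent
grows by exactly the contribution of one weight block, since the `D1` terms cancel. The pairing
vanishes at layer `0`, so the increments telescope. -/
lemma inner_costate_tangent (x : P.Act 0) (w δ : P.Params) :
    inner ℝ (P.costate x w (Fin.last E)) (P.tangent x w (Fin.last E) δ) =
      inner ℝ (P.lossGrad x w) δ := by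
  have h := fin_sum_telescope (fun i => inner ℝ (P.costate x w i) (P.tangent x w i δ))
  have h0 : P.tangent x w 0 δ = 0 := rfl
  rw [h0, inner_zero_right, sub_zero] at h
  rw [← h, PiLp.inner_apply]
  refine Finset.sum_congr rfl fun e _ => ?_
  simp [tangent_succ, lossGrad, inner_add_right, ContinuousLinearMap.adjoint_inner_left]

lemma hasGradientAt_loss
    (h : ∀ e : Fin E, Differentiable ℝ (fun z : P.Act e.castSucc × P.Wt e => P.a e z.1 z.2))
    (x : P.Act 0) (w : P.Params) : HasGradientAt (P.loss x) (P.lossGrad x w) w := by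
  rw [hasGradientAt_iff_hasFDerivAt]
  have h1 := hasFDerivAt_activation h x w (Fin.last E)
  have h2 := ((innerSL ℝ (P.costate x w (Fin.last E))).hasFDerivAt).comp w h1
  have h3 : P.loss x = (innerSL ℝ (P.costate x w (Fin.last E))) ∘
      (fun w => P.activation x w (Fin.last E)) := by
    funext w'
    simp only [Function.comp, innerSL_apply_apply, costate_last]
    rw [inner_toLp_one P.d_last]
    rfl
  rw [h3]
  refine h2.congr_fderiv ?_
  refine ContinuousLinearMap.ext fun δ => ?_
  simp only [InnerProductSpace.toDual_apply_apply, ContinuousLinearMap.comp_apply,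
    innerSL_apply_apply]
  exact inner_costate_tangent x w δ

/-! ### Bounds -/

lemma Smooth.mono {D : Measure (P.Act 0)} {Ll Ca La LG M : ℝ} (h : P.Smooth D Ll Ca La LG)
    (h1 : Ll ≤ M) (h2 : Ca ≤ M) (h3 : La ≤ M) (h4 : LG ≤ M) : P.Smooth D M M M M where
  risk_differentiable := h.risk_differentiable
  risk_lipschitz w w' := (h.risk_lipschitz w w').trans (by gcongr)
  differentiable := h.differentiable
  D1_bound e y w := (h.D1_bound e y w).trans h2
  D2_bound e y w := (h.D2_bound e y w).trans h2
  a_lipschitz e he y y' w w' := (h.a_lipschitz e he y y' w w').trans (by gcongr)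
  D1_lipschitz e he y y' w w' := (h.D1_lipschitz e he y y' w w').trans (by gcongr)
  D2_lipschitz e he y y' w w' := (h.D2_lipschitz e he y y' w w').trans (by gcongr)

/-- A common bound for the exact activation gradients and for the Lipschitz constants of the exact
activations and activation gradients as functions of the weights. -/
def flowBound (E : ℕ) (M : ℝ) : ℝ := (2 * M) ^ (3 * E + 1)

lemma pow_le_flowBound {M : ℝ} (hM : 1 ≤ M) {k : ℕ} (hk : k ≤ 3 * E + 1) :
    (2 * M) ^ k ≤ flowBound E M :=
  pow_le_pow_right₀ (by linarith) hk

lemma one_le_flowBound {M : ℝ} (hM : 1 ≤ M) : 1 ≤ flowBound E M :=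
  one_le_pow₀ (by linarith)

lemma norm_adjoint_le {V W : Type*} [NormedAddCommGroup V] [InnerProductSpace ℝ V]
    [CompleteSpace V] [NormedAddCommGroup W] [InnerProductSpace ℝ W] [CompleteSpace W]
    {A : V →L[ℝ] W} {M : ℝ} (hA : ‖A‖ ≤ M) (v : W) : ‖A.adjoint v‖ ≤ M * ‖v‖ := by
  refine (A.adjoint.le_opNorm v).trans ?_
  rw [LinearIsometryEquiv.norm_map]
  gcongr

/-- The difference is split so that only `v'` has to be bounded. In the applications `v'` is an
exact activation gradient, whereas the communicated ones carry no a priori bound. -/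
lemma norm_adjoint_sub_le {V W : Type*} [NormedAddCommGroup V] [InnerProductSpace ℝ V]
    [CompleteSpace V] [NormedAddCommGroup W] [InnerProductSpace ℝ W] [CompleteSpace W]
    {A A' : V →L[ℝ] W} {M L : ℝ} (hA : ‖A‖ ≤ M) (hL : ‖A - A'‖ ≤ L) (v v' : W) :
    ‖A.adjoint v - A'.adjoint v'‖ ≤ M * ‖v - v'‖ + L * ‖v'‖ := by
  have h : A.adjoint v - A'.adjoint v' = A.adjoint (v - v') + (A - A').adjoint v' := by
    simp [map_sub]
  rw [h]
  exact (norm_add_le _ _).trans (add_le_add (norm_adjoint_le hA _) (norm_adjoint_le hL _))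

lemma norm_block_le (w : P.Params) (e : Fin E) : ‖w e‖ ≤ ‖w‖ := PiLp.norm_apply_le w e

section Bounds

variable {D : Measure (P.Act 0)} {M : ℝ} (h : P.Smooth D M M M M) (hM : 1 ≤ M)
include h hM

/-- Each layer multiplies the previous difference by `M` and adds at most `M ‖w - w'‖`; a factor `2
* M` per layer covers both. The last operator is not assumed Lipschitz. -/
lemma norm_activation_sub_le (x : P.Act 0) (w w' : P.Params) (i : Fin (E + 1))
    (hi : i ≠ Fin.last E) :
    ‖P.activation x w i - P.activation x w' i‖ ≤ (2 * M) ^ (i : ℕ) * ‖w - w'‖ := by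
  induction i using Fin.induction with
  | zero => simp
  | succ e ih =>
    have h1 := ih (Fin.castSucc_lt_last e).ne
    simp only [activation_succ]
    refine (h.a_lipschitz e hi _ _ _ _).trans ?_
    have h2 : ‖w e - w' e‖ ≤ ‖w - w'‖ := norm_block_le (w - w') e
    have h3 : 1 ≤ (2 * M) ^ (e : ℕ) := one_le_pow₀ (by linarith)
    calc _ ≤ M * ((2 * M) ^ (e : ℕ) * ‖w - w'‖ + (2 * M) ^ (e : ℕ) * ‖w - w'‖) := by
          gcongr
          · simpa using h1
          · exact h2.trans (le_mul_of_one_le_left (norm_nonneg _) h3)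
      _ = _ := by
          rw [Fin.val_succ, pow_succ]
          ring

lemma norm_costate_le_pow (x : P.Act 0) (w : P.Params) (i : Fin (E + 1)) :
    ‖P.costate x w i‖ ≤ M ^ (E - (i : ℕ)) := by
  induction i using Fin.reverseInduction with
  | last => rw [costate_last, norm_toLp_one P.d_last]; simp
  | cast e ih =>
    rw [costate_castSucc]
    refine (norm_adjoint_le (h.D1_bound e _ _) _).trans ?_
    have : E - ((e.castSucc : Fin (E + 1)) : ℕ) = (E - ((e.succ : Fin (E + 1)) : ℕ)) + 1 := by
      simp; omega
    rw [this, pow_succ']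
    gcongr

lemma norm_costate_le' (x : P.Act 0) (w : P.Params) (i : Fin (E + 1)) :
    ‖P.costate x w i‖ ≤ (2 * M) ^ E :=
  (norm_costate_le_pow h hM x w i).trans <|
    (pow_le_pow_right₀ hM (Nat.sub_le _ _)).trans (pow_le_pow_left₀ (by linarith) (by linarith) _)

lemma norm_costate_le (x : P.Act 0) (w : P.Params) (i : Fin (E + 1)) :
    ‖P.costate x w i‖ ≤ flowBound E M :=
  (norm_costate_le' h hM x w i).trans (pow_le_flowBound hM (by omega))

/-- The Jacobian varies by `2 * M` times the Lipschitz bound `(2 * M) ^ E` of the activations, and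
acts on a costate of size `(2 * M) ^ E`: this is the exponent `2 * E + 1`. Propagation through the
remaining layers costs at most another `(2 * M) ^ E`, whence the exponent in `flowBound`. Index `0`
is excluded because `D1` of the first operator need not be Lipschitz. -/
lemma norm_costate_sub_le_pow (x : P.Act 0) (w w' : P.Params) (i : Fin (E + 1)) (hi : i ≠ 0) :
    ‖P.costate x w i - P.costate x w' i‖ ≤
      (2 * M) ^ (2 * E + 1) * (2 * M) ^ (E - (i : ℕ)) * ‖w - w'‖ := by
  induction i using Fin.reverseInduction with
  | last => simp only [costate_last, sub_self, norm_zero]; positivity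
  | cast e ih =>
    have h1 := ih (Fin.succ_ne_zero e)
    have he : (e : ℕ) ≠ 0 := fun h0 => hi (Fin.ext (by simpa using h0))
    simp only [costate_castSucc]
    refine (norm_adjoint_sub_le (h.D1_bound e _ _) (h.D1_lipschitz e he _ _ _ _) _ _).trans ?_
    have h2 : ‖w e - w' e‖ ≤ ‖w - w'‖ := norm_block_le (w - w') e
    have h3 := norm_activation_sub_le h hM x w w' e.castSucc (Fin.castSucc_lt_last e).ne
    have h4 := norm_costate_le' h hM x w' e.succ
    have hp : ∀ k, 1 ≤ (2 * M) ^ k := fun k => one_le_pow₀ (by linarith)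
    have h5 : (2 * M) ^ ((e.castSucc : Fin (E + 1)) : ℕ) ≤ (2 * M) ^ E :=
      pow_le_pow_right₀ (by linarith) (by simp)
    have e1 : E - ((e.castSucc : Fin (E + 1)) : ℕ) = (E - ((e.succ : Fin (E + 1)) : ℕ)) + 1 := by
      simp; omega
    rw [e1]
    set k := E - ((e.succ : Fin (E + 1)) : ℕ)
    have hw := norm_nonneg (w - w')
    calc _ ≤ M * ((2 * M) ^ (2 * E + 1) * (2 * M) ^ k * ‖w - w'‖) +
          M * ((2 * M) ^ E * ‖w - w'‖ + (2 * M) ^ E * ‖w - w'‖) * (2 * M) ^ E := by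
          gcongr
          · exact h3.trans (by gcongr)
          · exact h2.trans (le_mul_of_one_le_left hw (hp E))
      _ = (M * (2 * M) ^ k + 1) * (2 * M) ^ (2 * E + 1) * ‖w - w'‖ := by ring
      _ ≤ (M * (2 * M) ^ k + M * (2 * M) ^ k) * (2 * M) ^ (2 * E + 1) * ‖w - w'‖ := by
          gcongr
          exact one_le_mul_of_one_le_of_one_le hM (hp k)
      _ = _ := by ring

lemma norm_activation_sub_le_flow (x : P.Act 0) (w w' : P.Params) (i : Fin (E + 1))
    (hi : i ≠ Fin.last E) :
    ‖P.activation x w i - P.activation x w' i‖ ≤ flowBound E M * ‖w - w'‖ :=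
  (norm_activation_sub_le h hM x w w' i hi).trans <| by
    gcongr
    exact pow_le_flowBound hM (by omega)

lemma norm_costate_sub_le (x : P.Act 0) (w w' : P.Params) (i : Fin (E + 1)) (hi : i ≠ 0) :
    ‖P.costate x w i - P.costate x w' i‖ ≤ flowBound E M * ‖w - w'‖ :=
  (norm_costate_sub_le_pow h hM x w w' i hi).trans <| by
    rw [← pow_add]
    gcongr
    exact pow_le_flowBound hM (by omega)

lemma norm_lossGrad_block_le (x : P.Act 0) (w : P.Params) (e : Fin E) :
    ‖P.lossGrad x w e‖ ≤ M * flowBound E M :=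
  (norm_adjoint_le (h.D2_bound e _ _) _).trans (by gcongr; exact norm_costate_le h hM x w _)

/-- `hF` is needed only for the first block, where the incoming activation is the sample itself and
does not vary with the weights; elsewhere the joint Lipschitz bound on `D2` suffices. -/
lemma norm_lossGrad_block_sub_le (hF : P.FirstLayerSmooth M) (x : P.Act 0) (w w' : P.Params)
    (e : Fin E) :
    ‖P.lossGrad x w e - P.lossGrad x w' e‖ ≤ 3 * M * flowBound E M ^ 2 * ‖w - w'‖ := by
  have h2 : ‖w e - w' e‖ ≤ ‖w - w'‖ := norm_block_le (w - w') e
  have hQ := one_le_flowBound (E := E) hM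
  have key : ‖P.D2 e (P.activation x w e.castSucc) (w e) -
      P.D2 e (P.activation x w' e.castSucc) (w' e)‖ ≤ M * (2 * flowBound E M * ‖w - w'‖) := by
    by_cases he : (e : ℕ) = 0
    · have h0 : ∀ w, P.activation x w e.castSucc = P.activation x 0 e.castSucc := by
        have : e.castSucc = 0 := Fin.ext (by simpa using he)
        rw [this]
        simp
      rw [h0 w, h0 w']
      refine (hF e he _ _ _).trans ?_
      gcongr
      exact h2.trans (le_mul_of_one_le_left (norm_nonneg _) (by linarith))
    · refine (h.D2_lipschitz e he _ _ _ _).trans ?_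
      gcongr
      have := norm_activation_sub_le_flow h hM x w w' e.castSucc (Fin.castSucc_lt_last e).ne
      nlinarith [norm_nonneg (w - w')]
  refine (norm_adjoint_sub_le (h.D2_bound e _ _) key _ _).trans ?_
  have h3 := norm_costate_sub_le h hM x w w' e.succ (Fin.succ_ne_zero e)
  have h4 := norm_costate_le h hM x w' e.succ
  calc _ ≤ M * (flowBound E M * ‖w - w'‖) + M * (2 * flowBound E M * ‖w - w'‖) * flowBound E M := by
        gcongr
    _ ≤ M * (flowBound E M ^ 2 * ‖w - w'‖) +
        M * (2 * flowBound E M * ‖w - w'‖) * flowBound E M := by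
        gcongr
        nlinarith
    _ = _ := by ring

omit hM in
lemma gradient_loss (x : P.Act 0) (w : P.Params) : gradient (P.loss x) w = P.lossGrad x w :=
  (hasGradientAt_loss h.differentiable x w).gradient

end Bounds

end Pipeline

/-! ### Error feedback with random resets tracks a slowly moving target -/

/-- Young's inequality; the gap is `θ⁻¹ (θ x - y)²`. Extended nonnegative reals allow second moments
to be compared before they are known to be finite. -/
lemma ennreal_add_sq_le {θ : ℝ} (hθ : 0 < θ) (a b : ℝ≥0∞) :
    (a + b) ^ 2 ≤ ENNReal.ofReal (1 + θ) * a ^ 2 + ENNReal.ofReal (1 + θ⁻¹) * b ^ 2 := by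
  have h1 : ENNReal.ofReal (1 + θ) ≠ 0 := by
    simp only [ne_eq, ENNReal.ofReal_eq_zero, not_le]; positivity
  have h2 : ENNReal.ofReal (1 + θ⁻¹) ≠ 0 := by
    simp only [ne_eq, ENNReal.ofReal_eq_zero, not_le]; positivity
  by_cases ha : a = ⊤
  · simp [ha, ENNReal.mul_top h1]
  by_cases hb : b = ⊤
  · simp [hb, ENNReal.mul_top h2]
  rw [← ENNReal.ofReal_toReal ha, ← ENNReal.ofReal_toReal hb]
  have hx : 0 ≤ a.toReal := ENNReal.toReal_nonneg
  have hy : 0 ≤ b.toReal := ENNReal.toReal_nonneg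
  set x := a.toReal
  set y := b.toReal
  rw [← ENNReal.ofReal_add hx hy, ← ENNReal.ofReal_pow (by positivity), ← ENNReal.ofReal_pow hx,
    ← ENNReal.ofReal_pow hy, ← ENNReal.ofReal_mul (by positivity),
    ← ENNReal.ofReal_mul (by positivity), ← ENNReal.ofReal_add (by positivity) (by positivity)]
  refine ENNReal.ofReal_le_ofReal ?_
  have : (1 + θ) * x ^ 2 + (1 + θ⁻¹) * y ^ 2 - (x + y) ^ 2 = θ⁻¹ * (θ * x - y) ^ 2 := by
    field_simp
    ring
  have h3 : 0 ≤ θ⁻¹ * (θ * x - y) ^ 2 := by positivity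
  linarith

lemma ennreal_add_sq_le_two (a b : ℝ≥0∞) : (a + b) ^ 2 ≤ 2 * a ^ 2 + 2 * b ^ 2 := by
  have h := ennreal_add_sq_le one_pos a b
  norm_num at h
  exact h

/-- The residual of a randomized compressor whose seed is independent of its input. -/
lemma setLIntegral_residual_le {Ω S V : Type*} [MeasurableSpace Ω] [MeasurableSpace S]
    [NormedAddCommGroup V] [MeasurableSpace V] [BorelSpace V] [SecondCountableTopology V]
    {μ : Measure Ω} [IsProbabilityMeasure μ] {ν : Measure S} [IsProbabilityMeasure ν]
    {C : S → V → V} (hCm : Measurable (fun q : S × V => C q.1 q.2))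
    (hC : ∀ z, ∫⁻ s, ‖z - C s z‖ₑ ^ 2 ∂ν ≤ ‖z‖ₑ ^ 2)
    {fr : Ω → Bool} {z : Ω → V} {s : Ω → S} (hfr : Measurable fr) (hz : Measurable z)
    (hs : Measurable s) (hν : μ.map s = ν) (hind : IndepFun (fun ω => (fr ω, z ω)) s μ) :
    ∫⁻ ω in {ω | fr ω = false}, ‖z ω - C (s ω) (z ω)‖ₑ ^ 2 ∂μ ≤
      ∫⁻ ω in {ω | fr ω = false}, ‖z ω‖ₑ ^ 2 ∂μ := by
  have hset : MeasurableSet {ω | fr ω = false} := hfr (measurableSet_singleton false)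
  have hsetb : MeasurableSet {b : Bool | b = false} := MeasurableSet.of_discrete
  rw [← lintegral_indicator hset, ← lintegral_indicator hset]
  -- The stale event is read off from the flag, so both sides are integrals against the law of flag,
  -- input and seed. Independence makes this law a product, and the seed is integrated first, at a
  -- fixed input.
  let Φ : (Bool × V) × S → ℝ≥0∞ := fun q =>
    Set.indicator {b : Bool | b = false} (fun _ => ‖q.1.2 - C q.2 q.1.2‖ₑ ^ 2) q.1.1
  let Ψ : Bool × V → ℝ≥0∞ := fun q =>
    Set.indicator {b : Bool | b = false} (fun _ => ‖q.2‖ₑ ^ 2) q.1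
  have hΦ : Measurable Φ := by
    have h1 : Measurable (fun q : (Bool × V) × S => ‖q.1.2 - C q.2 q.1.2‖ₑ ^ 2) :=
      ((measurable_fst.snd.sub
        (hCm.comp (measurable_snd.prodMk measurable_fst.snd))).enorm.pow_const 2)
    exact h1.indicator (s := {q : (Bool × V) × S | q.1.1 = false}) (measurable_fst.fst hsetb)
  have hΨ : Measurable Ψ := by
    have h1 : Measurable (fun q : Bool × V => ‖q.2‖ₑ ^ 2) := measurable_snd.enorm.pow_const 2
    exact h1.indicator (s := {q : Bool × V | q.1 = false}) (measurable_fst hsetb)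
  have hp : Measurable (fun ω => (fr ω, z ω)) := hfr.prodMk hz
  have hmap := (indepFun_iff_map_prod_eq_prod_map_map hp.aemeasurable hs.aemeasurable).1 hind
  have h1 : ∫⁻ ω, Set.indicator {ω | fr ω = false} (fun ω => ‖z ω - C (s ω) (z ω)‖ₑ ^ 2) ω ∂μ =
      ∫⁻ q, Φ q ∂(μ.map (fun ω => ((fr ω, z ω), s ω))) := by
    rw [lintegral_map hΦ (hp.prodMk hs)]
    rfl
  have h2 : ∫⁻ ω, Set.indicator {ω | fr ω = false} (fun ω => ‖z ω‖ₑ ^ 2) ω ∂μ =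
      ∫⁻ q, Ψ q ∂(μ.map (fun ω => (fr ω, z ω))) := by
    rw [lintegral_map hΨ hp]
    rfl
  rw [h1, h2, hmap, hν, lintegral_prod _ hΦ.aemeasurable]
  refine lintegral_mono fun q => ?_
  rcases q with ⟨b, v⟩
  cases b
  · simpa [Φ, Ψ] using hC v
  · simp [Φ, Ψ]

/-- The amplification factor of the tracking error. -/
def trackConst (p : ℝ) : ℝ≥0∞ :=
  2 * (ENNReal.ofReal (1 + p / 4) * ENNReal.ofReal (1 + (p / 4)⁻¹)) +
    ENNReal.ofReal (1 + (p / 4)⁻¹)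

lemma trackConst_ne_top (p : ℝ) : trackConst p ≠ ⊤ := by
  unfold trackConst
  finiteness

/-- The slack is `p (1 - p) (8 - p) / 16`, so the choice `θ = p / 4` in two applications of Young's
inequality still leaves a gain of `p ^ 2`, with equality at `p = 1`. -/
lemma contraction_le {p : ℝ} (hp : 0 < p) (hp1 : p ≤ 1) :
    ENNReal.ofReal (1 + p / 4) * (ENNReal.ofReal (1 + p / 4) * ENNReal.ofReal (1 - p)) +
      ENNReal.ofReal (p ^ 2) ≤ 1 := by
  rw [← ENNReal.ofReal_mul (by positivity), ← ENNReal.ofReal_mul (by positivity),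
    ← ENNReal.ofReal_add (mul_nonneg (by positivity) (mul_nonneg (by positivity) (by linarith)))
      (by positivity), ← ENNReal.ofReal_one]
  refine ENNReal.ofReal_le_ofReal ?_
  nlinarith [mul_nonneg (mul_nonneg hp.le hp.le) (sub_nonneg.2 hp1), mul_pos hp hp]

/-- Here `q` is the memory, `h` the message, and `τ`, `τ'` the old and new target. On a fresh
iteration the new error is just `h - τ'`. On a stale one it is a compression residual plus `h - τ'`,
and the residual is in mean square at most `h - q`, that is, the old error up to `b` and the target
movement `c`. Young's inequality with `θ = p / 4` is applied to each of the two sums; `hX` supplies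
the factor `1 - p` on the old error. -/
lemma lintegral_tracking_le {Ω S V : Type*} [MeasurableSpace Ω] [MeasurableSpace S]
    [NormedAddCommGroup V] [MeasurableSpace V] [BorelSpace V] [SecondCountableTopology V]
    {μ : Measure Ω} [IsProbabilityMeasure μ] {ν : Measure S} [IsProbabilityMeasure ν]
    {p : ℝ} (hp : 0 < p) {C : S → V → V} (hCm : Measurable (fun q : S × V => C q.1 q.2))
    (hC : ∀ z, ∫⁻ s, ‖z - C s z‖ₑ ^ 2 ∂ν ≤ ‖z‖ₑ ^ 2)
    {fr : Ω → Bool} {q h τ τ' q' : Ω → V} {s : Ω → S} {b c : Ω → ℝ≥0∞} {X : ℝ≥0∞}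
    (hfr : Measurable fr) (hqm : Measurable q) (hhm : Measurable h) (hτm : Measurable τ)
    (hbm : Measurable b) (hcm : Measurable c)
    (hs : Measurable s) (hν : μ.map s = ν)
    (hind : IndepFun (fun ω => (fr ω, h ω - q ω)) s μ)
    (hq' : ∀ ω, q' ω = if fr ω then h ω else q ω + C (s ω) (h ω - q ω))
    (hb : ∀ ω, ‖h ω - τ' ω‖ₑ ≤ b ω) (hc : ∀ ω, fr ω = false → ‖τ' ω - τ ω‖ₑ ≤ c ω)
    (hX : ∫⁻ ω in {ω | fr ω = false}, ‖q ω - τ ω‖ₑ ^ 2 ∂μ ≤ ENNReal.ofReal (1 - p) * X) :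
    ∫⁻ ω, ‖q' ω - τ' ω‖ₑ ^ 2 ∂μ ≤
      ENNReal.ofReal (1 + p / 4) * (ENNReal.ofReal (1 + p / 4) * ENNReal.ofReal (1 - p)) * X +
        trackConst p * (∫⁻ ω, b ω ^ 2 ∂μ + ∫⁻ ω, c ω ^ 2 ∂μ) := by
  have hθ : 0 < p / 4 := by positivity
  set α := ENNReal.ofReal (1 + p / 4)
  set β := ENNReal.ofReal (1 + (p / 4)⁻¹)
  have hset : MeasurableSet {ω | fr ω = false} := hfr (measurableSet_singleton false)
  have hzm : Measurable (fun ω => h ω - q ω) := hhm.sub hqm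
  have hres := setLIntegral_residual_le hCm hC hfr hzm hs hν hind
  have hrm : Measurable (fun ω => ‖(h ω - q ω) - C (s ω) (h ω - q ω)‖ₑ ^ 2) :=
    (hzm.sub (hCm.comp (hs.prodMk hzm))).enorm.pow_const 2
  have hz : ∫⁻ ω in {ω | fr ω = false}, ‖h ω - q ω‖ₑ ^ 2 ∂μ ≤
      α * (ENNReal.ofReal (1 - p) * X) + β * (2 * ∫⁻ ω, b ω ^ 2 ∂μ + 2 * ∫⁻ ω, c ω ^ 2 ∂μ) := by
    calc _ ≤ ∫⁻ ω in {ω | fr ω = false},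
          (α * ‖q ω - τ ω‖ₑ ^ 2 + β * (2 * b ω ^ 2 + 2 * c ω ^ 2)) ∂μ := by
          refine setLIntegral_mono' hset fun ω hω => ?_
          have e : h ω - q ω = -(q ω - τ ω) + ((h ω - τ' ω) + (τ' ω - τ ω)) := by abel
          have t : ‖h ω - q ω‖ₑ ≤ ‖q ω - τ ω‖ₑ + (b ω + c ω) := by
            rw [e]
            refine (enorm_add_le _ _).trans ?_
            rw [enorm_neg]
            exact add_le_add_right ((enorm_add_le _ _).trans (add_le_add (hb ω) (hc ω hω))) _
          calc _ ≤ (‖q ω - τ ω‖ₑ + (b ω + c ω)) ^ 2 := by gcongr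
            _ ≤ α * ‖q ω - τ ω‖ₑ ^ 2 + β * (b ω + c ω) ^ 2 := ennreal_add_sq_le hθ _ _
            _ ≤ _ := by
              gcongr
              exact ennreal_add_sq_le_two _ _
      _ = α * ∫⁻ ω in {ω | fr ω = false}, ‖q ω - τ ω‖ₑ ^ 2 ∂μ +
          β * (2 * ∫⁻ ω in {ω | fr ω = false}, b ω ^ 2 ∂μ +
            2 * ∫⁻ ω in {ω | fr ω = false}, c ω ^ 2 ∂μ) := by
          have m1 : Measurable (fun ω => ‖q ω - τ ω‖ₑ ^ 2) := (hqm.sub hτm).enorm.pow_const 2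
          have m2 : Measurable (fun ω => b ω ^ 2) := hbm.pow_const 2
          have m3 : Measurable (fun ω => c ω ^ 2) := hcm.pow_const 2
          have m4 : Measurable (fun ω => 2 * b ω ^ 2 + 2 * c ω ^ 2) :=
            (m2.const_mul _).add (m3.const_mul _)
          rw [lintegral_add_left (m1.const_mul _), lintegral_const_mul _ m1,
            lintegral_const_mul _ m4,
            lintegral_add_left (m2.const_mul _), lintegral_const_mul _ m2,
            lintegral_const_mul _ m3]
      _ ≤ _ := by
          gcongr <;> exact Measure.restrict_le_self
  calc _ ≤ ∫⁻ ω, (α * Set.indicator {ω | fr ω = false}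
        (fun ω => ‖(h ω - q ω) - C (s ω) (h ω - q ω)‖ₑ ^ 2) ω + β * b ω ^ 2) ∂μ := by
        refine lintegral_mono fun ω => ?_
        rw [hq']
        by_cases hω : fr ω = true
        · have hβ : 1 ≤ β := by
            rw [← ENNReal.ofReal_one]
            exact ENNReal.ofReal_le_ofReal (by simp; positivity)
          simp only [hω, if_true]
          calc ‖h ω - τ' ω‖ₑ ^ 2 ≤ b ω ^ 2 := by gcongr; exact hb ω
            _ ≤ β * b ω ^ 2 := le_mul_of_one_le_left' hβ
            _ ≤ _ := le_add_self
        · have hω' : ω ∈ {ω | fr ω = false} := by simpa using hω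
          simp only [hω, Set.indicator_of_mem hω']
          have e : q ω + C (s ω) (h ω - q ω) - τ' ω =
              -((h ω - q ω) - C (s ω) (h ω - q ω)) + (h ω - τ' ω) := by abel
          simp only [Bool.false_eq_true, if_false]
          rw [e]
          calc _ ≤ (‖(h ω - q ω) - C (s ω) (h ω - q ω)‖ₑ + b ω) ^ 2 := by
                gcongr
                refine (enorm_add_le _ _).trans ?_
                rw [enorm_neg]
                exact add_le_add_right (hb ω) _
            _ ≤ _ := ennreal_add_sq_le hθ _ _
    _ = α * ∫⁻ ω in {ω | fr ω = false}, ‖(h ω - q ω) - C (s ω) (h ω - q ω)‖ₑ ^ 2 ∂μ +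
        β * ∫⁻ ω, b ω ^ 2 ∂μ := by
        rw [lintegral_add_left ((hrm.indicator hset).const_mul _),
          lintegral_const_mul _ (hrm.indicator hset), lintegral_const_mul _ (hbm.pow_const 2),
          lintegral_indicator hset]
    _ ≤ α * (α * (ENNReal.ofReal (1 - p) * X) +
          β * (2 * ∫⁻ ω, b ω ^ 2 ∂μ + 2 * ∫⁻ ω, c ω ^ 2 ∂μ)) + β * ∫⁻ ω, b ω ^ 2 ∂μ := by
        gcongr
        exact hres.trans hz
    _ ≤ α * (α * (ENNReal.ofReal (1 - p) * X) +
          β * (2 * ∫⁻ ω, b ω ^ 2 ∂μ + 2 * ∫⁻ ω, c ω ^ 2 ∂μ)) +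
          β * (∫⁻ ω, b ω ^ 2 ∂μ + ∫⁻ ω, c ω ^ 2 ∂μ) := by
        gcongr
        exact le_self_add
    _ = _ := by
        unfold trackConst
        ring

/-- Writing the contraction as `α + ρ ≤ 1` avoids truncated subtraction: at each step `ρ * X N`
moves from the recursion into the accumulated sum. -/
lemma sum_le_of_contraction {α ρ : ℝ≥0∞} (hρ : α + ρ ≤ 1) {X f : ℕ → ℝ≥0∞} (hX0 : X 0 = 0)
    (hX : ∀ n, X (n + 1) ≤ α * X n + f n) (N : ℕ) :
    ρ * ∑ n ∈ Finset.range N, X (n + 1) ≤ ∑ n ∈ Finset.range N, f n := by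
  have key : ∀ N, X N + ρ * ∑ n ∈ Finset.range N, X n ≤ ∑ n ∈ Finset.range N, f n := by
    intro N
    induction N with
    | zero => simp [hX0]
    | succ N ih =>
      rw [Finset.sum_range_succ, Finset.sum_range_succ]
      calc _ ≤ (α * X N + f N) + ρ * (∑ n ∈ Finset.range N, X n + X N) := by
            gcongr
            exact hX N
        _ = (α + ρ) * X N + ρ * ∑ n ∈ Finset.range N, X n + f N := by ring
        _ ≤ 1 * X N + ρ * ∑ n ∈ Finset.range N, X n + f N := by gcongr
        _ ≤ _ := by
            rw [one_mul]
            gcongr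
  have hρ1 : ρ ≤ 1 := le_add_self.trans hρ
  rcases N with _ | N
  · simp
  calc _ = ρ * ∑ n ∈ Finset.range N, X (n + 1) + ρ * X (N + 1) := by
        rw [Finset.sum_range_succ, mul_add]
    -- The sum to be bounded is shifted by one against `key`; its last term is paid by the extra `X
    -- (N + 1)` there, since `ρ ≤ 1`.
    _ ≤ ρ * ∑ n ∈ Finset.range (N + 1), X n + X (N + 1) := by
        rw [Finset.sum_range_succ' X]
        gcongr
        · exact le_self_add
        · exact mul_le_of_le_one_left' hρ1
    _ ≤ _ := by
        rw [add_comm]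
        exact key (N + 1)

/-- The amplification factor of the accumulated tracking error. -/
def trackSumConst (p : ℝ) : ℝ≥0∞ := (ENNReal.ofReal (p ^ 2))⁻¹ * trackConst p

lemma trackSumConst_ne_top {p : ℝ} (hp : 0 < p) : trackSumConst p ≠ ⊤ := by
  refine ENNReal.mul_ne_top (ENNReal.inv_ne_top.2 ?_) (trackConst_ne_top p)
  simp only [ne_eq, ENNReal.ofReal_eq_zero, not_le]
  positivity

lemma sum_tracking_le {p : ℝ} (hp : 0 < p) (hp1 : p ≤ 1) {X f : ℕ → ℝ≥0∞} (hX0 : X 0 = 0)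
    (hX : ∀ n, X (n + 1) ≤ ENNReal.ofReal (1 + p / 4) *
      (ENNReal.ofReal (1 + p / 4) * ENNReal.ofReal (1 - p)) * X n + trackConst p * f n) (N : ℕ) :
    ∑ n ∈ Finset.range N, X (n + 1) ≤ trackSumConst p * ∑ n ∈ Finset.range N, f n := by
  have h := sum_le_of_contraction (contraction_le hp hp1) hX0 hX N
  have hρ : ENNReal.ofReal (p ^ 2) ≠ 0 := by
    simp only [ne_eq, ENNReal.ofReal_eq_zero, not_le]; positivity
  rw [← Finset.mul_sum] at h
  unfold trackSumConst
  rw [mul_assoc, ← ENNReal.div_eq_inv_mul]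
  rw [ENNReal.le_div_iff_mul_le (Or.inl hρ) (Or.inl ENNReal.ofReal_ne_top), mul_comm]
  exact h

namespace Pipeline

variable {E : ℕ} {P : Pipeline E}

/-! ### Measurability of the building blocks -/

section Measurability

variable {α : Type*} {mα : MeasurableSpace α}

lemma measurable_block {w : α → P.Params} (hw : Measurable w) (e : Fin E) :
    Measurable (fun ω => w ω e) :=
  (measurable_pi_apply e).comp ((WithLp.measurable_ofLp 2 _).comp hw)

lemma measurable_params {w : α → P.Params} (hw : ∀ e, Measurable (fun ω => w ω e)) :
    Measurable w :=
  (WithLp.measurable_toLp 2 (∀ e, P.Wt e)).comp (measurable_pi_lambda _ hw)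

variable (h : ∀ e : Fin E, Differentiable ℝ (fun z : P.Act e.castSucc × P.Wt e => P.a e z.1 z.2))
include h

lemma measurable_operator (e : Fin E) {y : α → P.Act e.castSucc} {w : α → P.Wt e}
    (hy : Measurable y) (hw : Measurable w) : Measurable (fun ω => P.a e (y ω) (w ω)) :=
  (h e).continuous.measurable.comp (hy.prodMk hw)

/-- Continuity of the Jacobians is not available for the first layer. Measurability of a derivative
depending on a parameter needs only continuity of the operator, with the weights as the parameter.
-/
lemma measurable_D1 (e : Fin E) {y : α → P.Act e.castSucc} {w : α → P.Wt e}
    (hy : Measurable y) (hw : Measurable w) : Measurable (fun ω => P.D1 e (y ω) (w ω)) := by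
  have hc : Continuous (Function.uncurry fun (w : P.Wt e) (y : P.Act e.castSucc) => P.a e y w) :=
    (h e).continuous.comp continuous_swap
  exact (measurable_fderiv_with_param ℝ hc).comp (hw.prodMk hy)

lemma measurable_D2 (e : Fin E) {y : α → P.Act e.castSucc} {w : α → P.Wt e}
    (hy : Measurable y) (hw : Measurable w) : Measurable (fun ω => P.D2 e (y ω) (w ω)) := by
  have hc : Continuous (Function.uncurry fun (y : P.Act e.castSucc) (w : P.Wt e) => P.a e y w) :=
    (h e).continuous
  exact (measurable_fderiv_with_param ℝ hc).comp (hy.prodMk hw)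

omit h in
lemma measurable_adjoint_apply {m n : ℕ}
    {A : α → EuclideanSpace ℝ (Fin m) →L[ℝ] EuclideanSpace ℝ (Fin n)}
    {v : α → EuclideanSpace ℝ (Fin n)} (hA : Measurable A) (hv : Measurable v) :
    Measurable (fun ω => (A ω).adjoint (v ω)) := by
  have h1 : Measurable (fun ω => (A ω).adjoint) :=
    (ContinuousLinearMap.adjoint (𝕜 := ℝ) (E := EuclideanSpace ℝ (Fin m))
      (F := EuclideanSpace ℝ (Fin n))).continuous.measurable.comp hA
  exact (ContinuousLinearMap.measurable_apply₂ (𝕜 := ℝ) (E := EuclideanSpace ℝ (Fin n))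
    (F := EuclideanSpace ℝ (Fin m))).comp (h1.prodMk hv)

lemma measurable_activation {x : α → P.Act 0} {w : α → P.Params} (hx : Measurable x)
    (hw : Measurable w) (i : Fin (E + 1)) : Measurable (fun ω => P.activation (x ω) (w ω) i) := by
  induction i using Fin.induction with
  | zero => exact hx
  | succ e ih =>
    simp only [activation_succ]
    exact measurable_operator h e ih (measurable_block hw e)

lemma measurable_costate {x : α → P.Act 0} {w : α → P.Params} (hx : Measurable x)
    (hw : Measurable w) (i : Fin (E + 1)) : Measurable (fun ω => P.costate (x ω) (w ω) i) := by
  induction i using Fin.reverseInduction with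
  | last => simp only [costate_last]; exact measurable_const
  | cast e ih =>
    simp only [costate_castSucc]
    exact measurable_adjoint_apply
      (measurable_D1 h e (measurable_activation h hx hw _) (measurable_block hw e)) ih

lemma measurable_lossGrad {x : α → P.Act 0} {w : α → P.Params} (hx : Measurable x)
    (hw : Measurable w) : Measurable (fun ω => P.lossGrad (x ω) (w ω)) :=
  measurable_params fun e => measurable_adjoint_apply
    (measurable_D2 h e (measurable_activation h hx hw _) (measurable_block hw e))
    (measurable_costate h hx hw _)

end Measurability

/-! ### Information available at the various stages of an iteration -/

namespace Input

/-- The iteration in which a random input is used. -/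
def time : Input E → ℕ
  | sample t => t
  | flag t => t
  | seedF t _ => t
  | seedB t _ => t

/-- The inputs used before iteration `n`. -/
def before (n : ℕ) : Set (Input E) := {j | j.time < n}

/-- The inputs used up to the point of iteration `n` where activation `i` is communicated. -/
def forwardStage (n : ℕ) (i : Fin (E + 1)) : Set (Input E) :=
  before n ∪ {flag n, sample n} ∪ {j | ∃ k ≤ i, j = seedF n k}

/-- The inputs used up to the point of iteration `n` where activation gradient `i` is
communicated. -/
def backwardStage (n : ℕ) (i : Fin (E + 1)) : Set (Input E) :=
  before n ∪ {flag n, sample n} ∪ {j | ∃ k, j = seedF n k} ∪ {j | ∃ k ≥ i, j = seedB n k}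

lemma before_subset_forwardStage (n : ℕ) (i : Fin (E + 1)) : before n ⊆ forwardStage n i :=
  fun _ hj => Or.inl (Or.inl hj)

lemma flag_mem_forwardStage (n : ℕ) (i : Fin (E + 1)) : flag n ∈ forwardStage n i :=
  Or.inl (Or.inr (Or.inl rfl))

lemma sample_mem_forwardStage (n : ℕ) (i : Fin (E + 1)) : sample n ∈ forwardStage n i :=
  Or.inl (Or.inr (Or.inr rfl))

lemma seedF_mem_forwardStage (n : ℕ) (i : Fin (E + 1)) : seedF n i ∈ forwardStage n i :=
  Or.inr ⟨i, le_rfl, rfl⟩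

lemma forwardStage_mono (n : ℕ) {i k : Fin (E + 1)} (h : i ≤ k) :
    forwardStage n i ⊆ forwardStage n k := by
  rintro j (hj | ⟨l, hl, rfl⟩)
  · exact Or.inl hj
  · exact Or.inr ⟨l, hl.trans h, rfl⟩

lemma seedF_notMem_forwardStage (n : ℕ) {i k : Fin (E + 1)} (h : i < k) :
    seedF n k ∉ forwardStage n i := by
  rintro ((hj | hj | hj) | ⟨l, hl, hj⟩)
  · simp [before, time] at hj
  · cases hj
  · cases hj
  · cases hj
    exact absurd h (not_lt.2 hl)

lemma forwardStage_subset_backwardStage (n : ℕ) (i k : Fin (E + 1)) :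
    forwardStage n i ⊆ backwardStage n k := by
  rintro j (hj | ⟨l, -, rfl⟩)
  · exact Or.inl (Or.inl hj)
  · exact Or.inl (Or.inr ⟨l, rfl⟩)

lemma seedB_mem_backwardStage (n : ℕ) (i : Fin (E + 1)) : seedB n i ∈ backwardStage n i :=
  Or.inr ⟨i, le_rfl, rfl⟩

lemma backwardStage_anti (n : ℕ) {i k : Fin (E + 1)} (h : i ≤ k) :
    backwardStage n k ⊆ backwardStage n i := by
  rintro j (hj | ⟨l, hl, rfl⟩)
  · exact Or.inl hj
  · exact Or.inr ⟨l, h.trans hl, rfl⟩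

lemma seedB_notMem_backwardStage (n : ℕ) {i k : Fin (E + 1)} (h : k < i) :
    seedB n k ∉ backwardStage n i := by
  rintro (((hj | hj | hj) | ⟨l, hj⟩) | ⟨l, hl, hj⟩)
  · simp [before, time] at hj
  · cases hj
  · cases hj
  · cases hj
  · cases hj
    exact absurd h (not_lt.2 hl)

lemma backwardStage_subset_before (n : ℕ) (i : Fin (E + 1)) :
    backwardStage n i ⊆ before (n + 1) := by
  rintro j (((hj | hj | hj) | ⟨l, rfl⟩) | ⟨l, -, rfl⟩)
  · exact Nat.lt_succ_of_lt hj
  · cases hj; exact Nat.lt_succ_self n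
  · cases hj; exact Nat.lt_succ_self n
  · exact Nat.lt_succ_self n
  · exact Nat.lt_succ_self n

lemma forwardStage_subset_before (n : ℕ) (i : Fin (E + 1)) :
    forwardStage n i ⊆ before (n + 1) :=
  (forwardStage_subset_backwardStage n i i).trans (backwardStage_subset_before n i)

lemma flag_notMem_before (n : ℕ) : (flag n : Input E) ∉ before n := by
  simp [before, time]

lemma sample_notMem_before_flag (n : ℕ) :
    (sample n : Input E) ∉ before n ∪ {flag n} := by
  rintro (hj | hj)
  · simp [before, time] at hj
  · cases hj

end Input

end Pipeline

/-! ### A run as an adapted process -/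

open Pipeline

/-- A run of Clapping-FU in the setting of the theorem, with one constant `M` in the place of all
smoothness constants and without a contraction requirement on the compressors. -/
structure Trial (E : ℕ) (S Ω : Type*) [MeasurableSpace S] [MeasurableSpace Ω] where
  P : Pipeline E
  D : Measure (P.Act 0)
  ν : Measure S
  μ : Measure Ω
  CF : P.Compressor S
  CB : P.Compressor S
  w₁ : P.Params
  X : P.Source S Ω
  M : ℝ
  p : ℝ
  σ : ℝ
  γ : ℝ
  m : ℝ
  probD : IsProbabilityMeasure D
  probν : IsProbabilityMeasure ν
  probμ : IsProbabilityMeasure μ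
  one_le_M : 1 ≤ M
  p_pos : 0 < p
  p_le_one : p ≤ 1
  γ_pos : 0 < γ
  m_pos : 0 < m
  m_lt_one : m < 1
  smooth : P.Smooth D M M M M
  first : p = 1 ∨ P.FirstLayerSmooth M
  unbiased : P.Unbiased D σ
  contractF : P.Contractive ν CF 1
  contractB : P.Contractive ν CB 1
  driver : X.IsDriver D ν p μ

namespace Trial

attribute [instance] Trial.probD Trial.probν Trial.probμ

variable {E : ℕ} {S Ω : Type*} [MeasurableSpace S] [MeasurableSpace Ω] (R : Trial E S Ω)

/-- The state after `n` iterations. -/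
def st (n : ℕ) (ω : Ω) : R.P.State := R.P.run R.CF R.CB R.γ R.m R.w₁ R.X ω n

/-- Whether iteration `n` is fresh. -/
def fresh (n : ℕ) (ω : Ω) : Bool := n == 0 || R.X.flag n ω

/-- The sample used in the last iteration. -/
def x (n : ℕ) (ω : Ω) : R.P.Act 0 := (R.st n ω).x

/-- The communicated activations of the last iteration. -/
def y (n : ℕ) (i : Fin (E + 1)) (ω : Ω) : R.P.Act i := (R.st n ω).y i

/-- The communicated activation gradients of the last iteration. -/
def v (n : ℕ) (i : Fin (E + 1)) (ω : Ω) : R.P.Act i := (R.st n ω).v i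

/-- The momentum after `n` iterations. -/
def u (n : ℕ) (ω : Ω) : R.P.Params := (R.st n ω).u

/-- The weights after `n` iterations. -/
def w (n : ℕ) (ω : Ω) : R.P.Params := (R.st n ω).w

/-- The stochastic gradient that enters the momentum in iteration `n`. -/
def g (n : ℕ) (ω : Ω) : R.P.Params :=
  WithLp.toLp 2 fun e => (R.P.D2 e (R.y (n + 1) e.castSucc ω) (R.w n ω e)).adjoint
    (R.v (n + 1) e.succ ω)

/-- The input of the forward compressor of worker `e + 1`, before the memory is subtracted. -/
def yIn (n : ℕ) (e : Fin E) (ω : Ω) : R.P.Act e.succ :=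
  R.P.a e (R.y (n + 1) e.castSucc ω) (R.w n ω e)

/-- The input of the backward compressor of worker `e + 1`, before the memory is subtracted. -/
def vIn (n : ℕ) (e : Fin E) (ω : Ω) : R.P.Act e.castSucc :=
  (R.P.D1 e (R.y (n + 1) e.castSucc ω) (R.w n ω e)).adjoint (R.v (n + 1) e.succ ω)

lemma u_zero (ω : Ω) : R.u 0 ω = 0 := rfl

lemma fresh_zero (ω : Ω) : R.fresh 0 ω = true := rfl

lemma x_succ (n : ℕ) (ω : Ω) :
    R.x (n + 1) ω = if R.fresh n ω then R.X.sample n ω else R.x n ω := rfl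

lemma y_zero (n : ℕ) (ω : Ω) : R.y (n + 1) 0 ω = R.x (n + 1) ω := rfl

lemma y_succ (n : ℕ) (e : Fin E) (ω : Ω) :
    R.y (n + 1) e.succ ω = if R.fresh n ω then R.yIn n e ω
      else R.y n e.succ ω + R.CF e.succ (R.X.seedF n e.succ ω) (R.yIn n e ω - R.y n e.succ ω) := by
  simp only [y, yIn, st, run, step, forward, Fin.induction_succ, w]
  rfl

lemma v_last (n : ℕ) (ω : Ω) :
    R.v (n + 1) (Fin.last E) ω = WithLp.toLp 2 (fun _ => 1) := by
  simp only [v, st, run, step, backward, Fin.reverseInduction_last]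

lemma v_castSucc (n : ℕ) (e : Fin E) (ω : Ω) :
    R.v (n + 1) e.castSucc ω = if R.fresh n ω then R.vIn n e ω
      else R.v n e.castSucc ω +
        R.CB e.castSucc (R.X.seedB n e.castSucc ω) (R.vIn n e ω - R.v n e.castSucc ω) := by
  simp only [v, vIn, st, run, step, backward, Fin.reverseInduction_castSucc, w, y]
  rfl

lemma u_succ (n : ℕ) (ω : Ω) : R.u (n + 1) ω = (1 - R.m) • R.u n ω + R.m • R.g n ω := by
  ext e : 1
  rfl

lemma w_succ (n : ℕ) (ω : Ω) : R.w (n + 1) ω = R.w n ω - R.γ • R.u (n + 1) ω := rfl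

/-- The information contained in a set of random inputs. -/
@[reducible]
def info (J : Set (Input E)) : MeasurableSpace Ω := ⨆ j ∈ J, R.X.sigma j

lemma info_mono {J K : Set (Input E)} (h : J ⊆ K) : R.info J ≤ R.info K :=
  biSup_mono fun _ hj => h hj

lemma sigma_le_info {J : Set (Input E)} {j : Input E} (hj : j ∈ J) : R.X.sigma j ≤ R.info J :=
  le_biSup R.X.sigma hj

lemma sigma_le (j : Input E) : R.X.sigma j ≤ ‹MeasurableSpace Ω› := by
  cases j with
  | sample t => exact (R.driver.sample_measurable t).comap_le
  | flag t => exact (R.driver.flag_measurable t).comap_le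
  | seedF t i => exact (R.driver.seedF_measurable t i).comap_le
  | seedB t i => exact (R.driver.seedB_measurable t i).comap_le

lemma info_le (J : Set (Input E)) : R.info J ≤ ‹MeasurableSpace Ω› :=
  iSup₂_le fun j _ => R.sigma_le j

lemma indep_info {J K : Set (Input E)} (h : Disjoint J K) :
    Indep (R.info J) (R.info K) R.μ :=
  indep_iSup_of_disjoint R.sigma_le R.driver.indep h

/-- The common source of all independence in the proof: whatever is computed from the inputs in `J`
is independent of a single input outside `J`. It serves seeds, coins and samples alike. -/
lemma indepFun_of_notMem {J : Set (Input E)} {j : Input E} (hj : j ∉ J) {α β : Type*}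
    [MeasurableSpace α] [MeasurableSpace β] {f : Ω → α} {g : Ω → β}
    (hf : Measurable[R.info J] f) (hg : Measurable[R.X.sigma j] g) : IndepFun f g R.μ := by
  rw [IndepFun_iff_Indep]
  have h := R.indep_info (Set.disjoint_singleton_right.2 hj)
  refine indep_of_indep_of_le_left (indep_of_indep_of_le_right h ?_) hf.comap_le
  exact hg.comap_le.trans (R.sigma_le_info (Set.mem_singleton j))

lemma measurable_fresh_sigma (n : ℕ) : Measurable[R.X.sigma (.flag n)] (R.fresh n) := by
  have h : Measurable[R.X.sigma (.flag n)] (R.X.flag n) := comap_measurable _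
  exact (measurable_of_countable (fun b : Bool => (n == 0 || b))).comp h

/-- The memory after `n` iterations depends only on the inputs of these iterations. -/
structure Adapted (n : ℕ) : Prop where
  x : Measurable[R.info (Input.before n)] (R.x n)
  y : ∀ i, i ≠ Fin.last E → Measurable[R.info (Input.before n)] (R.y n i)
  v : ∀ i, i ≠ 0 → Measurable[R.info (Input.before n)] (R.v n i)
  u : Measurable[R.info (Input.before n)] (R.u n)
  w : Measurable[R.info (Input.before n)] (R.w n)

variable {R} in
lemma Adapted.x_stage {n : ℕ} (h : R.Adapted n) (i : Fin (E + 1)) :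
    Measurable[R.info (Input.forwardStage n i)] (R.x (n + 1)) := by
  have hf : Measurable[R.info (Input.forwardStage n i)] (R.fresh n) :=
    (R.measurable_fresh_sigma n).mono (R.sigma_le_info (Input.flag_mem_forwardStage n i)) le_rfl
  have hs : Measurable[R.info (Input.forwardStage n i)] (R.X.sample n) :=
    (comap_measurable _ : Measurable[R.X.sigma (.sample n)] _).mono
      (R.sigma_le_info (Input.sample_mem_forwardStage n i)) le_rfl
  exact Measurable.ite (hf (measurableSet_singleton true)) hs
    (h.x.mono (R.info_mono (Input.before_subset_forwardStage n i)) le_rfl)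

variable {R} in
lemma Adapted.y_stage {n : ℕ} (h : R.Adapted n) (i : Fin (E + 1)) (hi : i ≠ Fin.last E) :
    Measurable[R.info (Input.forwardStage n i)] (R.y (n + 1) i) := by
  induction i using Fin.induction with
  | zero => exact h.x_stage 0
  | succ e ih =>
    have hb := R.info_mono (Input.before_subset_forwardStage n e.succ)
    have hy := (ih (Fin.castSucc_lt_last e).ne).mono (R.info_mono
      (Input.forwardStage_mono n (Fin.castSucc_lt_succ (i := e)).le)) le_rfl
    have hw := h.w.mono hb le_rfl
    have hf : Measurable[R.info (Input.forwardStage n e.succ)] (R.fresh n) :=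
      (R.measurable_fresh_sigma n).mono
        (R.sigma_le_info (Input.flag_mem_forwardStage n e.succ)) le_rfl
    have hs : Measurable[R.info (Input.forwardStage n e.succ)] (R.X.seedF n e.succ) :=
      (comap_measurable _ : Measurable[R.X.sigma (.seedF n e.succ)] _).mono
        (R.sigma_le_info (Input.seedF_mem_forwardStage n e.succ)) le_rfl
    have hyIn : Measurable[R.info (Input.forwardStage n e.succ)] (R.yIn n e) :=
      measurable_operator R.smooth.differentiable e hy (measurable_block hw e)
    have hyo := (h.y e.succ hi).mono hb le_rfl
    have hc := (R.contractF.measurable e.succ (Fin.succ_ne_zero e) hi).comp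
      (hs.prodMk (hyIn.sub hyo))
    rw [show R.y (n + 1) e.succ = _ from funext (R.y_succ n e)]
    exact Measurable.ite (hf (measurableSet_singleton true)) hyIn (hyo.add hc)

variable {R} in
-- The message of worker `e + 1` is determined one stage before its own seed is used. Hence the
-- compressor seed is independent of the compressor input, although both belong to the same
-- iteration.
lemma Adapted.yIn_stage {n : ℕ} (h : R.Adapted n) (e : Fin E) :
    Measurable[R.info (Input.forwardStage n e.castSucc)] (R.yIn n e) :=
  measurable_operator R.smooth.differentiable e (h.y_stage _ (Fin.castSucc_lt_last e).ne)
    (measurable_block (h.w.mono (R.info_mono (Input.before_subset_forwardStage n _)) le_rfl) e)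

variable {R} in
lemma Adapted.v_stage {n : ℕ} (h : R.Adapted n) (i : Fin (E + 1)) (hi : i ≠ 0) :
    Measurable[R.info (Input.backwardStage n i)] (R.v (n + 1) i) := by
  induction i using Fin.reverseInduction with
  | last =>
    have : R.v (n + 1) (Fin.last E) = fun _ => WithLp.toLp 2 (fun _ => 1) :=
      funext fun ω => R.v_last n ω
    rw [this]
    exact measurable_const
  | cast e ih =>
    have hfb := R.info_mono (Input.forwardStage_subset_backwardStage n e.castSucc e.castSucc)
    have hb := (R.info_mono (Input.before_subset_forwardStage n e.castSucc)).trans hfb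
    have hv := (ih (Fin.succ_ne_zero e)).mono (R.info_mono
      (Input.backwardStage_anti n (Fin.castSucc_lt_succ (i := e)).le)) le_rfl
    have hw := h.w.mono hb le_rfl
    have hy := (h.y_stage e.castSucc (Fin.castSucc_lt_last e).ne).mono hfb le_rfl
    have hf : Measurable[R.info (Input.backwardStage n e.castSucc)] (R.fresh n) :=
      (R.measurable_fresh_sigma n).mono
        ((R.sigma_le_info (Input.flag_mem_forwardStage n e.castSucc)).trans hfb) le_rfl
    have hs : Measurable[R.info (Input.backwardStage n e.castSucc)] (R.X.seedB n e.castSucc) :=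
      (comap_measurable _ : Measurable[R.X.sigma (.seedB n e.castSucc)] _).mono
        (R.sigma_le_info (Input.seedB_mem_backwardStage n e.castSucc)) le_rfl
    have hvIn : Measurable[R.info (Input.backwardStage n e.castSucc)] (R.vIn n e) :=
      measurable_adjoint_apply
        (measurable_D1 R.smooth.differentiable e hy (measurable_block hw e)) hv
    have hvo := (h.v e.castSucc hi).mono hb le_rfl
    have hc := (R.contractB.measurable e.castSucc hi (Fin.castSucc_lt_last e).ne).comp
      (hs.prodMk (hvIn.sub hvo))
    rw [show R.v (n + 1) e.castSucc = _ from funext (R.v_castSucc n e)]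
    exact Measurable.ite (hf (measurableSet_singleton true)) hvIn (hvo.add hc)

variable {R} in
-- As in the forward pass, the backward message precedes its own seed; the backward stages contain
-- all forward seeds of the iteration.
lemma Adapted.vIn_stage {n : ℕ} (h : R.Adapted n) (e : Fin E) :
    Measurable[R.info (Input.backwardStage n e.succ)] (R.vIn n e) := by
  have hfb := R.info_mono (Input.forwardStage_subset_backwardStage n e.castSucc e.succ)
  exact measurable_adjoint_apply
    (measurable_D1 R.smooth.differentiable e
      ((h.y_stage e.castSucc (Fin.castSucc_lt_last e).ne).mono hfb le_rfl)
      (measurable_block (h.w.mono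
        ((R.info_mono (Input.before_subset_forwardStage n e.castSucc)).trans hfb) le_rfl) e))
    (h.v_stage e.succ (Fin.succ_ne_zero e))

variable {R} in
lemma Adapted.g_stage {n : ℕ} (h : R.Adapted n) :
    Measurable[R.info (Input.before (n + 1))] (R.g n) := by
  refine measurable_params fun e => measurable_adjoint_apply
    (measurable_D2 R.smooth.differentiable e
      ((h.y_stage e.castSucc (Fin.castSucc_lt_last e).ne).mono
        (R.info_mono (Input.forwardStage_subset_before n _)) le_rfl)
      (measurable_block (h.w.mono (R.info_mono ?_) le_rfl) e))
    ((h.v_stage e.succ (Fin.succ_ne_zero e)).mono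
        (R.info_mono (Input.backwardStage_subset_before n _)) le_rfl)
  exact (Input.before_subset_forwardStage n e.castSucc).trans
    (Input.forwardStage_subset_before n _)

lemma adapted (n : ℕ) : R.Adapted n := by
  induction n with
  | zero =>
    refine ⟨?_, fun _ _ => ?_, fun _ _ => ?_, ?_, ?_⟩
    all_goals exact measurable_const
  | succ n h =>
    have hb : Input.before n ⊆ (Input.before (n + 1) : Set (Input E)) :=
      (Input.before_subset_forwardStage n 0).trans (Input.forwardStage_subset_before n 0)
    have hu : Measurable[R.info (Input.before (n + 1))] (R.u (n + 1)) := by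
      rw [show R.u (n + 1) = _ from funext (R.u_succ n)]
      exact ((h.u.mono (R.info_mono hb) le_rfl).const_smul (1 - R.m)).add
        (h.g_stage.const_smul R.m)
    exact {
      x := (h.x_stage 0).mono (R.info_mono (Input.forwardStage_subset_before n 0)) le_rfl
      y := fun i hi => (h.y_stage i hi).mono
        (R.info_mono (Input.forwardStage_subset_before n i)) le_rfl
      v := fun i hi => (h.v_stage i hi).mono
        (R.info_mono (Input.backwardStage_subset_before n i)) le_rfl
      u := hu
      w := (h.w.mono (R.info_mono hb) le_rfl).sub (hu.const_smul R.γ) }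

end Trial

lemma enorm_le_ofReal_mul {V W : Type*} [NormedAddCommGroup V] [NormedAddCommGroup W] {a : V}
    {b : W} {c : ℝ} (hc : 0 ≤ c) (h : ‖a‖ ≤ c * ‖b‖) : ‖a‖ₑ ≤ ENNReal.ofReal c * ‖b‖ₑ := by
  rw [← ofReal_norm, ← ofReal_norm, ← ENNReal.ofReal_mul hc]
  exact ENNReal.ofReal_le_ofReal h

lemma enorm_sq_eq_ofReal {V : Type*} [NormedAddCommGroup V] (a : V) :
    ‖a‖ₑ ^ 2 = ENNReal.ofReal (‖a‖ ^ 2) := by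
  rw [← ofReal_norm, ENNReal.ofReal_pow (norm_nonneg a)]

lemma lintegral_const_mul_sq {Ω : Type*} [MeasurableSpace Ω] {μ : Measure Ω} (c : ℝ≥0∞)
    {f : Ω → ℝ≥0∞} (hf : Measurable f) :
    ∫⁻ ω, (c * f ω) ^ 2 ∂μ = c ^ 2 * ∫⁻ ω, f ω ^ 2 ∂μ := by
  simp_rw [mul_pow]
  exact lintegral_const_mul _ (hf.pow_const 2)

/-! ### Constants -/

/-- Bound for the accumulated error of activation `k`. -/
def forwardConst (E : ℕ) (M p : ℝ) : ℕ → ℝ≥0∞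
  | 0 => 0
  | k + 1 => trackSumConst p * (ENNReal.ofReal M ^ 2 * forwardConst E M p k +
      ENNReal.ofReal (flowBound E M) ^ 2)

/-- Bound for the accumulated error of all activations. -/
def forwardConstSum (E : ℕ) (M p : ℝ) : ℝ≥0∞ := ∑ k ∈ Finset.range (E + 1), forwardConst E M p k

/-- Bound for the accumulated error of the activation gradient that is `k` layers from the end. -/
def backwardConst (E : ℕ) (M p : ℝ) : ℕ → ℝ≥0∞
  | 0 => 0
  | k + 1 => trackSumConst p * ((2 * (ENNReal.ofReal M ^ 2 * backwardConst E M p k) +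
      2 * (ENNReal.ofReal (M * flowBound E M) ^ 2 * forwardConstSum E M p)) +
      ENNReal.ofReal (flowBound E M) ^ 2)

/-- Bound for the accumulated error of all activation gradients. -/
def backwardConstSum (E : ℕ) (M p : ℝ) : ℝ≥0∞ :=
  ∑ k ∈ Finset.range (E + 1), backwardConst E M p k

/-- Square of a Lipschitz constant for the deviation of the gradient noise. -/
def driftConst (E : ℕ) (M : ℝ) : ℝ := 4 * (E * (3 * M * flowBound E M ^ 2) ^ 2) + 4 * M ^ 2

/-- Bound for the accumulated bias of the stochastic gradients. -/
def biasConst (E : ℕ) (M p : ℝ) : ℝ≥0∞ :=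
  E * (ENNReal.ofReal (4 * M ^ 2) * backwardConstSum E M p +
    ENNReal.ofReal (4 * (M * flowBound E M) ^ 2) * forwardConstSum E M p) +
  ENNReal.ofReal (driftConst E M) * trackSumConst p

lemma forwardConst_ne_top (E : ℕ) (M : ℝ) {p : ℝ} (hp : 0 < p) (k : ℕ) :
    forwardConst E M p k ≠ ⊤ := by
  have := trackSumConst_ne_top hp
  induction k with
  | zero => simp [forwardConst]
  | succ k ih =>
    unfold forwardConst
    finiteness

lemma forwardConstSum_ne_top (E : ℕ) (M : ℝ) {p : ℝ} (hp : 0 < p) :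
    forwardConstSum E M p ≠ ⊤ :=
  ENNReal.sum_ne_top.2 fun k _ => forwardConst_ne_top E M hp k

lemma backwardConst_ne_top (E : ℕ) (M : ℝ) {p : ℝ} (hp : 0 < p) (k : ℕ) :
    backwardConst E M p k ≠ ⊤ := by
  have := trackSumConst_ne_top hp
  have := forwardConstSum_ne_top E M hp
  induction k with
  | zero => simp [backwardConst]
  | succ k ih =>
    unfold backwardConst
    finiteness

lemma biasConst_ne_top (E : ℕ) (M : ℝ) {p : ℝ} (hp : 0 < p) : biasConst E M p ≠ ⊤ := by
  have := trackSumConst_ne_top hp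
  have := forwardConstSum_ne_top E M hp
  have : backwardConstSum E M p ≠ ⊤ :=
    ENNReal.sum_ne_top.2 fun k _ => backwardConst_ne_top E M hp k
  unfold biasConst
  finiteness

lemma forwardConst_le_sum (E : ℕ) (M p : ℝ) (i : Fin (E + 1)) :
    forwardConst E M p i ≤ forwardConstSum E M p :=
  Finset.single_le_sum (f := fun k => forwardConst E M p k) (fun _ _ => zero_le)
    (Finset.mem_range.2 i.2)

lemma backwardConst_le_sum (E : ℕ) (M p : ℝ) (k : ℕ) (hk : k ≤ E) :
    backwardConst E M p k ≤ backwardConstSum E M p :=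
  Finset.single_le_sum (f := fun k => backwardConst E M p k) (fun _ _ => zero_le)
    (Finset.mem_range.2 (Nat.lt_succ_of_le hk))

/-! ### Tracking errors of activations and activation gradients -/

namespace Trial

variable {E : ℕ} {S Ω : Type*} [MeasurableSpace S] [MeasurableSpace Ω] (R : Trial E S Ω)

lemma M_nonneg : 0 ≤ R.M := zero_le_one.trans R.one_le_M

lemma flowBound_nonneg : 0 ≤ flowBound E R.M := zero_le_one.trans (one_le_flowBound R.one_le_M)

lemma before_mono {n k : ℕ} (h : n ≤ k) : R.info (Input.before n) ≤ R.info (Input.before k) :=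
  R.info_mono fun _ hj => lt_of_lt_of_le hj h

lemma measurable_fresh (n : ℕ) : Measurable (R.fresh n) :=
  (R.measurable_fresh_sigma n).mono (R.sigma_le _) le_rfl

lemma measurable_u (n : ℕ) : Measurable (R.u n) := (R.adapted n).u.mono (R.info_le _) le_rfl

lemma measurable_w (n : ℕ) : Measurable (R.w n) := (R.adapted n).w.mono (R.info_le _) le_rfl

/-- The weights used by the last iteration. -/
def wPrev (n : ℕ) (ω : Ω) : R.P.Params := R.w (n - 1) ω

lemma wPrev_succ (n : ℕ) (ω : Ω) : R.wPrev (n + 1) ω = R.w n ω := rfl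

/-- This also holds at `n = 0`: truncated subtraction gives `wPrev 0 = w 0`, and the momentum starts
at zero. -/
lemma norm_w_sub_wPrev (n : ℕ) (ω : Ω) : ‖R.w n ω - R.wPrev n ω‖ = R.γ * ‖R.u n ω‖ := by
  cases n with
  | zero => simp [wPrev, u_zero]
  | succ n =>
    rw [w_succ, wPrev_succ, sub_sub_cancel_left, norm_neg, norm_smul, Real.norm_of_nonneg R.γ_pos.le]

lemma measurable_wPrev_before (n : ℕ) : Measurable[R.info (Input.before n)] (R.wPrev n) :=
  (R.adapted (n - 1)).w.mono (R.before_mono (Nat.sub_le n 1)) le_rfl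

/-- The exact activations of the last iteration. -/
def yExact (n : ℕ) (i : Fin (E + 1)) (ω : Ω) : R.P.Act i := R.P.activation (R.x n ω) (R.wPrev n ω) i

/-- The exact activation gradients of the last iteration. -/
def vExact (n : ℕ) (i : Fin (E + 1)) (ω : Ω) : R.P.Act i := R.P.costate (R.x n ω) (R.wPrev n ω) i

lemma measurable_yExact_before (n : ℕ) (i : Fin (E + 1)) :
    Measurable[R.info (Input.before n)] (R.yExact n i) :=
  measurable_activation R.smooth.differentiable (R.adapted n).x (R.measurable_wPrev_before n) i

lemma measurable_vExact_before (n : ℕ) (i : Fin (E + 1)) :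
    Measurable[R.info (Input.before n)] (R.vExact n i) :=
  measurable_costate R.smooth.differentiable (R.adapted n).x (R.measurable_wPrev_before n) i

lemma measurable_yErr_before (n : ℕ) (i : Fin (E + 1)) (hi : i ≠ Fin.last E) :
    Measurable[R.info (Input.before n)] (fun ω => R.y n i ω - R.yExact n i ω) :=
  ((R.adapted n).y i hi).sub (R.measurable_yExact_before n i)

lemma measurable_vErr_before (n : ℕ) (i : Fin (E + 1)) (hi : i ≠ 0) :
    Measurable[R.info (Input.before n)] (fun ω => R.v n i ω - R.vExact n i ω) :=
  ((R.adapted n).v i hi).sub (R.measurable_vExact_before n i)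

/-- Only an inequality, because iteration `0` is fresh whatever its coin shows. -/
lemma measure_stale_le (n : ℕ) : R.μ {ω | R.fresh n ω = false} ≤ ENNReal.ofReal (1 - R.p) := by
  cases n with
  | zero => simp [fresh_zero]
  | succ n =>
    have h1 : {ω | R.fresh (n + 1) ω = false} = {ω | R.X.flag (n + 1) ω = true}ᶜ := by
      ext ω
      simp [fresh]
    have h2 : MeasurableSet {ω | R.X.flag (n + 1) ω = true} :=
      R.driver.flag_measurable (n + 1) (measurableSet_singleton true)
    rw [h1, prob_compl_eq_one_sub h2, R.driver.flag_law, ENNReal.ofReal_sub _ R.p_pos.le,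
      ENNReal.ofReal_one]

/-- What is known before iteration `n` is independent of whether this iteration is fresh. -/
lemma setLIntegral_stale (n : ℕ) {f : Ω → ℝ≥0∞}
    (hf : Measurable[R.info (Input.before n)] f) :
    ∫⁻ ω in {ω | R.fresh n ω = false}, f ω ∂(R.μ) =
      R.μ {ω | R.fresh n ω = false} * ∫⁻ ω, f ω ∂(R.μ) := by
  have hT : MeasurableSet {ω | R.fresh n ω = false} :=
    R.measurable_fresh n (measurableSet_singleton false)
  have hTs : MeasurableSet[R.X.sigma (.flag n)] {ω | R.fresh n ω = false} :=
    R.measurable_fresh_sigma n (measurableSet_singleton false)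
  have hind : Indep (R.info (Input.before n)) (R.X.sigma (.flag n)) R.μ :=
    indep_of_indep_of_le_right
      (R.indep_info (Set.disjoint_singleton_right.2 (Input.flag_notMem_before n)))
      (R.sigma_le_info (Set.mem_singleton _))
  have h := lintegral_mul_eq_lintegral_mul_lintegral_of_independent_measurableSpace
    (R.info_le _) (R.sigma_le _) hind hf
    ((measurable_const (a := (1 : ℝ≥0∞))).indicator hTs)
  rw [lintegral_indicator_const hT, one_mul] at h
  rw [mul_comm, ← h, ← lintegral_indicator hT]
  refine lintegral_congr fun ω => ?_
  by_cases hω : ω ∈ {ω | R.fresh n ω = false}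
  · simp [Set.indicator_of_mem hω]
  · simp [Set.indicator_of_notMem hω]

/-- The gain from lazy sampling: errors carried over from the past are independent of the current
coin. -/
lemma setLIntegral_stale_le (n : ℕ) {V : Type*} [NormedAddCommGroup V] [MeasurableSpace V]
    [BorelSpace V] {f : Ω → V} (hf : Measurable[R.info (Input.before n)] f) :
    ∫⁻ ω in {ω | R.fresh n ω = false}, ‖f ω‖ₑ ^ 2 ∂(R.μ) ≤
      ENNReal.ofReal (1 - R.p) * ∫⁻ ω, ‖f ω‖ₑ ^ 2 ∂(R.μ) := by
  have hφ : Measurable (fun z : V => ‖z‖ₑ ^ 2) := measurable_enorm.pow_const 2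
  refine (R.setLIntegral_stale n (hφ.comp hf)).le.trans ?_
  exact mul_le_mul_left (R.measure_stale_le n) _

lemma setLIntegral_stale_zero (f : Ω → ℝ≥0∞) :
    ∫⁻ ω in {ω | R.fresh 0 ω = false}, f ω ∂(R.μ) = 0 := by
  simp [fresh_zero]

/-- The second moment of the momentum. -/
def uSq (n : ℕ) : ℝ≥0∞ := ∫⁻ ω, ‖R.u n ω‖ₑ ^ 2 ∂(R.μ)

/-- The accumulated movement of the weights. -/
def travel (N : ℕ) : ℝ≥0∞ := ENNReal.ofReal R.γ ^ 2 * ∑ n ∈ Finset.range N, R.uSq n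

/-- The mean square error of activation `i` in the last iteration. -/
def yErr (i : Fin (E + 1)) : ℕ → ℝ≥0∞
  | 0 => 0
  | n + 1 => ∫⁻ ω, ‖R.y (n + 1) i ω - R.yExact (n + 1) i ω‖ₑ ^ 2 ∂(R.μ)

/-- The mean square error of activation gradient `i` in the last iteration. -/
def vErr (i : Fin (E + 1)) : ℕ → ℝ≥0∞
  | 0 => 0
  | n + 1 => ∫⁻ ω, ‖R.v (n + 1) i ω - R.vExact (n + 1) i ω‖ₑ ^ 2 ∂(R.μ)

lemma x_succ_of_stale {n : ℕ} {ω : Ω} (h : R.fresh n ω = false) : R.x (n + 1) ω = R.x n ω := by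
  simp [x_succ, h]

lemma contractive_bound {ν : Measure S} {C : R.P.Compressor S} (h : R.P.Contractive ν C 1)
    {i : Fin (E + 1)} (h0 : i ≠ 0) (h1 : i ≠ Fin.last E) (z : R.P.Act i) :
    ∫⁻ s, ‖z - C i s z‖ₑ ^ 2 ∂ν ≤ ‖z‖ₑ ^ 2 := by
  rw [enorm_sq_eq_ofReal z]
  simpa using h.contractive i h0 h1 z

lemma sum_sq_increment (c : ℝ) (hc : 0 ≤ c) (N : ℕ) :
    ∑ n ∈ Finset.range N, ∫⁻ ω, (ENNReal.ofReal (c * R.γ) * ‖R.u n ω‖ₑ) ^ 2 ∂(R.μ) =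
      ENNReal.ofReal c ^ 2 * R.travel N := by
  simp_rw [lintegral_const_mul_sq _ (R.measurable_u _).enorm]
  rw [← Finset.mul_sum, ENNReal.ofReal_mul hc, travel, mul_pow, mul_assoc]
  rfl

/-- The targets are the exact activations at the sample and weights of the iteration. The message
misses the new target only through the error of its incoming activation. On a stale iteration the
target moves only with the weights. -/
lemma yErr_succ_le (e : Fin E) (he : e.succ ≠ Fin.last E) (n : ℕ) :
    R.yErr e.succ (n + 1) ≤ ENNReal.ofReal (1 + R.p / 4) *
      (ENNReal.ofReal (1 + R.p / 4) * ENNReal.ofReal (1 - R.p)) * R.yErr e.succ n +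
      trackConst R.p * (∫⁻ ω, (ENNReal.ofReal R.M *
          ‖R.y (n + 1) e.castSucc ω - R.yExact (n + 1) e.castSucc ω‖ₑ) ^ 2 ∂(R.μ) +
        ∫⁻ ω, (ENNReal.ofReal (flowBound E R.M * R.γ) * ‖R.u n ω‖ₑ) ^ 2 ∂(R.μ)) := by
  have hlast := (Fin.castSucc_lt_last e).ne
  have A := R.adapted n
  have hseed : Measurable (R.X.seedF n e.succ) := R.driver.seedF_measurable n e.succ
  have hyIn : Measurable (R.yIn n e) := (A.yIn_stage e).mono (R.info_le _) le_rfl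
  have hy : Measurable (R.y n e.succ) := (A.y e.succ he).mono (R.info_le _) le_rfl
  refine lintegral_tracking_le R.p_pos
    (R.contractF.measurable e.succ (Fin.succ_ne_zero e) he)
    (R.contractive_bound R.contractF (Fin.succ_ne_zero e) he)
    (R.measurable_fresh n) hy hyIn
    ((R.measurable_yExact_before n e.succ).mono (R.info_le _) le_rfl)
    (((R.measurable_yErr_before (n + 1) e.castSucc hlast).mono
      (R.info_le _) le_rfl).enorm.const_mul _) ((R.measurable_u n).enorm.const_mul _)
    hseed (R.driver.seedF_law n e.succ) ?_ (R.y_succ n e) ?_ ?_ ?_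
  · refine R.indepFun_of_notMem (J := Input.forwardStage n e.castSucc) (j := .seedF n e.succ)
      (Input.seedF_notMem_forwardStage n Fin.castSucc_lt_succ) ?_ (comap_measurable _)
    have hf : Measurable[R.info (Input.forwardStage n e.castSucc)] (R.fresh n) :=
      (R.measurable_fresh_sigma n).mono
        (R.sigma_le_info (Input.flag_mem_forwardStage n e.castSucc)) le_rfl
    exact hf.prodMk ((A.yIn_stage e).sub ((A.y e.succ he).mono
      (R.info_mono (Input.before_subset_forwardStage n e.castSucc)) le_rfl))
  · intro ω
    refine enorm_le_ofReal_mul R.M_nonneg ?_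
    have h := R.smooth.a_lipschitz e he (R.y (n + 1) e.castSucc ω)
      (R.yExact (n + 1) e.castSucc ω) (R.w n ω e) (R.w n ω e)
    simpa [yIn, yExact, wPrev_succ] using h
  · intro ω hω
    refine enorm_le_ofReal_mul (mul_nonneg R.flowBound_nonneg R.γ_pos.le) ?_
    rw [mul_assoc, ← norm_w_sub_wPrev]
    unfold yExact
    rw [R.x_succ_of_stale hω, wPrev_succ]
    exact norm_activation_sub_le_flow R.smooth R.one_le_M _ _ _ _ he
  -- The initial memory approximates nothing, but iteration `0` is never stale, so the value `yErr _
  -- 0 = 0` is a legitimate start of the recursion.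
  · cases n with
    | zero => rw [R.setLIntegral_stale_zero]; exact zero_le
    | succ n =>
      exact R.setLIntegral_stale_le (n + 1)
        (R.measurable_yErr_before (n + 1) e.succ he)

/-- Induction along the forward pass, starting from the sample, which is communicated exactly. -/
lemma sum_yErr_le (i : Fin (E + 1)) (hi : i ≠ Fin.last E) (N : ℕ) :
    ∑ n ∈ Finset.range N, R.yErr i (n + 1) ≤ forwardConst E R.M R.p i * R.travel N := by
  induction i using Fin.induction with
  | zero => simp [yErr, y_zero, yExact]
  | succ e ih =>
    have hlast := (Fin.castSucc_lt_last e).ne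
    refine (sum_tracking_le R.p_pos R.p_le_one rfl (R.yErr_succ_le e hi) N).trans ?_
    rw [Finset.sum_add_distrib, R.sum_sq_increment _ R.flowBound_nonneg]
    simp_rw [lintegral_const_mul_sq _ ((R.measurable_yErr_before _ e.castSucc hlast).mono
      (R.info_le _) le_rfl).enorm]
    rw [← Finset.mul_sum]
    calc _ ≤ trackSumConst R.p * (ENNReal.ofReal R.M ^ 2 *
          (forwardConst E R.M R.p (e.castSucc : Fin (E + 1)) * R.travel N) +
          ENNReal.ofReal (flowBound E R.M) ^ 2 * R.travel N) := by
          gcongr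
          exact ih hlast
      _ = _ := by
          simp only [Fin.val_succ, Fin.val_castSucc, forwardConst]
          ring

/-- The backward message inherits two errors: that of the incoming activation gradient, through the
bounded Jacobian, and that of the activation at which the Jacobian is evaluated, through its
Lipschitz constant times the bound on the exact activation gradient. -/
lemma vErr_castSucc_le (e : Fin E) (he : e.castSucc ≠ 0) (n : ℕ) :
    R.vErr e.castSucc (n + 1) ≤ ENNReal.ofReal (1 + R.p / 4) *
      (ENNReal.ofReal (1 + R.p / 4) * ENNReal.ofReal (1 - R.p)) * R.vErr e.castSucc n +
      trackConst R.p * (∫⁻ ω, (ENNReal.ofReal R.M *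
          ‖R.v (n + 1) e.succ ω - R.vExact (n + 1) e.succ ω‖ₑ +
          ENNReal.ofReal (R.M * flowBound E R.M) *
          ‖R.y (n + 1) e.castSucc ω - R.yExact (n + 1) e.castSucc ω‖ₑ) ^ 2 ∂(R.μ) +
        ∫⁻ ω, (ENNReal.ofReal (flowBound E R.M * R.γ) * ‖R.u n ω‖ₑ) ^ 2 ∂(R.μ)) := by
  have hlast := (Fin.castSucc_lt_last e).ne
  have he0 : (e : ℕ) ≠ 0 := fun h => he (Fin.ext (by simpa using h))
  have A := R.adapted n
  have hseed : Measurable (R.X.seedB n e.castSucc) := R.driver.seedB_measurable n e.castSucc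
  have hvIn : Measurable (R.vIn n e) := (A.vIn_stage e).mono (R.info_le _) le_rfl
  have hv : Measurable (R.v n e.castSucc) := (A.v e.castSucc he).mono (R.info_le _) le_rfl
  refine lintegral_tracking_le R.p_pos
    (R.contractB.measurable e.castSucc he hlast)
    (R.contractive_bound R.contractB he hlast)
    (R.measurable_fresh n) hv hvIn
    ((R.measurable_vExact_before n e.castSucc).mono (R.info_le _) le_rfl)
    ((((R.measurable_vErr_before (n + 1) e.succ (Fin.succ_ne_zero e)).mono
      (R.info_le _) le_rfl).enorm.const_mul _).add
      (((R.measurable_yErr_before (n + 1) e.castSucc hlast).mono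
      (R.info_le _) le_rfl).enorm.const_mul _)) ((R.measurable_u n).enorm.const_mul _)
    hseed (R.driver.seedB_law n e.castSucc) ?_ (R.v_castSucc n e) ?_ ?_ ?_
  · refine R.indepFun_of_notMem (J := Input.backwardStage n e.succ) (j := .seedB n e.castSucc)
      (Input.seedB_notMem_backwardStage n Fin.castSucc_lt_succ) ?_ (comap_measurable _)
    have hfb := R.info_mono (Input.forwardStage_subset_backwardStage n e.castSucc e.succ)
    have hf : Measurable[R.info (Input.backwardStage n e.succ)] (R.fresh n) :=
      (R.measurable_fresh_sigma n).mono
        ((R.sigma_le_info (Input.flag_mem_forwardStage n e.castSucc)).trans hfb) le_rfl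
    exact hf.prodMk ((A.vIn_stage e).sub ((A.v e.castSucc he).mono
      ((R.info_mono (Input.before_subset_forwardStage n e.castSucc)).trans hfb) le_rfl))
  · intro ω
    have h1 := R.smooth.D1_lipschitz e he0 (R.y (n + 1) e.castSucc ω)
      (R.yExact (n + 1) e.castSucc ω) (R.w n ω e) (R.w n ω e)
    rw [sub_self, norm_zero, add_zero] at h1
    have h2 := norm_adjoint_sub_le (R.smooth.D1_bound e _ _) h1 (R.v (n + 1) e.succ ω)
      (R.vExact (n + 1) e.succ ω)
    have h3 : ‖R.vExact (n + 1) e.succ ω‖ ≤ flowBound E R.M :=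
      norm_costate_le R.smooth R.one_le_M _ _ _
    have h4 : R.vIn n e ω - R.vExact (n + 1) e.castSucc ω =
        (R.P.D1 e (R.y (n + 1) e.castSucc ω) (R.w n ω e)).adjoint (R.v (n + 1) e.succ ω) -
        (R.P.D1 e (R.yExact (n + 1) e.castSucc ω) (R.w n ω e)).adjoint
          (R.vExact (n + 1) e.succ ω) := by
      simp [vIn, vExact, yExact, wPrev_succ]
    rw [h4, ← ofReal_norm, ← ofReal_norm, ← ofReal_norm, ← ENNReal.ofReal_mul R.M_nonneg,
      ← ENNReal.ofReal_mul (mul_nonneg R.M_nonneg R.flowBound_nonneg),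
      ← ENNReal.ofReal_add (mul_nonneg R.M_nonneg (norm_nonneg _))
        (mul_nonneg (mul_nonneg R.M_nonneg R.flowBound_nonneg) (norm_nonneg _))]
    refine ENNReal.ofReal_le_ofReal (h2.trans ?_)
    have h5 := mul_le_mul_of_nonneg_left h3 (mul_nonneg R.M_nonneg
      (norm_nonneg (R.y (n + 1) e.castSucc ω - R.yExact (n + 1) e.castSucc ω)))
    linarith
  · intro ω hω
    refine enorm_le_ofReal_mul (mul_nonneg R.flowBound_nonneg R.γ_pos.le) ?_
    rw [mul_assoc, ← norm_w_sub_wPrev]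
    unfold vExact
    rw [R.x_succ_of_stale hω, wPrev_succ]
    exact norm_costate_sub_le R.smooth R.one_le_M _ _ _ _ he
  · cases n with
    | zero => rw [R.setLIntegral_stale_zero]; exact zero_le
    | succ n =>
      exact R.setLIntegral_stale_le (n + 1)
        (R.measurable_vErr_before (n + 1) e.castSucc he)

/-- Induction along the backward pass, starting from the exact value `1` at the last index; the
activation errors are already controlled. -/
lemma sum_vErr_le (i : Fin (E + 1)) (hi : i ≠ 0) (N : ℕ) :
    ∑ n ∈ Finset.range N, R.vErr i (n + 1) ≤
      backwardConst E R.M R.p (E - (i : ℕ)) * R.travel N := by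
  induction i using Fin.reverseInduction with
  | last => simp [vErr, v_last, vExact]
  | cast e ih =>
    have hlast := (Fin.castSucc_lt_last e).ne
    refine (sum_tracking_le R.p_pos R.p_le_one rfl (R.vErr_castSucc_le e hi) N).trans ?_
    rw [Finset.sum_add_distrib, R.sum_sq_increment _ R.flowBound_nonneg]
    have hsplit : ∀ n, ∫⁻ ω, (ENNReal.ofReal R.M *
          ‖R.v (n + 1) e.succ ω - R.vExact (n + 1) e.succ ω‖ₑ +
          ENNReal.ofReal (R.M * flowBound E R.M) *
          ‖R.y (n + 1) e.castSucc ω - R.yExact (n + 1) e.castSucc ω‖ₑ) ^ 2 ∂(R.μ) ≤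
        2 * (ENNReal.ofReal R.M ^ 2 * R.vErr e.succ (n + 1)) +
        2 * (ENNReal.ofReal (R.M * flowBound E R.M) ^ 2 * R.yErr e.castSucc (n + 1)) := by
      intro n
      have m1 := ((R.measurable_vErr_before (n + 1) e.succ (Fin.succ_ne_zero e)).mono
        (R.info_le _) le_rfl).enorm
      have m2 := ((R.measurable_yErr_before (n + 1) e.castSucc hlast).mono
        (R.info_le _) le_rfl).enorm
      refine (lintegral_mono fun ω => ennreal_add_sq_le_two _ _).trans ?_
      rw [lintegral_add_left (((m1.const_mul _).pow_const 2).const_mul _),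
        lintegral_const_mul _ ((m1.const_mul _).pow_const 2),
        lintegral_const_mul _ ((m2.const_mul _).pow_const 2), lintegral_const_mul_sq _ m1,
        lintegral_const_mul_sq _ m2]
      rfl
    have e1 : E - ((e.castSucc : Fin (E + 1)) : ℕ) = (E - ((e.succ : Fin (E + 1)) : ℕ)) + 1 := by
      simp; omega
    rw [e1]
    calc _ ≤ trackSumConst R.p * (∑ n ∈ Finset.range N,
          (2 * (ENNReal.ofReal R.M ^ 2 * R.vErr e.succ (n + 1)) +
          2 * (ENNReal.ofReal (R.M * flowBound E R.M) ^ 2 * R.yErr e.castSucc (n + 1))) +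
          ENNReal.ofReal (flowBound E R.M) ^ 2 * R.travel N) := by
          gcongr with n
          exact hsplit n
      _ = trackSumConst R.p * ((2 * (ENNReal.ofReal R.M ^ 2 *
            ∑ n ∈ Finset.range N, R.vErr e.succ (n + 1)) +
          2 * (ENNReal.ofReal (R.M * flowBound E R.M) ^ 2 *
            ∑ n ∈ Finset.range N, R.yErr e.castSucc (n + 1))) +
          ENNReal.ofReal (flowBound E R.M) ^ 2 * R.travel N) := by
          rw [Finset.sum_add_distrib, ← Finset.mul_sum, ← Finset.mul_sum, ← Finset.mul_sum,
            ← Finset.mul_sum]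
      _ ≤ trackSumConst R.p * ((2 * (ENNReal.ofReal R.M ^ 2 *
            (backwardConst E R.M R.p (E - ((e.succ : Fin (E + 1)) : ℕ)) * R.travel N)) +
          2 * (ENNReal.ofReal (R.M * flowBound E R.M) ^ 2 *
            (forwardConstSum E R.M R.p * R.travel N))) +
          ENNReal.ofReal (flowBound E R.M) ^ 2 * R.travel N) := by
          gcongr
          · exact ih (Fin.succ_ne_zero e)
          · exact (R.sum_yErr_le e.castSucc hlast N).trans
              (mul_le_mul_left (forwardConst_le_sum E R.M R.p e.castSucc) _)
      _ = _ := by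
          rw [backwardConst]
          ring

/-! ### The weights at the last refresh -/

/-- The weights at the last fresh iteration. -/
def wRef : ℕ → Ω → R.P.Params
  | 0, _ => R.w₁
  | n + 1, ω => if R.fresh n ω then R.w n ω else wRef n ω

lemma wRef_succ (n : ℕ) (ω : Ω) :
    R.wRef (n + 1) ω = if R.fresh n ω then R.w n ω else R.wRef n ω := rfl

lemma measurable_fresh_before (n : ℕ) : Measurable[R.info (Input.before (n + 1))] (R.fresh n) :=
  (R.measurable_fresh_sigma n).mono
    (R.sigma_le_info (Input.forwardStage_subset_before n 0 (Input.flag_mem_forwardStage n 0)))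
    le_rfl

lemma measurable_wRef_before (n : ℕ) : Measurable[R.info (Input.before n)] (R.wRef n) := by
  induction n with
  | zero => exact measurable_const
  | succ n ih =>
    exact Measurable.ite (R.measurable_fresh_before n (measurableSet_singleton true))
      ((R.adapted n).w.mono (R.before_mono n.le_succ) le_rfl)
      (ih.mono (R.before_mono n.le_succ) le_rfl)

/-- The mean square distance from the weights at the last refresh. -/
def wErr : ℕ → ℝ≥0∞
  | 0 => 0
  | n + 1 => ∫⁻ ω, ‖R.wRef (n + 1) ω - R.w n ω‖ₑ ^ 2 ∂(R.μ)

/-- `wRef` is a memory whose compressor always returns `0`: it keeps its value on stale iterations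
and is overwritten on fresh ones. The zero compressor satisfies the contraction bound with constant
`1`, so the general recursion applies, with message equal to target. -/
lemma wErr_succ_le (n : ℕ) :
    R.wErr (n + 1) ≤ ENNReal.ofReal (1 + R.p / 4) *
      (ENNReal.ofReal (1 + R.p / 4) * ENNReal.ofReal (1 - R.p)) * R.wErr n +
      trackConst R.p * (∫⁻ _, (0 : ℝ≥0∞) ^ 2 ∂(R.μ) +
        ∫⁻ ω, (ENNReal.ofReal (1 * R.γ) * ‖R.u n ω‖ₑ) ^ 2 ∂(R.μ)) := by
  have hq := (R.measurable_wRef_before n).mono (R.info_le _) le_rfl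
  refine lintegral_tracking_le (S := Unit) (ν := Measure.dirac ()) (C := fun _ _ => 0)
    (s := fun _ => ()) (q := R.wRef n) (h := R.w n) (τ := R.wPrev n) R.p_pos measurable_const
    (fun z => by simp) (R.measurable_fresh n) hq (R.measurable_w n)
    ((R.measurable_wPrev_before n).mono (R.info_le _) le_rfl) measurable_const
    ((R.measurable_u n).enorm.const_mul _) measurable_const (by simp [Measure.map_const])
    (indepFun_const_right _ _) (fun ω => by rw [add_zero]; rfl) (fun ω => by simp) ?_ ?_
  · intro ω _
    refine enorm_le_ofReal_mul (mul_nonneg zero_le_one R.γ_pos.le) ?_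
    rw [one_mul, ← norm_w_sub_wPrev]
  · cases n with
    | zero => rw [R.setLIntegral_stale_zero]; exact zero_le
    | succ n =>
      exact R.setLIntegral_stale_le (n + 1)
        ((R.measurable_wRef_before (n + 1)).sub (R.measurable_wPrev_before (n + 1)))

lemma sum_wErr_le (N : ℕ) :
    ∑ n ∈ Finset.range N, R.wErr (n + 1) ≤ trackSumConst R.p * R.travel N := by
  refine (sum_tracking_le R.p_pos R.p_le_one rfl R.wErr_succ_le N).trans ?_
  rw [Finset.sum_add_distrib, R.sum_sq_increment _ zero_le_one]
  simp

/-! ### The bias of the stochastic gradients -/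

/-- The noise of the stochastic gradient at the last refresh. -/
def noise : ℕ → Ω → R.P.Params
  | 0, _ => 0
  | n + 1, ω => R.P.lossGrad (R.x (n + 1) ω) (R.wRef (n + 1) ω) -
      gradient (R.P.risk R.D) (R.wRef (n + 1) ω)

/-- The gradient of the objective. -/
def G (n : ℕ) (ω : Ω) : R.P.Params := gradient (R.P.risk R.D) (R.w n ω)

/-- The part of the stochastic gradient that is neither exact gradient nor noise. -/
def bias (n : ℕ) (ω : Ω) : R.P.Params := R.g n ω - R.noise (n + 1) ω - R.G n ω

lemma norm_sq_g_sub_le (n : ℕ) (ω : Ω) :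
    ‖R.g n ω - R.P.lossGrad (R.x (n + 1) ω) (R.w n ω)‖ ^ 2 ≤
      ∑ e : Fin E, (2 * R.M ^ 2 * ‖R.v (n + 1) e.succ ω - R.vExact (n + 1) e.succ ω‖ ^ 2 +
        2 * (R.M * flowBound E R.M) ^ 2 *
          ‖R.y (n + 1) e.castSucc ω - R.yExact (n + 1) e.castSucc ω‖ ^ 2) := by
  rw [PiLp.norm_sq_eq_of_L2]
  refine Finset.sum_le_sum fun e _ => ?_
  set dy := ‖R.y (n + 1) e.castSucc ω - R.yExact (n + 1) e.castSucc ω‖ with hdy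
  set dv := ‖R.v (n + 1) e.succ ω - R.vExact (n + 1) e.succ ω‖
  have h1 : ‖R.P.D2 e (R.y (n + 1) e.castSucc ω) (R.w n ω e) -
      R.P.D2 e (R.yExact (n + 1) e.castSucc ω) (R.w n ω e)‖ ≤ R.M * dy := by
    -- `D2` of the first operator need not be Lipschitz in its input, but that input is the sample
    -- and carries no error.
    by_cases he : (e : ℕ) = 0
    · have h0 : R.y (n + 1) e.castSucc ω = R.yExact (n + 1) e.castSucc ω := by
        have : e.castSucc = 0 := Fin.ext (by simpa using he)
        rw [this, y_zero]
        simp [yExact]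
      rw [h0, sub_self, norm_zero]
      exact mul_nonneg R.M_nonneg (norm_nonneg _)
    · have h := R.smooth.D2_lipschitz e he (R.y (n + 1) e.castSucc ω)
        (R.yExact (n + 1) e.castSucc ω) (R.w n ω e) (R.w n ω e)
      simpa using h
  have h2 := norm_adjoint_sub_le (R.smooth.D2_bound e _ _) h1 (R.v (n + 1) e.succ ω)
      (R.vExact (n + 1) e.succ ω)
  have h3 : ‖R.vExact (n + 1) e.succ ω‖ ≤ flowBound E R.M :=
    norm_costate_le R.smooth R.one_le_M _ _ _
  have h4 : (R.g n ω - R.P.lossGrad (R.x (n + 1) ω) (R.w n ω)) e =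
      (R.P.D2 e (R.y (n + 1) e.castSucc ω) (R.w n ω e)).adjoint (R.v (n + 1) e.succ ω) -
      (R.P.D2 e (R.yExact (n + 1) e.castSucc ω) (R.w n ω e)).adjoint
        (R.vExact (n + 1) e.succ ω) := rfl
  rw [h4]
  have h5 : 0 ≤ R.M * dy := mul_nonneg R.M_nonneg (norm_nonneg _)
  have h6 := h2.trans (add_le_add_right (mul_le_mul_of_nonneg_left h3 h5) (R.M * dv))
  refine (pow_le_pow_left₀ (norm_nonneg _) h6 2).trans ?_
  nlinarith [sq_nonneg (R.M * dv - R.M * dy * flowBound E R.M)]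

/-- On a fresh iteration `wRef` is the current point and the drift vanishes identically. Otherwise
it is the variation of the sample gradient minus that of the full gradient between the two weights;
only the former uses smoothness of the first layer. -/
lemma norm_sq_drift_le (n : ℕ) (ω : Ω) (h : R.fresh n ω = true ∨ R.P.FirstLayerSmooth R.M) :
    ‖R.P.lossGrad (R.x (n + 1) ω) (R.w n ω) - R.noise (n + 1) ω - R.G n ω‖ ^ 2 ≤
      driftConst E R.M / 2 * ‖R.wRef (n + 1) ω - R.w n ω‖ ^ 2 := by
  have hd : 0 ≤ driftConst E R.M := by unfold driftConst; positivity
  rcases h with h | h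
  · have : R.wRef (n + 1) ω = R.w n ω := by rw [wRef_succ, h]; rfl
    simp [noise, G, this]
  · have h1 : ‖R.P.lossGrad (R.x (n + 1) ω) (R.w n ω) -
        R.P.lossGrad (R.x (n + 1) ω) (R.wRef (n + 1) ω)‖ ^ 2 ≤
        E * (3 * R.M * flowBound E R.M ^ 2) ^ 2 * ‖R.wRef (n + 1) ω - R.w n ω‖ ^ 2 := by
      rw [PiLp.norm_sq_eq_of_L2]
      calc _ ≤ ∑ _e : Fin E, (3 * R.M * flowBound E R.M ^ 2 *
            ‖R.wRef (n + 1) ω - R.w n ω‖) ^ 2 := by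
            refine Finset.sum_le_sum fun e _ => pow_le_pow_left₀ (norm_nonneg _) ?_ 2
            rw [norm_sub_rev (R.wRef (n + 1) ω)]
            exact norm_lossGrad_block_sub_le R.smooth R.one_le_M h _ _ _ e
        _ = _ := by
            rw [Finset.sum_const, Finset.card_univ, Fintype.card_fin, nsmul_eq_mul]
            ring
    have h2 : ‖gradient (R.P.risk R.D) (R.wRef (n + 1) ω) - R.G n ω‖ ^ 2 ≤
        R.M ^ 2 * ‖R.wRef (n + 1) ω - R.w n ω‖ ^ 2 := by
      rw [← mul_pow]
      exact pow_le_pow_left₀ (norm_nonneg _) (R.smooth.risk_lipschitz _ _) 2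
    have h3 : R.P.lossGrad (R.x (n + 1) ω) (R.w n ω) - R.noise (n + 1) ω - R.G n ω =
        (R.P.lossGrad (R.x (n + 1) ω) (R.w n ω) -
          R.P.lossGrad (R.x (n + 1) ω) (R.wRef (n + 1) ω)) +
        (gradient (R.P.risk R.D) (R.wRef (n + 1) ω) - R.G n ω) := by
      simp only [noise]
      abel
    rw [h3]
    refine (pow_le_pow_left₀ (norm_nonneg _) (norm_add_le _ _) 2).trans ?_
    refine (add_sq_le).trans ?_
    unfold driftConst
    nlinarith

lemma norm_sq_bias_le (n : ℕ) (ω : Ω) (h : R.fresh n ω = true ∨ R.P.FirstLayerSmooth R.M) :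
    ‖R.bias n ω‖ ^ 2 ≤
      ∑ e : Fin E, (4 * R.M ^ 2 * ‖R.v (n + 1) e.succ ω - R.vExact (n + 1) e.succ ω‖ ^ 2 +
        4 * (R.M * flowBound E R.M) ^ 2 *
          ‖R.y (n + 1) e.castSucc ω - R.yExact (n + 1) e.castSucc ω‖ ^ 2) +
      driftConst E R.M * ‖R.wRef (n + 1) ω - R.w n ω‖ ^ 2 := by
  have h1 := R.norm_sq_g_sub_le n ω
  have h2 := R.norm_sq_drift_le n ω h
  have h3 : R.bias n ω = (R.g n ω - R.P.lossGrad (R.x (n + 1) ω) (R.w n ω)) +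
      (R.P.lossGrad (R.x (n + 1) ω) (R.w n ω) - R.noise (n + 1) ω - R.G n ω) := by
    simp only [bias]
    abel
  rw [h3]
  refine (pow_le_pow_left₀ (norm_nonneg _) (norm_add_le _ _) 2).trans ?_
  refine (add_sq_le).trans ?_
  have h4 : ∑ e : Fin E, (4 * R.M ^ 2 *
        ‖R.v (n + 1) e.succ ω - R.vExact (n + 1) e.succ ω‖ ^ 2 +
        4 * (R.M * flowBound E R.M) ^ 2 *
          ‖R.y (n + 1) e.castSucc ω - R.yExact (n + 1) e.castSucc ω‖ ^ 2) =
      2 * ∑ e : Fin E, (2 * R.M ^ 2 *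
        ‖R.v (n + 1) e.succ ω - R.vExact (n + 1) e.succ ω‖ ^ 2 +
        2 * (R.M * flowBound E R.M) ^ 2 *
          ‖R.y (n + 1) e.castSucc ω - R.yExact (n + 1) e.castSucc ω‖ ^ 2) := by
    rw [Finset.mul_sum]
    exact Finset.sum_congr rfl fun e _ => by ring
  rw [h4]
  linarith

/-- For `p = 1` stale iterations form a null set, which replaces the smoothness of the first layer.
-/
lemma ae_fresh_or_first (n : ℕ) :
    ∀ᵐ ω ∂(R.μ), R.fresh n ω = true ∨ R.P.FirstLayerSmooth R.M := by
  rcases R.first with h | h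
  · have h0 := R.measure_stale_le n
    rw [h, sub_self, ENNReal.ofReal_zero, nonpos_iff_eq_zero] at h0
    have : ∀ᵐ ω ∂(R.μ), ¬ (R.fresh n ω = false) := by
      rw [ae_iff]
      simpa using h0
    filter_upwards [this] with ω hω
    exact Or.inl (by simpa using hω)
  · exact Filter.Eventually.of_forall fun _ => Or.inr h

lemma lintegral_bias_le (n : ℕ) :
    ∫⁻ ω, ‖R.bias n ω‖ₑ ^ 2 ∂(R.μ) ≤
      ∑ e : Fin E, (ENNReal.ofReal (4 * R.M ^ 2) * R.vErr e.succ (n + 1) +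
        ENNReal.ofReal (4 * (R.M * flowBound E R.M) ^ 2) * R.yErr e.castSucc (n + 1)) +
      ENNReal.ofReal (driftConst E R.M) * R.wErr (n + 1) := by
  have hd : 0 ≤ driftConst E R.M := by unfold driftConst; positivity
  have hv : ∀ e : Fin E, Measurable
      (fun ω => ‖R.v (n + 1) e.succ ω - R.vExact (n + 1) e.succ ω‖ₑ ^ 2) := fun e =>
    ((R.measurable_vErr_before (n + 1) e.succ (Fin.succ_ne_zero e)).mono
      (R.info_le _) le_rfl).enorm.pow_const 2
  have hy : ∀ e : Fin E, Measurable
      (fun ω => ‖R.y (n + 1) e.castSucc ω - R.yExact (n + 1) e.castSucc ω‖ₑ ^ 2) := fun e =>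
    ((R.measurable_yErr_before (n + 1) e.castSucc (Fin.castSucc_lt_last e).ne).mono
      (R.info_le _) le_rfl).enorm.pow_const 2
  have hw : Measurable (fun ω => ‖R.wRef (n + 1) ω - R.w n ω‖ₑ ^ 2) :=
    (((R.measurable_wRef_before (n + 1)).mono (R.info_le _) le_rfl).sub
      (R.measurable_w n)).enorm.pow_const 2
  have hvy : ∀ e : Fin E, Measurable (fun ω => ENNReal.ofReal (4 * R.M ^ 2) *
      ‖R.v (n + 1) e.succ ω - R.vExact (n + 1) e.succ ω‖ₑ ^ 2 +
      ENNReal.ofReal (4 * (R.M * flowBound E R.M) ^ 2) *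
        ‖R.y (n + 1) e.castSucc ω - R.yExact (n + 1) e.castSucc ω‖ₑ ^ 2) := fun e =>
    ((hv e).const_mul _).add ((hy e).const_mul _)
  calc _ ≤ ∫⁻ ω, (∑ e : Fin E, (ENNReal.ofReal (4 * R.M ^ 2) *
          ‖R.v (n + 1) e.succ ω - R.vExact (n + 1) e.succ ω‖ₑ ^ 2 +
        ENNReal.ofReal (4 * (R.M * flowBound E R.M) ^ 2) *
          ‖R.y (n + 1) e.castSucc ω - R.yExact (n + 1) e.castSucc ω‖ₑ ^ 2) +
        ENNReal.ofReal (driftConst E R.M) * ‖R.wRef (n + 1) ω - R.w n ω‖ₑ ^ 2) ∂(R.μ) := by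
        refine lintegral_mono_ae ?_
        filter_upwards [R.ae_fresh_or_first n] with ω hω
        have h := ENNReal.ofReal_le_ofReal (R.norm_sq_bias_le n ω hω)
        rw [enorm_sq_eq_ofReal]
        refine h.trans (le_of_eq ?_)
        rw [ENNReal.ofReal_add (Finset.sum_nonneg fun e _ => by positivity) (by positivity),
          ENNReal.ofReal_sum_of_nonneg fun e _ => by positivity, ENNReal.ofReal_mul hd,
          enorm_sq_eq_ofReal]
        congr 1
        refine Finset.sum_congr rfl fun e _ => ?_
        rw [ENNReal.ofReal_add (by positivity) (by positivity),
          ENNReal.ofReal_mul (show 0 ≤ 4 * R.M ^ 2 by positivity),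
          ENNReal.ofReal_mul (show 0 ≤ 4 * (R.M * flowBound E R.M) ^ 2 by positivity),
          enorm_sq_eq_ofReal, enorm_sq_eq_ofReal]
    _ = _ := by
        rw [lintegral_add_right _ (hw.const_mul _), lintegral_const_mul _ hw,
          lintegral_finsetSum _ fun e _ => hvy e]
        congr 1
        refine Finset.sum_congr rfl fun e _ => ?_
        rw [lintegral_add_left ((hv e).const_mul _), lintegral_const_mul _ (hv e),
          lintegral_const_mul _ (hy e)]
        rfl

/-- All three sources of bias (activations, activation gradients, drift) are multiples of the same
squared weight increments. This makes the bias absorbable for small step sizes. -/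
lemma sum_bias_le (N : ℕ) :
    ∑ n ∈ Finset.range N, ∫⁻ ω, ‖R.bias n ω‖ₑ ^ 2 ∂(R.μ) ≤ biasConst E R.M R.p * R.travel N := by
  calc _ ≤ ∑ n ∈ Finset.range N,
        (∑ e : Fin E, (ENNReal.ofReal (4 * R.M ^ 2) * R.vErr e.succ (n + 1) +
        ENNReal.ofReal (4 * (R.M * flowBound E R.M) ^ 2) * R.yErr e.castSucc (n + 1)) +
        ENNReal.ofReal (driftConst E R.M) * R.wErr (n + 1)) :=
        Finset.sum_le_sum fun n _ => R.lintegral_bias_le n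
    _ = ∑ e : Fin E, (ENNReal.ofReal (4 * R.M ^ 2) *
          ∑ n ∈ Finset.range N, R.vErr e.succ (n + 1) +
        ENNReal.ofReal (4 * (R.M * flowBound E R.M) ^ 2) *
          ∑ n ∈ Finset.range N, R.yErr e.castSucc (n + 1)) +
        ENNReal.ofReal (driftConst E R.M) * ∑ n ∈ Finset.range N, R.wErr (n + 1) := by
        rw [Finset.sum_add_distrib, Finset.sum_comm, Finset.mul_sum]
        congr 1
        refine Finset.sum_congr rfl fun e _ => ?_
        rw [Finset.sum_add_distrib, Finset.mul_sum, Finset.mul_sum]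
    _ ≤ ∑ e : Fin E, (ENNReal.ofReal (4 * R.M ^ 2) *
          (backwardConstSum E R.M R.p * R.travel N) +
        ENNReal.ofReal (4 * (R.M * flowBound E R.M) ^ 2) *
          (forwardConstSum E R.M R.p * R.travel N)) +
        ENNReal.ofReal (driftConst E R.M) * (trackSumConst R.p * R.travel N) := by
        gcongr with e
        · exact (R.sum_vErr_le e.succ (Fin.succ_ne_zero e) N).trans
            (mul_le_mul_left (backwardConst_le_sum E R.M R.p _ (Nat.sub_le _ _)) _)
        · exact (R.sum_yErr_le e.castSucc (Fin.castSucc_lt_last e).ne N).trans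
            (mul_le_mul_left (forwardConst_le_sum E R.M R.p e.castSucc) _)
        · exact R.sum_wErr_le N
    _ = _ := by
        rw [Finset.sum_const, Finset.card_univ, Fintype.card_fin, nsmul_eq_mul, biasConst]
        ring

end Trial

lemma integrable_of_measurable_of_abs_le {Ω : Type*} [MeasurableSpace Ω] {μ : Measure Ω}
    [IsFiniteMeasure μ] {f : Ω → ℝ} (hf : Measurable f) {c : ℝ} (hc : ∀ ω, |f ω| ≤ c) :
    Integrable f μ :=
  Integrable.of_bound hf.aestronglyMeasurable c (Filter.Eventually.of_forall hc)

namespace Trial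

variable {E : ℕ} {S Ω : Type*} [MeasurableSpace S] [MeasurableSpace Ω] (R : Trial E S Ω)

/-! ### Boundedness of the gradients -/

/-- A bound for the gradients of the sample losses. -/
def gradBound : ℝ := Real.sqrt E * (R.M * flowBound E R.M)

lemma gradBound_nonneg : 0 ≤ R.gradBound :=
  mul_nonneg (Real.sqrt_nonneg _) (mul_nonneg R.M_nonneg R.flowBound_nonneg)

/-- Bounded Jacobians bound the exact gradients, hence the noise and its averages, whose moments are
then automatically integrable. No such bound is available for the computed gradient `g`. -/
lemma norm_lossGrad_le (x : R.P.Act 0) (w : R.P.Params) : ‖R.P.lossGrad x w‖ ≤ R.gradBound := by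
  refine abs_le_of_sq_le_sq' ?_ R.gradBound_nonneg |>.2
  rw [PiLp.norm_sq_eq_of_L2, gradBound, mul_pow, Real.sq_sqrt (Nat.cast_nonneg E)]
  calc _ ≤ ∑ _e : Fin E, (R.M * flowBound E R.M) ^ 2 := by
        refine Finset.sum_le_sum fun e _ => pow_le_pow_left₀ (norm_nonneg _) ?_ 2
        exact norm_lossGrad_block_le R.smooth R.one_le_M x w e
    _ = _ := by rw [Finset.sum_const, Finset.card_univ, Fintype.card_fin, nsmul_eq_mul]

lemma integral_lossGrad (w : R.P.Params) :
    ∫ x, R.P.lossGrad x w ∂(R.D) = gradient (R.P.risk R.D) w := by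
  rw [← R.unbiased.unbiased w]
  simp_rw [gradient_loss R.smooth]

lemma integrable_lossGrad (w : R.P.Params) : Integrable (fun x => R.P.lossGrad x w) R.D :=
  Integrable.of_bound (measurable_lossGrad R.smooth.differentiable measurable_id
    measurable_const).aestronglyMeasurable R.gradBound
    (Filter.Eventually.of_forall fun x => R.norm_lossGrad_le x w)

lemma norm_gradient_risk_le (w : R.P.Params) : ‖gradient (R.P.risk R.D) w‖ ≤ R.gradBound := by
  rw [← R.integral_lossGrad w]
  simpa using norm_integral_le_of_norm_le_const (μ := R.D)
    (Filter.Eventually.of_forall fun x => R.norm_lossGrad_le x w)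

lemma continuous_gradient_risk : Continuous (gradient (R.P.risk R.D)) :=
  (LipschitzWith.of_dist_le_mul (K := ⟨R.M, R.M_nonneg⟩) fun w w' => by
    rw [dist_eq_norm, dist_eq_norm]
    exact R.smooth.risk_lipschitz w w').continuous

/-- The noise of the gradient of a sample loss. -/
def gradNoise (x : R.P.Act 0) (w : R.P.Params) : R.P.Params :=
  R.P.lossGrad x w - gradient (R.P.risk R.D) w

lemma measurable_gradNoise {α : Type*} {mα : MeasurableSpace α} {x : α → R.P.Act 0}
    {w : α → R.P.Params} (hx : Measurable x) (hw : Measurable w) :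
    Measurable (fun ω => R.gradNoise (x ω) (w ω)) :=
  (measurable_lossGrad R.smooth.differentiable hx hw).sub
    (R.continuous_gradient_risk.measurable.comp hw)

lemma norm_gradNoise_le (x : R.P.Act 0) (w : R.P.Params) :
    ‖R.gradNoise x w‖ ≤ 2 * R.gradBound := by
  have h1 := R.norm_lossGrad_le x w
  have h2 := R.norm_gradient_risk_le w
  have h3 := norm_sub_le (R.P.lossGrad x w) (gradient (R.P.risk R.D) w)
  unfold gradNoise
  linarith

lemma integrable_gradNoise (w : R.P.Params) : Integrable (fun x => R.gradNoise x w) R.D :=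
  (R.integrable_lossGrad w).sub (integrable_const _)

lemma integral_gradNoise (w : R.P.Params) : ∫ x, R.gradNoise x w ∂(R.D) = 0 := by
  unfold gradNoise
  rw [integral_sub (R.integrable_lossGrad w) (integrable_const _), R.integral_lossGrad]
  simp

lemma integral_norm_sq_gradNoise_le (w : R.P.Params) :
    ∫ x, ‖R.gradNoise x w‖ ^ 2 ∂(R.D) ≤ R.σ ^ 2 := by
  have hm : Measurable (fun x => ‖R.gradNoise x w‖ ^ 2) :=
    (R.measurable_gradNoise measurable_id measurable_const).norm.pow_const 2
  have hi : Integrable (fun x => ‖R.gradNoise x w‖ ^ 2) R.D := by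
    refine integrable_of_measurable_of_abs_le hm (c := (2 * R.gradBound) ^ 2) fun x => ?_
    rw [abs_of_nonneg (by positivity)]
    exact pow_le_pow_left₀ (norm_nonneg _) (R.norm_gradNoise_le x w) 2
  rw [← ENNReal.ofReal_le_ofReal_iff (sq_nonneg _),
    ofReal_integral_eq_lintegral_ofReal hi (Filter.Eventually.of_forall fun x => by positivity)]
  have h := R.unbiased.variance w
  simp_rw [gradient_loss R.smooth, enorm_sq_eq_ofReal] at h
  exact h

/-! ### The noise of the momentum -/

/-- A stale iteration keeps both the sample and `wRef`, hence the noise; this is the reason for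
evaluating the noise at `wRef`. -/
lemma noise_succ (n : ℕ) (ω : Ω) :
    R.noise (n + 1) ω = if R.fresh n ω then R.gradNoise (R.X.sample n ω) (R.w n ω)
      else R.noise n ω := by
  by_cases h : R.fresh n ω = true
  · simp [noise, gradNoise, x_succ, wRef_succ, h]
  · cases n with
    | zero => exact absurd (R.fresh_zero ω) h
    | succ n =>
      have h' : R.fresh (n + 1) ω = false := by simpa using h
      rw [if_neg h]
      simp only [noise]
      rw [R.x_succ_of_stale h', wRef_succ R (n + 1), h']
      rfl

lemma measurable_noise_before (n : ℕ) : Measurable[R.info (Input.before n)] (R.noise n) := by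
  cases n with
  | zero => exact measurable_const
  | succ n =>
    exact R.measurable_gradNoise (R.adapted (n + 1)).x (R.measurable_wRef_before (n + 1))

lemma norm_noise_le (n : ℕ) (ω : Ω) : ‖R.noise n ω‖ ≤ 2 * R.gradBound := by
  cases n with
  | zero =>
    have := R.gradBound_nonneg
    simp only [noise, norm_zero]
    positivity
  | succ n => exact R.norm_gradNoise_le _ _

/-- The contribution of the noise to the momentum. -/
def avgNoise : ℕ → Ω → R.P.Params
  | 0, _ => 0
  | n + 1, ω => (1 - R.m) • avgNoise n ω + R.m • R.noise (n + 1) ω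

lemma avgNoise_succ (n : ℕ) (ω : Ω) :
    R.avgNoise (n + 1) ω = (1 - R.m) • R.avgNoise n ω + R.m • R.noise (n + 1) ω := rfl

lemma measurable_avgNoise_before (n : ℕ) :
    Measurable[R.info (Input.before n)] (R.avgNoise n) := by
  induction n with
  | zero => exact measurable_const
  | succ n ih =>
    exact ((ih.mono (R.before_mono n.le_succ) le_rfl).const_smul (1 - R.m)).add
      ((R.measurable_noise_before (n + 1)).const_smul R.m)

lemma norm_avgNoise_le (n : ℕ) (ω : Ω) : ‖R.avgNoise n ω‖ ≤ 2 * R.gradBound := by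
  have h1 : 0 ≤ 1 - R.m := by linarith [R.m_lt_one]
  induction n with
  | zero =>
    have := R.gradBound_nonneg
    simp only [avgNoise, norm_zero]
    positivity
  | succ n ih =>
    rw [avgNoise_succ]
    refine (norm_add_le _ _).trans ?_
    rw [norm_smul, norm_smul, Real.norm_of_nonneg h1, Real.norm_of_nonneg R.m_pos.le]
    have h2 := R.norm_noise_le (n + 1) ω
    have h3 := mul_le_mul_of_nonneg_left ih h1
    have h4 := mul_le_mul_of_nonneg_left h2 R.m_pos.le
    linarith

lemma measurable_noise (n : ℕ) : Measurable (R.noise n) :=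
  (R.measurable_noise_before n).mono (R.info_le _) le_rfl

lemma measurable_avgNoise (n : ℕ) : Measurable (R.avgNoise n) :=
  (R.measurable_avgNoise_before n).mono (R.info_le _) le_rfl

/-- The indicator of a stale iteration. -/
def stale (n : ℕ) (ω : Ω) : ℝ := if R.fresh n ω then 0 else 1

lemma measurable_stale_sigma (n : ℕ) : Measurable[R.X.sigma (.flag n)] (R.stale n) :=
  (measurable_of_countable (fun b : Bool => if b then (0 : ℝ) else 1)).comp
    (R.measurable_fresh_sigma n)

lemma measurable_stale (n : ℕ) : Measurable (R.stale n) :=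
  (R.measurable_stale_sigma n).mono (R.sigma_le _) le_rfl

lemma stale_nonneg (n : ℕ) (ω : Ω) : 0 ≤ R.stale n ω := by
  unfold stale
  split_ifs <;> norm_num

lemma stale_le_one (n : ℕ) (ω : Ω) : R.stale n ω ≤ 1 := by
  unfold stale
  split_ifs <;> norm_num

/-- The probability of a stale iteration. -/
def staleProb (n : ℕ) : ℝ := ∫ ω, R.stale n ω ∂(R.μ)

lemma integrable_stale (n : ℕ) : Integrable (R.stale n) R.μ :=
  integrable_of_measurable_of_abs_le (R.measurable_stale n) fun ω => by
    rw [abs_of_nonneg (R.stale_nonneg n ω)]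
    exact R.stale_le_one n ω

lemma staleProb_nonneg (n : ℕ) : 0 ≤ R.staleProb n := integral_nonneg (R.stale_nonneg n)

lemma staleProb_le (n : ℕ) : R.staleProb n ≤ 1 - R.p := by
  have h0 : 0 ≤ 1 - R.p := by linarith [R.p_le_one]
  have hT : MeasurableSet {ω | R.fresh n ω = false} :=
    R.measurable_fresh n (measurableSet_singleton false)
  have h1 : R.stale n = Set.indicator {ω | R.fresh n ω = false} 1 := by
    funext ω
    by_cases h : R.fresh n ω = true
    · simp [stale, h]
    · simp [stale, h]
  rw [staleProb, h1, integral_indicator_one hT]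
  exact ENNReal.toReal_le_of_le_ofReal h0 (R.measure_stale_le n)

lemma integral_mul_stale (n : ℕ) {f : Ω → ℝ} (hf : Measurable[R.info (Input.before n)] f) :
    ∫ ω, f ω * R.stale n ω ∂(R.μ) = (∫ ω, f ω ∂(R.μ)) * R.staleProb n := by
  have h := R.indepFun_of_notMem (Input.flag_notMem_before n) hf (R.measurable_stale_sigma n)
  exact h.integral_mul_eq_mul_integral
    (hf.mono (R.info_le _) le_rfl).aestronglyMeasurable (R.measurable_stale n).aestronglyMeasurable

/-- In a fresh iteration the sample can be integrated out. -/
lemma integral_fresh (n : ℕ) {Φ : (R.P.Params × R.P.Params) × R.P.Act 0 → ℝ} (hΦ : Measurable Φ)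
    {c : ℝ} (hc : ∀ ω ξ, |Φ ((R.avgNoise n ω, R.w n ω), ξ)| ≤ c) :
    ∫ ω, (1 - R.stale n ω) * Φ ((R.avgNoise n ω, R.w n ω), R.X.sample n ω) ∂(R.μ) =
      ∫ ω, (1 - R.stale n ω) * ∫ ξ, Φ ((R.avgNoise n ω, R.w n ω), ξ) ∂(R.D) ∂(R.μ) := by
  let q : Ω → ℝ × (R.P.Params × R.P.Params) := fun ω => (R.stale n ω, (R.avgNoise n ω, R.w n ω))
  let Ψ : (ℝ × (R.P.Params × R.P.Params)) × R.P.Act 0 → ℝ := fun z => (1 - z.1.1) * Φ (z.1.2, z.2)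
  have hΨ : Measurable Ψ :=
    (measurable_const.sub measurable_fst.fst).mul
      (hΦ.comp (measurable_fst.snd.prodMk measurable_snd))
  -- The coin is adjoined to the past, since the sample has to be independent of both together.
  have hqJ : Measurable[R.info (Input.before n ∪ {Input.flag n})] q := by
    have hb := R.info_mono
      (Set.subset_union_left : Input.before n ⊆ Input.before n ∪ {Input.flag n})
    exact ((R.measurable_stale_sigma n).mono
      (R.sigma_le_info (Or.inr rfl)) le_rfl).prodMk
      (((R.measurable_avgNoise_before n).mono hb le_rfl).prodMk ((R.adapted n).w.mono hb le_rfl))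
  have hq : Measurable q := hqJ.mono (R.info_le _) le_rfl
  have hs : Measurable (R.X.sample n) := R.driver.sample_measurable n
  have hind : IndepFun q (R.X.sample n) R.μ :=
    R.indepFun_of_notMem (j := .sample n) (Input.sample_notMem_before_flag n) hqJ
      (comap_measurable _)
  have hmap := (indepFun_iff_map_prod_eq_prod_map_map hq.aemeasurable hs.aemeasurable).1 hind
  have hbound : ∀ ω ξ, |Ψ (q ω, ξ)| ≤ c := by
    intro ω ξ
    have h1 := R.stale_nonneg n ω
    have h2 := R.stale_le_one n ω
    simp only [Ψ, q, abs_mul]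
    rw [abs_of_nonneg (by linarith)]
    exact (mul_le_of_le_one_left (abs_nonneg _) (by linarith)).trans (hc ω ξ)
  have hprob : IsProbabilityMeasure (R.μ.map q) := Measure.isProbabilityMeasure_map hq.aemeasurable
  -- The bound is known only along the process, so integrability against the product law is obtained
  -- by pulling back to `Ω`.
  have hint : Integrable Ψ ((R.μ.map q).prod R.D) := by
    refine Integrable.of_bound hΨ.aestronglyMeasurable c ?_
    rw [← R.driver.sample_law n, ← hmap]
    rw [ae_map_iff (hq.prodMk hs).aemeasurable
      (measurableSet_le hΨ.norm measurable_const)]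
    exact Filter.Eventually.of_forall fun ω => hbound ω _
  calc _ = ∫ z, Ψ z ∂(R.μ.map (fun ω => (q ω, R.X.sample n ω))) := by
        rw [integral_map (hq.prodMk hs).aemeasurable hΨ.aestronglyMeasurable]
    _ = ∫ z, ∫ ξ, Ψ (z, ξ) ∂(R.D) ∂(R.μ.map q) := by
        rw [hmap, R.driver.sample_law n, integral_prod _ hint]
    _ = ∫ ω, ∫ ξ, Ψ (q ω, ξ) ∂(R.D) ∂(R.μ) := by
        rw [integral_map hq.aemeasurable]
        exact (hΨ.stronglyMeasurable.integral_prod_right (ν := R.D)).aestronglyMeasurable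
    _ = _ := by
        refine integral_congr_ae (Filter.Eventually.of_forall fun ω => ?_)
        exact integral_const_mul (1 - R.stale n ω) _

lemma noise_split (n : ℕ) (ω : Ω) (F : R.P.Params → ℝ) :
    F (R.noise (n + 1) ω) = (1 - R.stale n ω) * F (R.gradNoise (R.X.sample n ω) (R.w n ω)) +
      F (R.noise n ω) * R.stale n ω := by
  rw [noise_succ, stale]
  split_ifs <;> simp

lemma integrable_norm_sq_noise (n : ℕ) : Integrable (fun ω => ‖R.noise n ω‖ ^ 2) R.μ := by
  refine integrable_of_measurable_of_abs_le ((R.measurable_noise n).norm.pow_const 2)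
    (c := (2 * R.gradBound) ^ 2) fun ω => ?_
  rw [abs_of_nonneg (by positivity)]
  exact pow_le_pow_left₀ (norm_nonneg _) (R.norm_noise_le n ω) 2

lemma integrable_norm_sq_avgNoise (n : ℕ) : Integrable (fun ω => ‖R.avgNoise n ω‖ ^ 2) R.μ := by
  refine integrable_of_measurable_of_abs_le ((R.measurable_avgNoise n).norm.pow_const 2)
    (c := (2 * R.gradBound) ^ 2) fun ω => ?_
  rw [abs_of_nonneg (by positivity)]
  exact pow_le_pow_left₀ (norm_nonneg _) (R.norm_avgNoise_le n ω) 2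

lemma abs_inner_le_of_norm_le {V : Type*} [NormedAddCommGroup V] [InnerProductSpace ℝ V]
    {a b : V} {c : ℝ} (ha : ‖a‖ ≤ c) (hb : ‖b‖ ≤ c) : |inner ℝ a b| ≤ c * c :=
  (abs_real_inner_le_norm a b).trans
    (mul_le_mul ha hb (norm_nonneg _) ((norm_nonneg _).trans ha))

lemma integrable_one_sub_stale_mul (n : ℕ) {f : Ω → ℝ} (hf : Measurable f) {c : ℝ}
    (hc : ∀ ω, |f ω| ≤ c) : Integrable (fun ω => (1 - R.stale n ω) * f ω) R.μ := by
  refine integrable_of_measurable_of_abs_le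
    ((measurable_const.sub (R.measurable_stale n)).mul hf) (c := c) fun ω => ?_
  have h1 := R.stale_nonneg n ω
  have h2 := R.stale_le_one n ω
  rw [abs_mul, abs_of_nonneg (by linarith : 0 ≤ 1 - R.stale n ω)]
  exact (mul_le_of_le_one_left (abs_nonneg _) (by linarith)).trans (hc ω)

lemma integrable_mul_stale (n : ℕ) {f : Ω → ℝ} (hf : Measurable f) {c : ℝ}
    (hc : ∀ ω, |f ω| ≤ c) : Integrable (fun ω => f ω * R.stale n ω) R.μ := by
  refine integrable_of_measurable_of_abs_le (hf.mul (R.measurable_stale n)) (c := c) fun ω => ?_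
  rw [abs_mul, abs_of_nonneg (R.stale_nonneg n ω)]
  exact (mul_le_of_le_one_right (abs_nonneg _) (R.stale_le_one n ω)).trans (hc ω)

lemma measurable_sample_gradNoise (n : ℕ) :
    Measurable (fun ω => R.gradNoise (R.X.sample n ω) (R.w n ω)) :=
  R.measurable_gradNoise (R.driver.sample_measurable n) (R.measurable_w n)

/-- The second moment is a convex combination of that of new noise, bounded by the variance
assumption, and that of the retained noise, which is independent of the coin. -/
lemma integral_norm_sq_noise_le (n : ℕ) : ∫ ω, ‖R.noise n ω‖ ^ 2 ∂(R.μ) ≤ R.σ ^ 2 := by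
  induction n with
  | zero =>
    simp only [noise, norm_zero, ne_eq, OfNat.ofNat_ne_zero, not_false_eq_true, zero_pow,
      integral_zero]
    positivity
  | succ n ih =>
    have hb : ∀ ω ξ, |‖R.gradNoise ξ (R.w n ω)‖ ^ 2| ≤ (2 * R.gradBound) ^ 2 := fun ω ξ => by
      rw [abs_of_nonneg (by positivity)]
      exact pow_le_pow_left₀ (norm_nonneg _) (R.norm_gradNoise_le _ _) 2
    have hb' : ∀ ω, |‖R.noise n ω‖ ^ 2| ≤ (2 * R.gradBound) ^ 2 := fun ω => by
      rw [abs_of_nonneg (by positivity)]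
      exact pow_le_pow_left₀ (norm_nonneg _) (R.norm_noise_le _ _) 2
    have hΦ : Measurable (fun z : (R.P.Params × R.P.Params) × R.P.Act 0 =>
        ‖R.gradNoise z.2 z.1.2‖ ^ 2) :=
      (R.measurable_gradNoise measurable_snd measurable_fst.snd).norm.pow_const 2
    have h1 := R.integral_fresh n hΦ hb
    simp only at h1
    have hφ : Measurable (fun z : R.P.Params => ‖z‖ ^ 2) := measurable_norm.pow_const 2
    have h2 := R.integral_mul_stale n (hφ.comp (R.measurable_noise_before n))
    simp only [Function.comp] at h2
    have hI := R.integrable_one_sub_stale_mul n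
      ((R.measurable_sample_gradNoise n).norm.pow_const 2) (fun ω => hb ω _)
    simp_rw [fun ω => R.noise_split n ω (fun z => ‖z‖ ^ 2)]
    rw [integral_add hI (R.integrable_mul_stale n ((R.measurable_noise n).norm.pow_const 2) hb'),
      h1, h2]
    have h3 : ∫ ω, (1 - R.stale n ω) * ∫ ξ, ‖R.gradNoise ξ (R.w n ω)‖ ^ 2 ∂(R.D) ∂(R.μ) ≤
        ∫ ω, (1 - R.stale n ω) * R.σ ^ 2 ∂(R.μ) := by
      refine integral_mono_of_nonneg (Filter.Eventually.of_forall fun ω => ?_)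
        (((integrable_const 1).sub (R.integrable_stale n)).mul_const _)
        (Filter.Eventually.of_forall fun ω => ?_)
      · exact mul_nonneg (by linarith [R.stale_le_one n ω]) (integral_nonneg fun _ => by positivity)
      · exact mul_le_mul_of_nonneg_left (R.integral_norm_sq_gradNoise_le _)
          (by linarith [R.stale_le_one n ω])
    have h4 : ∫ ω, (1 - R.stale n ω) * R.σ ^ 2 ∂(R.μ) = (1 - R.staleProb n) * R.σ ^ 2 := by
      rw [integral_mul_const, integral_sub (integrable_const 1) (R.integrable_stale n)]
      simp [staleProb]
    have h5 := mul_le_mul_of_nonneg_right ih (R.staleProb_nonneg n)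
    linarith

lemma integrable_inner_avgNoise (n k : ℕ) :
    Integrable (fun ω => inner ℝ (R.avgNoise n ω) (R.noise k ω)) R.μ :=
  integrable_of_measurable_of_abs_le ((R.measurable_avgNoise n).inner (R.measurable_noise k))
    fun ω => abs_inner_le_of_norm_le (R.norm_avgNoise_le n ω) (R.norm_noise_le k ω)

/-- New noise has mean zero given the past, so only the retained noise correlates with the average.
-/
lemma integral_inner_avgNoise_succ (n : ℕ) :
    ∫ ω, inner ℝ (R.avgNoise n ω) (R.noise (n + 1) ω) ∂(R.μ) =
      (∫ ω, inner ℝ (R.avgNoise n ω) (R.noise n ω) ∂(R.μ)) * R.staleProb n := by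
  have hb : ∀ ω ξ, |inner ℝ (R.avgNoise n ω) (R.gradNoise ξ (R.w n ω))| ≤
      2 * R.gradBound * (2 * R.gradBound) := fun ω ξ =>
    abs_inner_le_of_norm_le (R.norm_avgNoise_le n ω) (R.norm_gradNoise_le _ _)
  have hb' : ∀ ω, |inner ℝ (R.avgNoise n ω) (R.noise n ω)| ≤
      2 * R.gradBound * (2 * R.gradBound) := fun ω =>
    abs_inner_le_of_norm_le (R.norm_avgNoise_le n ω) (R.norm_noise_le _ _)
  have hΦ : Measurable (fun z : (R.P.Params × R.P.Params) × R.P.Act 0 =>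
      inner ℝ z.1.1 (R.gradNoise z.2 z.1.2)) :=
    measurable_fst.fst.inner (R.measurable_gradNoise measurable_snd measurable_fst.snd)
  have h1 := R.integral_fresh n hΦ hb
  simp only at h1
  have hφ : Measurable (fun z : R.P.Params × R.P.Params => inner ℝ z.1 z.2) :=
    measurable_fst.inner measurable_snd
  have h2 := R.integral_mul_stale n (hφ.comp
    ((R.measurable_avgNoise_before n).prodMk (R.measurable_noise_before n)))
  simp only [Function.comp] at h2
  have h3 : ∀ ω, ∫ ξ, inner ℝ (R.avgNoise n ω) (R.gradNoise ξ (R.w n ω)) ∂(R.D) = 0 := by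
    intro ω
    rw [integral_inner (R.integrable_gradNoise _), R.integral_gradNoise, inner_zero_right]
  simp_rw [fun ω => R.noise_split n ω (fun z => inner ℝ (R.avgNoise n ω) z)]
  rw [integral_add (R.integrable_one_sub_stale_mul n
      ((R.measurable_avgNoise n).inner (R.measurable_sample_gradNoise n)) (fun ω => hb ω _))
    (R.integrable_mul_stale n ((R.measurable_avgNoise n).inner (R.measurable_noise n)) hb'),
    h1, h2]
  simp [h3]

/-- The correlation `c` satisfies `c (n + 1) ≤ (1 - p) (c n + m σ²)`: a geometric series of ratio `1
- p`, bounded by `m σ² / p`. -/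
lemma integral_inner_avgNoise_le (n : ℕ) :
    ∫ ω, inner ℝ (R.avgNoise n ω) (R.noise (n + 1) ω) ∂(R.μ) ≤ R.m * R.σ ^ 2 / R.p := by
  have hp := R.p_pos
  have hm := R.m_pos
  have hc : 0 ≤ R.m * R.σ ^ 2 / R.p := by positivity
  induction n with
  | zero => simpa [avgNoise] using hc
  | succ n ih =>
    rw [R.integral_inner_avgNoise_succ (n + 1)]
    have h1 : ∀ ω, inner ℝ (R.avgNoise (n + 1) ω) (R.noise (n + 1) ω) =
        (1 - R.m) * inner ℝ (R.avgNoise n ω) (R.noise (n + 1) ω) +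
          R.m * ‖R.noise (n + 1) ω‖ ^ 2 := by
      intro ω
      rw [avgNoise_succ, inner_add_left, inner_smul_left, inner_smul_left,
        real_inner_self_eq_norm_sq]
      rfl
    simp_rw [h1]
    rw [integral_add ((R.integrable_inner_avgNoise _ _).const_mul _)
      ((R.integrable_norm_sq_noise _).const_mul _), integral_const_mul, integral_const_mul]
    have h2 := R.integral_norm_sq_noise_le (n + 1)
    have h3 : (1 - R.m) * (∫ ω, inner ℝ (R.avgNoise n ω) (R.noise (n + 1) ω) ∂(R.μ)) +
        R.m * (∫ ω, ‖R.noise (n + 1) ω‖ ^ 2 ∂(R.μ)) ≤ R.m * R.σ ^ 2 / R.p + R.m * R.σ ^ 2 := by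
      have h4 := mul_le_mul_of_nonneg_left ih (by linarith [R.m_lt_one] : 0 ≤ 1 - R.m)
      have h5 := mul_le_mul_of_nonneg_left h2 hm.le
      have h6 := mul_nonneg hm.le hc
      linarith
    have h7 : 0 ≤ R.m * R.σ ^ 2 / R.p + R.m * R.σ ^ 2 := by positivity
    calc _ ≤ (R.m * R.σ ^ 2 / R.p + R.m * R.σ ^ 2) * R.staleProb (n + 1) :=
          mul_le_mul_of_nonneg_right h3 (R.staleProb_nonneg _)
      _ ≤ (R.m * R.σ ^ 2 / R.p + R.m * R.σ ^ 2) * (1 - R.p) :=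
          mul_le_mul_of_nonneg_left (R.staleProb_le _) h7
      _ = R.m * R.σ ^ 2 / R.p - R.m * R.σ ^ 2 * R.p := by
          field_simp
          ring
      _ ≤ _ := by
          have : 0 ≤ R.m * R.σ ^ 2 * R.p := by positivity
          linarith

/-- Expanding the square, the old average loses a factor `(1 - m)²`, while the cross term and the
new noise contribute of order `m² σ² / p`. The bound with constant `3` is preserved by this
recursion. -/
lemma integral_norm_sq_avgNoise_le (n : ℕ) :
    ∫ ω, ‖R.avgNoise n ω‖ ^ 2 ∂(R.μ) ≤ 3 / R.p * (R.m * R.σ ^ 2) := by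
  have hp := R.p_pos
  have hm := R.m_pos
  have hm1 := R.m_lt_one
  have hc : 0 ≤ 3 / R.p * (R.m * R.σ ^ 2) := by positivity
  induction n with
  | zero => simpa [avgNoise] using hc
  | succ n ih =>
    have h1 : ∀ ω, ‖R.avgNoise (n + 1) ω‖ ^ 2 = (1 - R.m) ^ 2 * ‖R.avgNoise n ω‖ ^ 2 +
        (2 * R.m * (1 - R.m) * inner ℝ (R.avgNoise n ω) (R.noise (n + 1) ω) +
          R.m ^ 2 * ‖R.noise (n + 1) ω‖ ^ 2) := by
      intro ω
      rw [avgNoise_succ, norm_add_sq_real, norm_smul, norm_smul, inner_smul_left,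
        inner_smul_right, mul_pow, mul_pow, Real.norm_eq_abs, Real.norm_eq_abs, sq_abs, sq_abs]
      simp only [conj_trivial]
      ring
    have hI : Integrable (fun ω =>
        2 * R.m * (1 - R.m) * inner ℝ (R.avgNoise n ω) (R.noise (n + 1) ω) +
          R.m ^ 2 * ‖R.noise (n + 1) ω‖ ^ 2) R.μ :=
      ((R.integrable_inner_avgNoise _ _).const_mul _).add
        ((R.integrable_norm_sq_noise _).const_mul _)
    simp_rw [h1]
    rw [integral_add ((R.integrable_norm_sq_avgNoise _).const_mul _) hI,
      integral_add ((R.integrable_inner_avgNoise _ _).const_mul _)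
        ((R.integrable_norm_sq_noise _).const_mul _),
      integral_const_mul, integral_const_mul, integral_const_mul]
    have h2 := mul_le_mul_of_nonneg_left ih (sq_nonneg (1 - R.m))
    have h3 := mul_le_mul_of_nonneg_left (R.integral_inner_avgNoise_le n)
      (by nlinarith : 0 ≤ 2 * R.m * (1 - R.m))
    have h4 := mul_le_mul_of_nonneg_left (R.integral_norm_sq_noise_le (n + 1)) (sq_nonneg R.m)
    have h5 : (1 - R.m) ^ 2 * (3 / R.p * (R.m * R.σ ^ 2)) +
        (2 * R.m * (1 - R.m) * (R.m * R.σ ^ 2 / R.p) + R.m ^ 2 * R.σ ^ 2) ≤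
        3 / R.p * (R.m * R.σ ^ 2) := by
      have h6 : 3 / R.p * (R.m * R.σ ^ 2) - ((1 - R.m) ^ 2 * (3 / R.p * (R.m * R.σ ^ 2)) +
          (2 * R.m * (1 - R.m) * (R.m * R.σ ^ 2 / R.p) + R.m ^ 2 * R.σ ^ 2)) =
          R.m ^ 2 * R.σ ^ 2 / R.p * (3 * (1 - R.m) + (1 - R.p) + 2 * R.m) := by
        field_simp
        ring
      have h7 : 0 ≤ R.m ^ 2 * R.σ ^ 2 / R.p * (3 * (1 - R.m) + (1 - R.p) + 2 * R.m) := by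
        have h8 : 0 ≤ 3 * (1 - R.m) + (1 - R.p) + 2 * R.m := by
          have := R.p_le_one
          linarith
        positivity
      linarith
    linarith

end Trial

/-! ### Descent along momentum steps -/

section Descent

variable {H : Type*} [NormedAddCommGroup H] [InnerProductSpace ℝ H] [CompleteSpace H]

/-- The descent lemma with `M` in place of `M / 2`, which the mean value inequality on the segment
yields without integration. -/
lemma le_add_inner_gradient {f : H → ℝ} {M : ℝ} (hf : Differentiable ℝ f) (hM : 0 ≤ M)
    (hL : ∀ w w', ‖gradient f w - gradient f w'‖ ≤ M * ‖w - w'‖) (w w' : H) :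
    f w' ≤ f w + inner ℝ (gradient f w) (w' - w) + M * ‖w' - w‖ ^ 2 := by
  have h := (convex_segment (𝕜 := ℝ) w w').norm_image_sub_le_of_norm_hasFDerivWithin_le'
    (f := f) (f' := fun z => InnerProductSpace.toDual ℝ H (gradient f z))
    (φ := InnerProductSpace.toDual ℝ H (gradient f w)) (C := M * ‖w' - w‖)
    (fun z _ => (hf z).hasGradientAt.hasFDerivAt.hasFDerivWithinAt)
    (fun z hz => by
      rw [← map_sub, LinearIsometryEquiv.norm_map]
      refine (hL z w).trans (mul_le_mul_of_nonneg_left ?_ hM)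
      rw [segment_eq_image'] at hz
      obtain ⟨t, ht, rfl⟩ := hz
      rw [add_sub_cancel_left, norm_smul, Real.norm_of_nonneg ht.1]
      exact mul_le_of_le_one_left (norm_nonneg _) ht.2)
    (left_mem_segment ℝ w w') (right_mem_segment ℝ w w')
  rw [InnerProductSpace.toDual_apply_apply, Real.norm_eq_abs] at h
  have h2 := le_of_abs_le h
  nlinarith

/-- A gradient step of length `1 / (2 * M)` decreases `f` by at least `‖gradient f w‖² / (4 * M)`,
which cannot exceed `Δ`. -/
lemma norm_sq_gradient_le {f : H → ℝ} {M Δ : ℝ} (hf : Differentiable ℝ f) (hM : 0 < M)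
    (hL : ∀ w w', ‖gradient f w - gradient f w'‖ ≤ M * ‖w - w'‖) {w : H}
    (hΔ : ∀ w', f w - f w' ≤ Δ) : ‖gradient f w‖ ^ 2 ≤ 4 * M * Δ := by
  have h1 := le_add_inner_gradient hf hM.le hL w (w - (2 * M)⁻¹ • gradient f w)
  have h2 := hΔ (w - (2 * M)⁻¹ • gradient f w)
  rw [sub_sub_cancel_left, norm_neg, inner_neg_right, inner_smul_right,
    real_inner_self_eq_norm_sq, norm_smul, Real.norm_of_nonneg (by positivity)] at h1
  have h3 : (2 * M)⁻¹ * ‖gradient f w‖ ^ 2 - M * ((2 * M)⁻¹ * ‖gradient f w‖) ^ 2 =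
      (4 * M)⁻¹ * ‖gradient f w‖ ^ 2 := by
    field_simp
    ring
  have h4 : (4 * M)⁻¹ * ‖gradient f w‖ ^ 2 ≤ Δ := by linarith
  rwa [inv_mul_le_iff₀ (by positivity)] at h4

lemma sum_real_le_of_contraction {ρ : ℝ} (hρ0 : 0 ≤ ρ) (hρ : ρ ≤ 1) {b f : ℕ → ℝ}
    (hb : ∀ n, 0 ≤ b n) (h : ∀ n, b (n + 1) ≤ (1 - ρ) * b n + f n) (N : ℕ) :
    ρ * ∑ n ∈ Finset.range N, b (n + 1) ≤ b 0 + ∑ n ∈ Finset.range N, f n := by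
  have key : ρ * ∑ n ∈ Finset.range N, b (n + 1) + (1 - ρ) * b N ≤
      (1 - ρ) * b 0 + ∑ n ∈ Finset.range N, f n := by
    induction N with
    | zero => simp
    | succ N ih =>
      rw [Finset.sum_range_succ, Finset.sum_range_succ]
      linarith [h N]
  have h1 := mul_nonneg (sub_nonneg.2 hρ) (hb N)
  have h2 := mul_nonneg hρ0 (hb 0)
  linarith

variable {f : H → ℝ} {M Δ γ m : ℝ} {w u A N B : ℕ → H}

omit [CompleteSpace H] in
-- Convexity of the square separates `r` at weight `m`; Young's inequality then splits `b + d`,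
-- giving up half of the contraction.
lemma norm_sq_momentum_step (hm : 0 < m) (hm1 : m < 1) (b d r : H) :
    ‖(1 - m) • (b + d) + m • r‖ ^ 2 ≤
      (1 - m / 2) * ‖b‖ ^ 2 + (2 / m * ‖d‖ ^ 2 + m * ‖r‖ ^ 2) := by
  have h0 : 0 ≤ 1 - m := by linarith
  have h1 : ‖(1 - m) • (b + d) + m • r‖ ≤ (1 - m) * (‖b‖ + ‖d‖) + m * ‖r‖ := by
    refine (norm_add_le _ _).trans ?_
    rw [norm_smul, norm_smul, Real.norm_of_nonneg h0, Real.norm_of_nonneg hm.le]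
    gcongr
    exact norm_add_le _ _
  refine (pow_le_pow_left₀ (norm_nonneg _) h1 2).trans ?_
  set x := ‖b‖
  set y := ‖d‖
  set z := ‖r‖
  have h2 : (1 - m) * (x + y) ^ 2 + m * z ^ 2 - ((1 - m) * (x + y) + m * z) ^ 2 =
      m * (1 - m) * (x + y - z) ^ 2 := by ring
  have h3 : 0 ≤ m * (1 - m) * (x + y - z) ^ 2 := by positivity
  have h4 : (1 - m / 2) * x ^ 2 + 2 / m * y ^ 2 - (1 - m) * (x + y) ^ 2 =
      (1 - m) * (m / 2) * (x - 2 / m * y) ^ 2 + m ^ 2 / 2 * x ^ 2 + (1 + m) * y ^ 2 := by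
    field_simp
    ring
  have h5 : 0 ≤ (1 - m) * (m / 2) * (x - 2 / m * y) ^ 2 + m ^ 2 / 2 * x ^ 2 + (1 + m) * y ^ 2 := by
    positivity
  linarith

/-- The deterministic part of the analysis of momentum steps with noise `N` and bias `B`. -/
lemma sum_norm_sq_gradient_le (hf : Differentiable ℝ f) (hM : 0 < M)
    (hL : ∀ w w', ‖gradient f w - gradient f w'‖ ≤ M * ‖w - w'‖)
    (hΔ : ∀ w', f (w 0) - f w' ≤ Δ) (hm : 0 < m) (hm1 : m < 1) (hγ : 0 < γ) (hγM : γ * M ≤ 1 / 4)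
    (hu0 : u 0 = 0) (hA0 : A 0 = 0) (hw : ∀ n, w (n + 1) = w n - γ • u (n + 1))
    (hu : ∀ n, u (n + 1) = (1 - m) • u n + m • (B n + N (n + 1) + gradient f (w n)))
    (hA : ∀ n, A (n + 1) = (1 - m) • A n + m • N (n + 1)) (T : ℕ) :
    1 / 2 * ∑ n ∈ Finset.range T, ‖gradient f (w n)‖ ^ 2 +
        1 / 4 * ∑ n ∈ Finset.range T, ‖u n‖ ^ 2 ≤
      Δ / γ + 8 * M * Δ / m + ∑ n ∈ Finset.range T, ‖A (n + 1)‖ ^ 2 +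
        (4 * (M * γ / m) ^ 2 * ∑ n ∈ Finset.range T, ‖u n‖ ^ 2 +
          2 * ∑ n ∈ Finset.range T, ‖B n‖ ^ 2) := by
  -- The momentum error with the averaged noise removed contracts at rate `m / 2`, driven only by
  -- bias and gradient variation. At `n = 0` truncated subtraction makes it minus the initial
  -- gradient.
  set e : ℕ → H := fun n => u n - A n - gradient f (w (n - 1)) with he
  have he1 : ∀ n, ‖e (n + 1)‖ ^ 2 ≤ (1 - m / 2) * ‖e n‖ ^ 2 +
      (2 / m * (M * γ * ‖u n‖) ^ 2 + m * ‖B n‖ ^ 2) := by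
    intro n
    have h1 : e (n + 1) = (1 - m) • (e n + (gradient f (w (n - 1)) - gradient f (w n))) +
        m • B n := by
      simp only [he, hu, hA, Nat.add_sub_cancel]
      module
    have h2 : ‖gradient f (w (n - 1)) - gradient f (w n)‖ ≤ M * γ * ‖u n‖ := by
      cases n with
      | zero => simp [hu0]
      | succ n =>
        refine (hL _ _).trans ?_
        rw [Nat.add_sub_cancel, hw, sub_sub_cancel, norm_smul, Real.norm_of_nonneg hγ.le, mul_assoc]
    rw [h1]
    refine (norm_sq_momentum_step hm hm1 _ _ _).trans ?_
    gcongr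
  have he2 := sum_real_le_of_contraction (by positivity : 0 ≤ m / 2) (by linarith)
    (b := fun n => ‖e n‖ ^ 2) (fun n => by positivity) he1 T
  -- Zero initial momentum leaves the whole initial gradient as error; divided by the rate `m / 2`,
  -- it becomes the term `8 * M * Δ / m`.
  have he0 : ‖e 0‖ ^ 2 ≤ 4 * M * Δ := by
    simp only [he, hu0, hA0, sub_zero, zero_sub, norm_neg, Nat.zero_sub]
    exact norm_sq_gradient_le hf hM hL hΔ
  rw [Finset.sum_add_distrib, ← Finset.mul_sum, ← Finset.mul_sum] at he2
  simp_rw [mul_pow (M * γ)] at he2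
  rw [← Finset.mul_sum] at he2
  have he3 : ∑ n ∈ Finset.range T, ‖e (n + 1)‖ ^ 2 ≤ 8 * M * Δ / m +
      (4 * (M * γ / m) ^ 2 * ∑ n ∈ Finset.range T, ‖u n‖ ^ 2 +
          2 * ∑ n ∈ Finset.range T, ‖B n‖ ^ 2) := by
    have h1 := mul_le_mul_of_nonneg_left (he2.trans (add_le_add_left he0 _))
      (by positivity : 0 ≤ 2 / m)
    have h2 : 2 / m * (m / 2 * ∑ n ∈ Finset.range T, ‖e (n + 1)‖ ^ 2) =
        ∑ n ∈ Finset.range T, ‖e (n + 1)‖ ^ 2 := by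
      field_simp
    rw [h2] at h1
    refine h1.trans (le_of_eq ?_)
    field_simp
    ring
  have hd : ∀ n, γ / 2 * ‖gradient f (w n)‖ ^ 2 + γ / 4 * ‖u (n + 1)‖ ^ 2 ≤
      f (w n) - f (w (n + 1)) + γ * (‖A (n + 1)‖ ^ 2 + ‖e (n + 1)‖ ^ 2) := by
    intro n
    have h1 := le_add_inner_gradient hf hM.le hL (w n) (w (n + 1))
    have h2 : w (n + 1) - w n = -(γ • u (n + 1)) := by rw [hw]; abel
    rw [h2, norm_neg, norm_smul, Real.norm_of_nonneg hγ.le, inner_neg_right,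
      inner_smul_right] at h1
    have h3 := norm_sub_sq_real (u (n + 1)) (gradient f (w n))
    rw [real_inner_comm] at h3
    have h4 : u (n + 1) - gradient f (w n) = A (n + 1) + e (n + 1) := by
      simp only [he, Nat.add_sub_cancel]
      abel
    have h5 : ‖u (n + 1) - gradient f (w n)‖ ^ 2 ≤ 2 * (‖A (n + 1)‖ ^ 2 + ‖e (n + 1)‖ ^ 2) := by
      rw [h4]
      exact (pow_le_pow_left₀ (norm_nonneg _) (norm_add_le _ _) 2).trans add_sq_le
    have h6 : γ / 2 * ‖u (n + 1) - gradient f (w n)‖ ^ 2 ≤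
        γ * (‖A (n + 1)‖ ^ 2 + ‖e (n + 1)‖ ^ 2) := by nlinarith
    -- Polarization of the inner product provides `-γ / 2 * ‖u (n + 1)‖ ^ 2`. Half of it pays for
    -- the quadratic term; the other half remains to absorb bias and variation.
    have h7 : M * (γ * ‖u (n + 1)‖) ^ 2 ≤ γ / 4 * ‖u (n + 1)‖ ^ 2 := by
      have := mul_le_mul_of_nonneg_left hγM (by positivity : 0 ≤ γ * ‖u (n + 1)‖ ^ 2)
      linarith
    rw [h3] at h6
    linarith
  have hs := Finset.sum_le_sum fun n (_ : n ∈ Finset.range T) => hd n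
  simp only [Finset.sum_add_distrib, ← Finset.mul_sum] at hs
  rw [Finset.sum_range_sub'] at hs
  have hs2 := hs.trans (add_le_add_left (hΔ (w T)) _)
  have hs3 := mul_le_mul_of_nonneg_left hs2 (by positivity : 0 ≤ γ⁻¹)
  have hu1 : ∑ n ∈ Finset.range T, ‖u n‖ ^ 2 ≤ ∑ n ∈ Finset.range T, ‖u (n + 1)‖ ^ 2 := by
    have h1 := Finset.sum_range_succ (fun n => ‖u n‖ ^ 2) T
    have h2 := Finset.sum_range_succ' (fun n => ‖u n‖ ^ 2) T
    rw [hu0, norm_zero] at h2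
    have h3 : 0 ≤ ‖u T‖ ^ 2 := by positivity
    linarith
  have hs4 : γ⁻¹ * (γ / 2 * ∑ n ∈ Finset.range T, ‖gradient f (w n)‖ ^ 2 +
      γ / 4 * ∑ n ∈ Finset.range T, ‖u (n + 1)‖ ^ 2) =
      1 / 2 * ∑ n ∈ Finset.range T, ‖gradient f (w n)‖ ^ 2 +
      1 / 4 * ∑ n ∈ Finset.range T, ‖u (n + 1)‖ ^ 2 := by
    field_simp
  have hs5 : γ⁻¹ * (Δ + γ * (∑ n ∈ Finset.range T, ‖A (n + 1)‖ ^ 2 +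
      ∑ n ∈ Finset.range T, ‖e (n + 1)‖ ^ 2)) = Δ / γ +
      (∑ n ∈ Finset.range T, ‖A (n + 1)‖ ^ 2 + ∑ n ∈ Finset.range T, ‖e (n + 1)‖ ^ 2) := by
    field_simp
  rw [hs4, hs5] at hs3
  linarith

end Descent

/-! ### Choice of the step size relative to the momentum coefficient -/

/-- The quotient of step size and momentum coefficient. -/
def stepRatio (E : ℕ) (M p : ℝ) : ℝ := 1 / (8 * (M + (biasConst E M p).toReal))

lemma stepRatio_pos (E : ℕ) {M : ℝ} (hM : 1 ≤ M) (p : ℝ) : 0 < stepRatio E M p := by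
  have : 0 ≤ (biasConst E M p).toReal := ENNReal.toReal_nonneg
  unfold stepRatio
  positivity

lemma stepRatio_mul_le (E : ℕ) {M : ℝ} (hM : 1 ≤ M) (p : ℝ) : stepRatio E M p * M ≤ 1 / 4 := by
  have : 0 ≤ (biasConst E M p).toReal := ENNReal.toReal_nonneg
  unfold stepRatio
  rw [div_mul_eq_mul_div, div_le_iff₀ (by positivity)]
  linarith

/-- The right-hand side is the coefficient of `∑ ‖u n‖ ^ 2` retained in `sum_norm_sq_gradient_le`;
the left-hand side collects what gradient variation and bias cost. `1 ≤ M` handles the term linear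
in the bias constant. -/
lemma stepRatio_absorb (E : ℕ) {M : ℝ} (hM : 1 ≤ M) (p : ℝ) :
    4 * (M * stepRatio E M p) ^ 2 + 2 * ((biasConst E M p).toReal * stepRatio E M p ^ 2) ≤
      1 / 4 := by
  have hK : 0 ≤ (biasConst E M p).toReal := ENNReal.toReal_nonneg
  unfold stepRatio
  set K := (biasConst E M p).toReal
  have h1 : 4 * (M * (1 / (8 * (M + K)))) ^ 2 + 2 * (K * (1 / (8 * (M + K))) ^ 2) =
      (4 * M ^ 2 + 2 * K) / (64 * (M + K) ^ 2) := by
    field_simp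
    ring
  rw [h1, div_le_iff₀ (by positivity)]
  nlinarith [mul_nonneg (sub_nonneg.2 hM) hK]

namespace Trial

variable {E : ℕ} {S Ω : Type*} [MeasurableSpace S] [MeasurableSpace Ω] (R : Trial E S Ω)

/-! ### Expectations -/

lemma u_succ_eq (n : ℕ) (ω : Ω) :
    R.u (n + 1) ω = (1 - R.m) • R.u n ω + R.m • (R.bias n ω + R.noise (n + 1) ω +
      gradient (R.P.risk R.D) (R.w n ω)) := by
  rw [u_succ, bias, G]
  congr 2
  abel

lemma measurable_G (n : ℕ) : Measurable (R.G n) :=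
  R.continuous_gradient_risk.measurable.comp (R.measurable_w n)

lemma measurable_bias (n : ℕ) : Measurable (R.bias n) :=
  (((R.adapted n).g_stage.mono (R.info_le _) le_rfl).sub (R.measurable_noise (n + 1))).sub
    (R.measurable_G n)

lemma memLp_G (n : ℕ) : MemLp (R.G n) 2 R.μ :=
  MemLp.of_bound (R.measurable_G n).aestronglyMeasurable R.gradBound
    (Filter.Eventually.of_forall fun _ => R.norm_gradient_risk_le _)

lemma memLp_noise (n : ℕ) : MemLp (R.noise n) 2 R.μ :=
  MemLp.of_bound (R.measurable_noise n).aestronglyMeasurable (2 * R.gradBound)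
    (Filter.Eventually.of_forall fun ω => R.norm_noise_le n ω)

lemma lintegral_enorm_sq_eq {V : Type*} [NormedAddCommGroup V] {μ : Measure Ω} {f : Ω → V}
    (hf : MemLp f 2 μ) : ∫⁻ ω, ‖f ω‖ₑ ^ 2 ∂μ = ENNReal.ofReal (∫ ω, ‖f ω‖ ^ 2 ∂μ) := by
  rw [ofReal_integral_eq_lintegral_ofReal hf.norm.integrable_sq
    (Filter.Eventually.of_forall fun ω => by positivity)]
  simp_rw [enorm_sq_eq_ofReal]

lemma memLp_two_of_lintegral_ne_top {V : Type*} [NormedAddCommGroup V] {μ : Measure Ω} {f : Ω → V}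
    (hf : AEStronglyMeasurable f μ) (h : ∫⁻ ω, ‖f ω‖ₑ ^ 2 ∂μ ≠ ⊤) : MemLp f 2 μ := by
  refine ⟨hf, ?_⟩
  rw [eLpNorm_lt_top_iff_lintegral_rpow_enorm_lt_top two_ne_zero ENNReal.ofNat_ne_top]
  simpa using lt_top_iff_ne_top.2 h

/-- One summand of `sum_bias_le` is bounded by the whole right-hand side, which involves the momenta
only up to time `n`. This lets square integrability of momentum and bias be established by a joint
induction. -/
lemma memLp_bias_of_memLp_u (n : ℕ) (h : ∀ k ≤ n, MemLp (R.u k) 2 R.μ) :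
    MemLp (R.bias n) 2 R.μ := by
  refine memLp_two_of_lintegral_ne_top (R.measurable_bias n).aestronglyMeasurable ?_
  refine ne_top_of_le_ne_top (ENNReal.mul_ne_top (biasConst_ne_top E R.M R.p_pos) ?_)
    ((Finset.single_le_sum (f := fun n => ∫⁻ ω, ‖R.bias n ω‖ₑ ^ 2 ∂(R.μ))
      (fun _ _ => zero_le) (Finset.self_mem_range_succ n)).trans (R.sum_bias_le (n + 1)))
  refine ENNReal.mul_ne_top (by finiteness) (ENNReal.sum_ne_top.2 fun k hk => ?_)
  rw [uSq, lintegral_enorm_sq_eq (h k (Nat.lt_succ_iff.1 (Finset.mem_range.1 hk)))]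
  exact ENNReal.ofReal_ne_top

lemma memLp_u (n : ℕ) : MemLp (R.u n) 2 R.μ := by
  induction n using Nat.strong_induction_on with
  | _ n ih =>
    cases n with
    | zero =>
      have : R.u 0 = 0 := rfl
      rw [this]
      exact MemLp.zero
    | succ n =>
      have hb := R.memLp_bias_of_memLp_u n fun k hk => ih k (Nat.lt_succ_of_le hk)
      have h := ((ih n n.lt_succ_self).const_smul (1 - R.m)).add
        (((hb.add (R.memLp_noise (n + 1))).add (R.memLp_G n)).const_smul R.m)
      rw [show R.u (n + 1) = _ from funext (R.u_succ_eq n)]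
      exact h

lemma memLp_bias (n : ℕ) : MemLp (R.bias n) 2 R.μ :=
  R.memLp_bias_of_memLp_u n fun k _ => R.memLp_u k

lemma integrable_norm_sq_u (n : ℕ) : Integrable (fun ω => ‖R.u n ω‖ ^ 2) R.μ :=
  (R.memLp_u n).norm.integrable_sq

lemma integrable_norm_sq_bias (n : ℕ) : Integrable (fun ω => ‖R.bias n ω‖ ^ 2) R.μ :=
  (R.memLp_bias n).norm.integrable_sq

lemma integrable_norm_sq_G (n : ℕ) : Integrable (fun ω => ‖R.G n ω‖ ^ 2) R.μ :=
  (R.memLp_G n).norm.integrable_sq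

lemma sum_integral_bias_le (N : ℕ) :
    ∑ n ∈ Finset.range N, ∫ ω, ‖R.bias n ω‖ ^ 2 ∂(R.μ) ≤
      (biasConst E R.M R.p).toReal *
        (R.γ ^ 2 * ∑ n ∈ Finset.range N, ∫ ω, ‖R.u n ω‖ ^ 2 ∂(R.μ)) := by
  have h := R.sum_bias_le N
  have hu : ∀ n, 0 ≤ ∫ ω, ‖R.u n ω‖ ^ 2 ∂(R.μ) := fun n => integral_nonneg fun _ => by positivity
  have hb : ∀ n, 0 ≤ ∫ ω, ‖R.bias n ω‖ ^ 2 ∂(R.μ) := fun n => integral_nonneg fun _ => by positivity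
  simp_rw [travel, uSq, lintegral_enorm_sq_eq (R.memLp_u _),
    lintegral_enorm_sq_eq (R.memLp_bias _)] at h
  rw [← ENNReal.ofReal_sum_of_nonneg fun n _ => hb n,
    ← ENNReal.ofReal_sum_of_nonneg fun n _ => hu n, ← ENNReal.ofReal_pow R.γ_pos.le,
    ← ENNReal.ofReal_mul (by positivity), ← ENNReal.ofReal_toReal (biasConst_ne_top E R.M R.p_pos),
    ← ENNReal.ofReal_mul ENNReal.toReal_nonneg] at h
  exact (ENNReal.ofReal_le_ofReal_iff (mul_nonneg ENNReal.toReal_nonneg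
    (mul_nonneg (by positivity) (Finset.sum_nonneg fun n _ => hu n)))).1 h

/-- The pathwise descent inequality is integrated, and the momentum terms on its right-hand side are
absorbed on the left. -/
lemma sum_integral_norm_sq_G_le {Δ : ℝ} (hΔ : ∀ w, R.P.risk R.D R.w₁ - R.P.risk R.D w ≤ Δ)
    (hγ : R.γ = stepRatio E R.M R.p * R.m) (T : ℕ) :
    ∑ n ∈ Finset.range T, ∫ ω, ‖R.G n ω‖ ^ 2 ∂(R.μ) ≤
      (2 * Δ / stepRatio E R.M R.p + 16 * R.M * Δ) / R.m +
        6 / R.p * (R.m * R.σ ^ 2) * T := by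
  have hm := R.m_pos
  have hc := stepRatio_pos E R.one_le_M R.p
  set c := stepRatio E R.M R.p with hcdef
  have hM : 0 < R.M := lt_of_lt_of_le one_pos R.one_le_M
  have hγM : R.γ * R.M ≤ 1 / 4 := by
    have h1 := stepRatio_mul_le E R.one_le_M R.p
    rw [hγ]
    have h2 : 0 ≤ c * R.M := by positivity
    nlinarith [R.m_lt_one]
  have hpath := fun ω => sum_norm_sq_gradient_le (w := fun n => R.w n ω) (u := fun n => R.u n ω)
    (A := fun n => R.avgNoise n ω) (N := fun n => R.noise n ω) (B := fun n => R.bias n ω)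
    R.smooth.risk_differentiable hM R.smooth.risk_lipschitz hΔ hm R.m_lt_one R.γ_pos hγM rfl rfl
    (fun n => R.w_succ n ω) (fun n => R.u_succ_eq n ω) (fun n => R.avgNoise_succ n ω) T
  have iG := fun n (_ : n ∈ Finset.range T) => R.integrable_norm_sq_G n
  have iu := fun n (_ : n ∈ Finset.range T) => R.integrable_norm_sq_u n
  have iA := fun n (_ : n ∈ Finset.range T) => R.integrable_norm_sq_avgNoise (n + 1)
  have iB := fun n (_ : n ∈ Finset.range T) => R.integrable_norm_sq_bias n
  have jG := (integrable_finsetSum _ iG).const_mul (1 / 2)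
  have ju := (integrable_finsetSum _ iu).const_mul (1 / 4)
  have ju' := (integrable_finsetSum _ iu).const_mul (4 * (R.M * R.γ / R.m) ^ 2)
  have jA := integrable_finsetSum _ iA
  have jB := (integrable_finsetSum _ iB).const_mul 2
  have jK : Integrable (fun _ : Ω => Δ / R.γ + 8 * R.M * Δ / R.m) R.μ := integrable_const _
  have hexp := integral_mono (jG.add ju) ((jK.add jA).add (ju'.add jB)) hpath
  rw [integral_add' jG ju, integral_add' (jK.add jA) (ju'.add jB), integral_add' jK jA,
    integral_add' ju' jB, integral_const_mul, integral_const_mul, integral_const_mul,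
    integral_const_mul, integral_finsetSum _ iG, integral_finsetSum _ iu,
    integral_finsetSum _ iA, integral_finsetSum _ iB, integral_const, probReal_univ, one_smul]
    at hexp
  have hA : ∑ n ∈ Finset.range T, ∫ ω, ‖R.avgNoise (n + 1) ω‖ ^ 2 ∂(R.μ) ≤
      3 / R.p * (R.m * R.σ ^ 2) * T := by
    calc _ ≤ ∑ _n ∈ Finset.range T, 3 / R.p * (R.m * R.σ ^ 2) :=
          Finset.sum_le_sum fun n _ => R.integral_norm_sq_avgNoise_le (n + 1)
      _ = _ := by
          rw [Finset.sum_const, Finset.card_range, nsmul_eq_mul]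
          ring
  have hB := R.sum_integral_bias_le T
  have hU : 0 ≤ ∑ n ∈ Finset.range T, ∫ ω, ‖R.u n ω‖ ^ 2 ∂(R.μ) :=
    Finset.sum_nonneg fun n _ => integral_nonneg fun _ => by positivity
  set U := ∑ n ∈ Finset.range T, ∫ ω, ‖R.u n ω‖ ^ 2 ∂(R.μ)
  have hK : 0 ≤ (biasConst E R.M R.p).toReal := ENNReal.toReal_nonneg
  -- For the bias `γ ≤ c` is enough; the variation term contains `γ / m`, which equals `c` exactly
  -- and forces the proportionality of `γ` and `m`.
  have hγ2 : R.γ ^ 2 ≤ c ^ 2 := by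
    rw [hγ, mul_pow]
    exact mul_le_of_le_one_right (by positivity) (pow_le_one₀ hm.le R.m_lt_one.le)
  have hB2 : (biasConst E R.M R.p).toReal * (R.γ ^ 2 * U) ≤
      (biasConst E R.M R.p).toReal * c ^ 2 * U := by
    rw [mul_assoc]
    gcongr
  have hMγ : R.M * R.γ / R.m = R.M * c := by
    rw [hγ]
    field_simp
  have habs := mul_le_mul_of_nonneg_right (stepRatio_absorb E R.one_le_M R.p) hU
  rw [← hcdef] at habs
  rw [hMγ] at hexp
  have hΔγ : Δ / R.γ = Δ / c / R.m := by rw [hγ, div_div]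
  rw [hΔγ] at hexp
  have hfin : (2 * Δ / c + 16 * R.M * Δ) / R.m = 2 * (Δ / c / R.m + 8 * R.M * Δ / R.m) := by
    field_simp
    ring
  rw [hfin]
  have hA2 : 6 / R.p * (R.m * R.σ ^ 2) * T = 2 * (3 / R.p * (R.m * R.σ ^ 2) * T) := by ring
  rw [hA2]
  linarith

end Trial

/-! ### The momentum coefficient and the final rate -/

/-- The constant in the convergence rate. -/
def rateConst (E : ℕ) (M Δ p : ℝ) : ℝ :=
  2 * (2 * Δ / stepRatio E M p + 16 * M * Δ) + 6 / p

/-- The momentum coefficient. -/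
def momentum (σ : ℝ) (T : ℕ) : ℝ := 1 / (2 + σ * Real.sqrt T)

lemma momentum_pos {σ : ℝ} (hσ : 0 ≤ σ) (T : ℕ) : 0 < momentum σ T := by
  unfold momentum
  positivity

lemma momentum_lt_one {σ : ℝ} (hσ : 0 ≤ σ) (T : ℕ) : momentum σ T < 1 := by
  have h : 0 ≤ σ * Real.sqrt T := by positivity
  unfold momentum
  rw [div_lt_one (by positivity)]
  linarith

lemma rateConst_pos (E : ℕ) {M Δ p : ℝ} (hM : 1 ≤ M) (hΔ : 0 ≤ Δ) (hp : 0 < p) :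
    0 < rateConst E M Δ p := by
  have := stepRatio_pos E hM p
  unfold rateConst
  positivity

/-- The momentum coefficient balances both terms: `1 / (m T) = 2 / T + σ / √T` and `m σ² ≤ σ / √T`.
The summand `2` keeps `m` below `1` even when `σ = 0`. -/
lemma rate_le {a b σ : ℝ} (ha : 0 ≤ a) (hb : 0 ≤ b) (hσ : 0 ≤ σ) {T : ℕ} (hT : 1 ≤ T) :
    1 / (T : ℝ) * (a / momentum σ T + b * (momentum σ T * σ ^ 2) * T) ≤
      (2 * a + b) * (σ / Real.sqrt T + 1 / T) := by
  have hT0 : (0 : ℝ) < T := by exact_mod_cast hT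
  have hs : 0 < Real.sqrt T := Real.sqrt_pos.2 hT0
  have hsq : (T : ℝ) = Real.sqrt T ^ 2 := (Real.sq_sqrt hT0.le).symm
  unfold momentum
  set s := Real.sqrt T
  rw [hsq]
  have h1 : 1 / (2 + σ * s) * σ ^ 2 ≤ σ / s := by
    rw [div_mul_eq_mul_div, div_le_div_iff₀ (by positivity) hs]
    nlinarith [mul_nonneg hσ hs.le]
  have h2 : 1 / s ^ 2 * (a / (1 / (2 + σ * s)) + b * (1 / (2 + σ * s) * σ ^ 2) * s ^ 2) =
      a * (2 * (1 / s ^ 2) + σ / s) + b * (1 / (2 + σ * s) * σ ^ 2) := by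
    field_simp
  rw [h2]
  have h3 := mul_le_mul_of_nonneg_left h1 hb
  have h4 : 0 ≤ σ / s := by positivity
  have h5 : 0 ≤ 1 / s ^ 2 := by positivity
  nlinarith [mul_nonneg ha h4, mul_nonneg hb h5]

lemma sum_Icc_one_eq_sum_range (f : ℕ → ℝ) (T : ℕ) :
    ∑ t ∈ Finset.Icc 1 T, f (t - 1) = ∑ n ∈ Finset.range T, f n := by
  induction T with
  | zero => simp
  | succ T ih =>
    rw [Finset.sum_Icc_succ_top (Nat.succ_le_succ (Nat.zero_le T)), Finset.sum_range_succ, ih,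
      Nat.add_sub_cancel]

/-- Convergence of Clapping-FU, with explicit constants and parameters. -/
theorem convergence {E : ℕ} {Ll Ca La LG Δ M p σ ωF ωB : ℝ} (hΔ : 0 ≤ Δ) (hM : 1 ≤ M)
    (h1 : Ll ≤ M) (h2 : Ca ≤ M) (h3 : La ≤ M) (h4 : LG ≤ M) (hp : 0 < p) (hp1 : p ≤ 1) {T : ℕ}
    (hσ : 0 ≤ σ) (hF0 : 0 ≤ ωF) (hF1 : ωF < 1) (hB0 : 0 ≤ ωB) (hB1 : ωB < 1) (hT : 1 ≤ T)
    (P : Pipeline E) (D : Measure (P.Act 0)) [IsProbabilityMeasure D]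
    {S : Type*} [MeasurableSpace S] {ν : Measure S} [IsProbabilityMeasure ν]
    {CF CB : P.Compressor S} (w₁ : P.Params)
    {Ω : Type*} [MeasurableSpace Ω] {μ : Measure Ω} [IsProbabilityMeasure μ] (X : P.Source S Ω)
    (hS : P.Smooth D Ll Ca La LG) (hfirst : p = 1 ∨ P.FirstLayerSmooth LG) (hU : P.Unbiased D σ)
    (hCF : P.Contractive ν CF ωF) (hCB : P.Contractive ν CB ωB)
    (hgap : ∀ w, P.risk D w₁ - P.risk D w ≤ Δ) (hX : X.IsDriver D ν p μ) :
    (∀ t, Integrable (fun ω => ‖gradient (P.risk D) (P.weights CF CB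
        (stepRatio E M p * momentum σ T) (momentum σ T) w₁ X t ω)‖ ^ 2) μ) ∧
      1 / (T : ℝ) * ∑ t ∈ Finset.Icc 1 T, ∫ ω, ‖gradient (P.risk D) (P.weights CF CB
          (stepRatio E M p * momentum σ T) (momentum σ T) w₁ X t ω)‖ ^ 2 ∂μ
        ≤ rateConst E M Δ p *
          (σ / Real.sqrt T + 1 / (T * (1 - ωB) ^ (E - 1) * (1 - ωF) ^ (E - 1))) := by
  -- The contraction constants are given up here; only the bound with constant `1` is used
  -- afterwards.
  have contract : ∀ {C : P.Compressor S} {ω : ℝ}, 0 ≤ ω → ω < 1 → P.Contractive ν C ω →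
      P.Contractive ν C 1 := fun h0 h1 h => ⟨h.measurable, fun i hi hi' z =>
    (h.contractive i hi hi' z).trans (ENNReal.ofReal_le_ofReal (by gcongr))⟩
  let R : Trial E S Ω :=
    { P := P, D := D, ν := ν, μ := μ, CF := CF, CB := CB, w₁ := w₁, X := X, M := M, p := p, σ := σ
      γ := stepRatio E M p * momentum σ T
      m := momentum σ T
      probD := inferInstance
      probν := inferInstance
      probμ := inferInstance
      one_le_M := hM
      p_pos := hp
      p_le_one := hp1
      γ_pos := mul_pos (stepRatio_pos E hM p) (momentum_pos hσ T)
      m_pos := momentum_pos hσ T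
      m_lt_one := momentum_lt_one hσ T
      smooth := hS.mono h1 h2 h3 h4
      first := hfirst.imp_right fun h e he x w w' => (h e he x w w').trans (by gcongr)
      unbiased := hU
      contractF := contract hF0 hF1 hCF
      contractB := contract hB0 hB1 hCB
      driver := hX }
  refine ⟨fun t => R.integrable_norm_sq_G (t - 1), ?_⟩
  have hc := stepRatio_pos E hM p
  have hT0 : (0 : ℝ) < T := by exact_mod_cast hT
  have hsum := R.sum_integral_norm_sq_G_le hgap rfl T
  have hrange := sum_Icc_one_eq_sum_range (fun n => ∫ ω, ‖R.G n ω‖ ^ 2 ∂μ) T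
  have hrate := rate_le (a := 2 * Δ / stepRatio E M p + 16 * M * Δ) (b := 6 / p)
    (by positivity) (by positivity) hσ hT
  -- The compression factors are at most `1` and stand in a denominator, so inserting them only
  -- weakens the rate.
  have hω : 1 / (T : ℝ) ≤ 1 / (T * (1 - ωB) ^ (E - 1) * (1 - ωF) ^ (E - 1)) := by
    have hB : 0 < (1 - ωB) ^ (E - 1) := pow_pos (by linarith) _
    have hF : 0 < (1 - ωF) ^ (E - 1) := pow_pos (by linarith) _
    have hB' : (1 - ωB) ^ (E - 1) ≤ 1 := pow_le_one₀ (by linarith) (by linarith)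
    have hF' : (1 - ωF) ^ (E - 1) ≤ 1 := pow_le_one₀ (by linarith) (by linarith)
    refine one_div_le_one_div_of_le (by positivity) ?_
    rw [mul_assoc]
    exact mul_le_of_le_one_right hT0.le (mul_le_one₀ hB' hF.le hF')
  calc _ = 1 / (T : ℝ) * ∑ n ∈ Finset.range T, ∫ ω, ‖R.G n ω‖ ^ 2 ∂μ :=
        congrArg (1 / (T : ℝ) * ·) hrange
    _ ≤ 1 / (T : ℝ) * ((2 * Δ / stepRatio E M p + 16 * M * Δ) / momentum σ T +
        6 / p * (momentum σ T * σ ^ 2) * T) := mul_le_mul_of_nonneg_left hsum (by positivity)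
    _ ≤ rateConst E M Δ p * (σ / Real.sqrt T + 1 / T) := hrate
    _ ≤ _ := mul_le_mul_of_nonneg_left (by gcongr) (rateConst_pos E hM hΔ hp).le

end Clapping

end

/-! ### The theorem -/

theorem mainTheorem2 (E : ℕ) (hE : 2 ≤ E) (Ll Ca La LG Δ : ℝ)
    (hLl : 0 ≤ Ll) (hCa : 0 ≤ Ca) (hLa : 0 ≤ La) (hLG : 0 ≤ LG) (hΔ : 0 ≤ Δ) :
    -- some constant lazy sampling coefficient works under the standing assumptions alone
    (∃ p : ℝ, 0 < p ∧ p ≤ 1 ∧ ∃ C : ℝ, 0 < C ∧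
      ∀ (σ ωF ωB : ℝ) (T : ℕ), 0 ≤ σ → 0 ≤ ωF → ωF < 1 → 0 ≤ ωB → ωB < 1 → 1 ≤ T →
      ∃ γ m : ℝ, 0 < γ ∧ 0 < m ∧ m < 1 ∧
      ∀ (P : Clapping.Pipeline E) (D : Measure (P.Act 0)) [IsProbabilityMeasure D]
        (S : Type*) [MeasurableSpace S] (ν : Measure S) [IsProbabilityMeasure ν]
        (CF CB : P.Compressor S) (w₁ : P.Params)
        (Ω : Type*) [MeasurableSpace Ω] (μ : Measure Ω) [IsProbabilityMeasure μ]
        (X : P.Source S Ω),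
        P.Smooth D Ll Ca La LG → P.Unbiased D σ →
        P.Contractive ν CF ωF → P.Contractive ν CB ωB →
        (∀ w, P.risk D w₁ - P.risk D w ≤ Δ) → X.IsDriver D ν p μ →
        (∀ t, Integrable
          (fun ω => ‖gradient (P.risk D) (P.weights CF CB γ m w₁ X t ω)‖ ^ 2) μ) ∧
        1 / (T : ℝ) * ∑ t ∈ Finset.Icc 1 T,
            ∫ ω, ‖gradient (P.risk D) (P.weights CF CB γ m w₁ X t ω)‖ ^ 2 ∂μ
          ≤ C * (σ / Real.sqrt T + 1 / (T * (1 - ωB) ^ (E - 1) * (1 - ωF) ^ (E - 1)))) ∧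
    -- every constant lazy sampling coefficient works if the first operator is smooth in its weights
    (∀ p : ℝ, 0 < p → p ≤ 1 → ∃ C : ℝ, 0 < C ∧
      ∀ (σ ωF ωB : ℝ) (T : ℕ), 0 ≤ σ → 0 ≤ ωF → ωF < 1 → 0 ≤ ωB → ωB < 1 → 1 ≤ T →
      ∃ γ m : ℝ, 0 < γ ∧ 0 < m ∧ m < 1 ∧
      ∀ (P : Clapping.Pipeline E) (D : Measure (P.Act 0)) [IsProbabilityMeasure D]
        (S : Type*) [MeasurableSpace S] (ν : Measure S) [IsProbabilityMeasure ν]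
        (CF CB : P.Compressor S) (w₁ : P.Params)
        (Ω : Type*) [MeasurableSpace Ω] (μ : Measure Ω) [IsProbabilityMeasure μ]
        (X : P.Source S Ω),
        P.Smooth D Ll Ca La LG → P.FirstLayerSmooth LG → P.Unbiased D σ →
        P.Contractive ν CF ωF → P.Contractive ν CB ωB →
        (∀ w, P.risk D w₁ - P.risk D w ≤ Δ) → X.IsDriver D ν p μ →
        (∀ t, Integrable
          (fun ω => ‖gradient (P.risk D) (P.weights CF CB γ m w₁ X t ω)‖ ^ 2) μ) ∧
        1 / (T : ℝ) * ∑ t ∈ Finset.Icc 1 T,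
            ∫ ω, ‖gradient (P.risk D) (P.weights CF CB γ m w₁ X t ω)‖ ^ 2 ∂μ
          ≤ C * (σ / Real.sqrt T + 1 / (T * (1 - ωB) ^ (E - 1) * (1 - ωF) ^ (E - 1)))) := by
  -- A single constant that dominates all smoothness constants and is at least `1`.
  have hM : 1 ≤ 1 + Ll + Ca + La + LG := by linarith
  have h1 : Ll ≤ 1 + Ll + Ca + La + LG := by linarith
  have h2 : Ca ≤ 1 + Ll + Ca + La + LG := by linarith
  have h3 : La ≤ 1 + Ll + Ca + La + LG := by linarith
  have h4 : LG ≤ 1 + Ll + Ca + La + LG := by linarith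
  constructor
  -- With `p = 1` almost surely every iteration is fresh, so neither compression nor drift occurs
  -- and the first layer needs no smoothness in its weights.
  · refine ⟨1, one_pos, le_rfl, Clapping.rateConst E (1 + Ll + Ca + La + LG) Δ 1,
      Clapping.rateConst_pos E hM hΔ one_pos, ?_⟩
    intro σ ωF ωB T hσ hF0 hF1 hB0 hB1 hT
    -- The step size and the momentum coefficient are determined by the positivity proofs:
    -- `stepRatio * momentum` and `momentum`.
    refine ⟨_, _, mul_pos (Clapping.stepRatio_pos E hM 1) (Clapping.momentum_pos hσ T),
      Clapping.momentum_pos hσ T, Clapping.momentum_lt_one hσ T, ?_⟩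
    intro P D _ S _ ν _ CF CB w₁ Ω _ μ _ X hS hU hCF hCB hgap hX
    exact Clapping.convergence hΔ hM h1 h2 h3 h4 one_pos le_rfl hσ hF0 hF1 hB0 hB1 hT P D w₁ X hS
      (Or.inl rfl) hU hCF hCB hgap hX
  · intro p hp hp1
    refine ⟨Clapping.rateConst E (1 + Ll + Ca + La + LG) Δ p,
      Clapping.rateConst_pos E hM hΔ hp, ?_⟩
    intro σ ωF ωB T hσ hF0 hF1 hB0 hB1 hT
    refine ⟨_, _, mul_pos (Clapping.stepRatio_pos E hM p) (Clapping.momentum_pos hσ T),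
      Clapping.momentum_pos hσ T, Clapping.momentum_lt_one hσ T, ?_⟩
    intro P D _ S _ ν _ CF CB w₁ Ω _ μ _ X hS hFirst hU hCF hCB hgap hX
    exact Clapping.convergence hΔ hM h1 h2 h3 h4 hp hp1 hσ hF0 hF1 hB0 hB1 hT P D w₁ X hS
      (Or.inr hFirst) hU hCF hCB hgap hX
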